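/- **Setting.** Let $F$ be a field with a valuation $\nu:F^\times\to\Gamma$ ($\nu(0)=\infty$), $\Gamma$ a totally ordered abelian group with a least positive element $1$; let $O_F=\{x:\nu(x)\ge0\}$, and let $t:\Gamma\to F^\times$ be a homomorphism with $\nu\circ t=\mathrm{id}_\Gamma$. Assume that the residue field $K=\overline F$ carries a topology making it a local field ($\mathbb R$, $\mathbb C$ or non-archimedean); fix a Haar measure on $(K,+)$ and let $|\cdot|_K$ be the normalized absolute value of $K$, i.e. multiplication by $\alpha$ scales Haar measure by $|\alpha|_K$. Write $\bar x$ for the residue of $x\in O_F$, and for $x\in F^\times$ put $\eta(x)=\overline{x\,t(-\nu(x))}$. Let $\mathbb C(\Gamma)$ be the field of fractions of the complex group algebra of $\Gamma$, with $X^\gamma$ the basis element of $\gamma\in\Gamma$, and put $|x|=|\eta(x)|_K\,X^{\nu(x)}$ for $x\in F^\times$. For $g:K\to\mathbb C$, $a\in F$, $\gamma\in\Gamma$ let $g^{a,\gamma}:F\to\mathbb C$ be the lift of $g$: $g^{a,\gamma}(x)=g\big(\overline{(x-a)t(-\gamma)}\big)$ for $x\in a+t(\gamma)O_F$ and $g^{a,\gamma}(x)=0$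 otherwise. Let $\psi:F\to S^1$ be a good additive character of conductor $1$: a homomorphism which is trivial on $t(1)O_F$, non-trivial on $O_F$, and for which the induced character of $K$ is continuous. Put $\psi_b(x)=\psi(bx)$. Let $\mathcal L(F)$ be the $\mathbb C(\Gamma)$-space of functions $F\to\mathbb C(\Gamma)$ spanned by the $g^{a,\gamma}$ with $g$ Haar integrable; let $\mathcal L(F,\psi)$ be the $\mathbb C(\Gamma)$-span of the functions $f\psi_b$ ($f\in\mathcal L(F)$, $b\in F$), and $\mathcal S(F,\psi)$ that of the functions $g^{a,\gamma}\psi_b$ with $g$ Schwartz–Bruhat on $K$. Let $\int^F$ be the unique translation-invariant $\mathbb C(\Gamma)$-linear functional on $\mathcal L(F,\psi)$ with $\int^F g^{a,\gamma}(x)\,dx=\big(\int_K g(u)\,du\big)X^\gamma$ for all Haar integrable $g$. A function $\phi:F^\times\to\mathbb C(\Gamma)$ is called integrable over $F^\times$ if $x\mapsto\phi(x)|x|^{-1}$ extends to a (necessarily unique) element $h$ of $\mathcal L(F,\psi)$, and then its integral over $F^\times$ is $\int^F h(x)\,dx$. Let $\omega:O_F^\times\to\mathbb C^\times$ be a good multiplicative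 character, i.e. $\omega(x)=\bar\omega(\bar x)$ for a continuous homomorphism $\bar\omega:K^\times\to\mathbb C^\times$, and let $L(\bar\omega,s)$ be its local $L$-function: $(1-\bar\omega(\pi)q^{-s})^{-1}$ or $1$ in the non-archimedean case according as $\bar\omega$ is unramified or ramified ($\pi$ a uniformizer of $K$, $q$ the size of its residue field); $\pi^{-(s+c+N)/2}\,\Gamma\big(\tfrac{s+c+N}2\big)$ if $K=\mathbb R$ and $\bar\omega=\mathrm{sgn}^N|\cdot|^c$, $N\in\{0,1\}$; and $2(2\pi)^{-(s+c+|n|/2)}\,\Gamma\big(s+c+\tfrac{|n|}2\big)$ if $K=\mathbb C$ and $\bar\omega(z)=(z\bar z)^c(z/\sqrt{z\bar z})^n$. (In the last two formulas $\pi$ and $\Gamma$ are the number $\pi$ and the Gamma function.) For $f\in\mathcal S(F,\psi)$ put $$\zeta^1_F(f,\omega,s)=\int^{F^\times}f(x)\,\omega(x)\,|x|^s\,\mathrm{char}_{O_F^\times}(x)\,\frac{dx}{|x|}$$ whenever the function $f\,\omega\,|\cdot|^s\,\mathrm{char}_{O_F^\times}$ is integrable over $F^\times$ in the above sense (on $O_F^\times$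 one has $|x|=|\bar x|_K>0$; off $O_F^\times$ the integrand is $0$). Call a pair $(a,\gamma)\in F\times\Gamma$ *admissible* if one of the following holds: (i) $\nu(a)<\min(\gamma,0)$, or $0<\nu(a)<\gamma$, or $0<\gamma\le\nu(a)$; (ii) $0=\nu(a)<\gamma$; (iii) $0=\gamma\le\nu(a)$. Call $f\in\mathcal S(F,\psi)$ *admissible* if it is a finite sum $f=\sum_i g_i^{a_i,\gamma_i}\psi_{b_i}\,p_i$ with $g_i$ Schwartz–Bruhat on $K$, $b_i\in F$, $p_i\in\mathbb C(\Gamma)$ and all pairs $(a_i,\gamma_i)$ admissible. A function $Z:\mathbb C\to\mathbb C(\Gamma)$ is called holomorphic if near each point it is a finite sum $\sum_j h_j(s)\,p_j$ with $h_j$ complex-valued holomorphic and $p_j\in\mathbb C(\Gamma)$. **Proposition.** Let $\omega$ be a good multiplicative character of $O_F^\times$. 1. For every admissible $f\in\mathcal S(F,\psi)$ the integrand of $\zeta^1_F(f,\omega,s)$ is integrable over $F^\times$ for all $s$ with $\mathrm{Re}(s)$ sufficiently large, so that $\zeta^1_F(f,\omega,s)$ is well-defined there. 2. For every admissible $f\in\mathcal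 S(F,\psi)$ there is a $\mathbb C(\Gamma)$-valued holomorphic function $Z^1_F(f,\omega,s)$ on $\mathbb C$ which equals $\zeta^1_F(f,\omega,s)/L(\bar\omega,s)$ for $\mathrm{Re}(s)$ sufficiently large. 3. There is an admissible $g\in\mathcal S(F,\psi)$ for which $Z^1_F(g,\omega,s)=1$ for all $s\in\mathbb C$. -/

import Mathlib

open MeasureTheory

noncomputable section

namespace LiftedZeta

/-! ### Local fields -/

section LocalField

variable (K : Type*) [Field K] [TopologicalSpace K]

/-- `K` is topologically isomorphic to the field of real numbers. -/
def IsRealLocalField : Prop := ∃ e : K ≃+* ℝ, IsHomeomorph e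

/-- `K` is topologically isomorphic to the field of complex numbers. -/
def IsComplexLocalField : Prop := ∃ e : K ≃+* ℂ, IsHomeomorph e

/-- The topology of `K` comes from a nontrivial valuation and is locally compact. -/
def IsNonarchLocalField : Prop := ∃ _ : ValuativeRel K, IsNonarchimedeanLocalField K

/-- A local field: `ℝ`, `ℂ`, or a non-archimedean local field (of any characteristic). -/
def IsLocalField : Prop :=
  IsRealLocalField K ∨ IsComplexLocalField K ∨ IsNonarchLocalField K

variable {K}

/-- Schwartz-Bruhat functions: Schwartz functions if `K` is `ℝ` or `ℂ`, locally constant functions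
of compact support if `K` is non-archimedean. -/
def IsSchwartzBruhat (g : K → ℂ) : Prop :=
  (∃ (e : K ≃+* ℝ) (φ : SchwartzMap ℝ ℂ), IsHomeomorph e ∧ ∀ x, g x = φ (e x)) ∨
  (∃ (e : K ≃+* ℂ) (φ : SchwartzMap ℂ ℂ), IsHomeomorph e ∧ ∀ x, g x = φ (e x)) ∨
  (IsNonarchLocalField K ∧ IsLocallyConstant g ∧ HasCompactSupport g)

open scoped Classical in
/-- The normalized absolute value of `K`: multiplication by `x` scales Haar measure by `absK x`. -/
def absK [IsTopologicalRing K] [LocallyCompactSpace K] (x : K) : ℝ :=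
  if h : x = 0 then 0 else (distribHaarChar K (Units.mk0 x h) : ℝ)

/-- The complex number `c` such that `ω x = x ^ c` for all `x > 0`, for a quasi-character `ω`
of `ℝˣ`. -/
def realExponent (ω : ℝˣ →* ℂˣ) : ℂ :=
  Classical.epsilon fun c : ℂ => ∀ x : ℝˣ, 0 < (x : ℝ) → (ω x : ℂ) = ((x : ℝ) : ℂ) ^ c

open scoped Classical in
/-- The local L-function of the quasi-character `ω = sgn ^ N * |·| ^ c` of `ℝˣ`, `N ∈ {0, 1}`:
`π ^ (-(s + c + N) / 2) * Γ ((s + c + N) / 2)`. -/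
def realL (ω : ℝˣ →* ℂˣ) (s : ℂ) : ℂ :=
  Complex.Gammaℝ (s + realExponent ω + if ω (-1) = 1 then 0 else 1)

/-- The pair `(c, n)` such that `ω z = (|z| ^ 2) ^ c * (z / |z|) ^ n` for all `z`, for a
quasi-character `ω` of `ℂˣ`. -/
def complexExponent (ω : ℂˣ →* ℂˣ) : ℂ × ℤ :=
  Classical.epsilon fun p : ℂ × ℤ => ∀ z : ℂˣ,
    (ω z : ℂ) = ((‖(z : ℂ)‖ ^ 2 : ℝ) : ℂ) ^ p.1 * ((z : ℂ) / (‖(z : ℂ)‖ : ℂ)) ^ p.2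

/-- The local L-function of the quasi-character `ω z = (|z| ^ 2) ^ c * (z / |z|) ^ n` of `ℂˣ`:
`2 * (2 * π) ^ (-(s + c + |n| / 2)) * Γ (s + c + |n| / 2)`. -/
def complexL (ω : ℂˣ →* ℂˣ) (s : ℂ) : ℂ :=
  Complex.Gammaℂ (s + (complexExponent ω).1 + ((complexExponent ω).2.natAbs : ℂ) / 2)

section

variable [IsTopologicalRing K] [LocallyCompactSpace K]

/-- A uniformizer of a non-archimedean local field: an element of largest absolute value `< 1`. -/
def IsUniformizer (p : Kˣ) : Prop :=
  absK (p : K) < 1 ∧ ∀ x : Kˣ, absK (x : K) < 1 → absK (x : K) ≤ absK (p : K)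

variable (K) in
/-- A chosen uniformizer of a non-archimedean local field. -/
def uniformizer : Kˣ := Classical.epsilon fun p : Kˣ => IsUniformizer p

open scoped Classical in
/-- The local L-function of a quasi-character `ω` in the non-archimedean case:
`(1 - ω p * q ^ (-s))⁻¹` if `ω` is trivial on the units of the ring of integers (where `p` is a
uniformizer, so that `|p| = q⁻¹` with `q` the size of the finite residue field), else `1`. -/
def nonarchL (ω : Kˣ →* ℂˣ) (s : ℂ) : ℂ :=
  if ∀ u : Kˣ, absK (u : K) = 1 → ω u = 1 then
    (1 - (ω (uniformizer K) : ℂ) * ((absK (uniformizer K : K) : ℝ) : ℂ) ^ s)⁻¹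
  else 1

open scoped Classical in
/-- The local L-function `L(ω, s)` of a quasi-character `ω` of `Kˣ`. -/
def localL (ω : Kˣ →* ℂˣ) (s : ℂ) : ℂ :=
  if h : IsRealLocalField K then
    realL (ω.comp (Units.map (h.choose.symm : ℝ →* K))) s
  else if h : IsComplexLocalField K then
    complexL (ω.comp (Units.map (h.choose.symm : ℂ →* K))) s
  else nonarchL ω s

end

end LocalField

/-! ### The field `ℂ(Γ)` and holomorphic functions with values in it -/

section CGamma

variable (Γ : Type*) [AddCommGroup Γ] [LinearOrder Γ] [IsOrderedAddMonoid Γ]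

/-- `ℂ(Γ)`: the field of fractions of the complex group algebra of `Γ`. -/
abbrev CGamma : Type _ := FractionRing (AddMonoidAlgebra ℂ Γ)

variable {Γ}

/-- The basis element `X ^ γ` of the group algebra, viewed in `ℂ(Γ)`. -/
def X (γ : Γ) : CGamma Γ :=
  algebraMap (AddMonoidAlgebra ℂ Γ) (CGamma Γ) (AddMonoidAlgebra.single γ 1)

/-- An entire `ℂ(Γ)`-valued function: near every point it is a finite sum of complex-valued
holomorphic functions times elements of `ℂ(Γ)`. -/
def IsEntire (Z : ℂ → CGamma Γ) : Prop :=
  ∀ z₀ : ℂ, ∃ U : Set ℂ, IsOpen U ∧ z₀ ∈ U ∧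
    ∃ (n : ℕ) (h : Fin n → ℂ → ℂ) (p : Fin n → CGamma Γ),
      (∀ i, DifferentiableOn ℂ (h i) U) ∧ ∀ z ∈ U, Z z = ∑ i, h i z • p i

end CGamma

/-! ### Fields with a split valuation -/

/-- A valuation `ν : Fˣ → Γ` (extended by `ν 0 = ⊤`) with a splitting `t`, where `Γ` has a least
positive element `one`. -/
structure SplitValuation (F Γ : Type*) [Field F] [AddCommGroup Γ] [LinearOrder Γ]
    [IsOrderedAddMonoid Γ] where
  /-- the valuation -/
  ν : AddValuation F (WithTop Γ)
  /-- the splitting, a homomorphism from `Γ` to `Fˣ` -/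
  t : Multiplicative Γ →* Fˣ
  ν_t : ∀ γ : Γ, ν (t (Multiplicative.ofAdd γ) : F) = (γ : WithTop Γ)
  /-- the least positive element of `Γ` -/
  one : Γ
  one_pos : 0 < one
  one_le : ∀ γ : Γ, 0 < γ → one ≤ γ

namespace SplitValuation

variable {F Γ : Type*} [Field F] [AddCommGroup Γ] [LinearOrder Γ] [IsOrderedAddMonoid Γ]
  (V : SplitValuation F Γ)

/-- The ring of integers `{x | 0 ≤ ν x}`. -/
def integers : ValuationSubring F where
  carrier := {x | 0 ≤ V.ν x}
  mul_mem' {a b} ha hb := by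
    simp only [Set.mem_ofPred_eq, AddValuation.map_mul] at *
    exact add_nonneg ha hb
  one_mem' := by simp
  add_mem' {a b} ha hb := (le_min ha hb).trans (V.ν.map_add a b)
  zero_mem' := by simp
  neg_mem' {a} ha := by simpa using ha
  mem_or_inv_mem' a := by
    by_cases h : a = 0
    · left; simp [h]
    · have h1 : V.ν a + V.ν a⁻¹ = 0 := by
        rw [← AddValuation.map_mul, mul_inv_cancel₀ h, AddValuation.map_one]
      rcases le_total 0 (V.ν a) with h2 | h2
      · exact Or.inl h2
      · refine Or.inr ?_
        by_contra h3
        have h4 : V.ν a⁻¹ < 0 := not_le.mp h3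
        exact absurd h1 (ne_of_lt (lt_of_le_of_lt (add_le_of_nonpos_left h2) h4))

/-- The residue field of the valuation. -/
abbrev ResidueField : Type _ := IsLocalRing.ResidueField V.integers

open scoped Classical in
/-- The residue map, extended by zero outside the ring of integers. -/
def res (x : F) : V.ResidueField :=
  if h : x ∈ V.integers then IsLocalRing.residue V.integers ⟨x, h⟩ else 0

/-- The element `t(γ)` of `F`. -/
def tt (γ : Γ) : F := (V.t (Multiplicative.ofAdd γ) : F)

/-- The valuation of a nonzero element, as an element of `Γ`. -/
def ord (x : Fˣ) : Γ :=
  (V.ν (x : F)).untop (fun h => x.ne_zero ((AddValuation.top_iff V.ν).1 h))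

/-- `η x` is the residue of `x t(-ν(x))`. -/
def η (x : Fˣ) : V.ResidueField := V.res ((x : F) * V.tt (-V.ord x))

open scoped Classical in
/-- The lift `g^{a,γ}` of `g` at `a, γ`: it sends `x ∈ a + t(γ) O` to `g` of the residue of
`(x - a) t(-γ)` and vanishes elsewhere. -/
def lift (g : V.ResidueField → ℂ) (a : F) (γ : Γ) (x : F) : ℂ :=
  if (x - a) * V.tt (-γ) ∈ V.integers then g (V.res ((x - a) * V.tt (-γ))) else 0

/-- The term `g^{a,γ} ψ_b` as a `ℂ(Γ)`-valued function, where `ψ_b(x) = ψ(bx)`. -/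
def term (ψ : AddChar F Circle) (g : V.ResidueField → ℂ) (a : F) (γ : Γ) (b : F) :
    F → CGamma Γ :=
  fun x => algebraMap ℂ (CGamma Γ) (V.lift g a γ x * (ψ (b * x) : ℂ))

section Characters

variable [TopologicalSpace V.ResidueField]

/-- `ψ` is a (non-trivial) good character of `F` of conductor `𝔣`: it is trivial on `t(𝔣) O`,
nontrivial on `t(𝔣 - 1) O`, and the induced character of the residue field is continuous. -/
def IsGoodCharacter (ψ : AddChar F Circle) (𝔣 : Γ) : Prop :=
  (∀ x ∈ V.integers, ψ (V.tt 𝔣 * x) = 1) ∧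
  (∃ x ∈ V.integers, ψ (V.tt (𝔣 - V.one) * x) ≠ 1) ∧
  ∃ ψbar : AddChar V.ResidueField Circle, Continuous ψbar ∧
    ∀ x ∈ V.integers, ψbar (V.res x) = ψ (V.tt (𝔣 - V.one) * x)

/-- `ω` is a good character of the group of units of the ring of integers: it is induced by the
quasi-character (continuous homomorphism) `ωbar` of the multiplicative group of the residue
field. -/
def IsGoodMulCharacter (ω : V.integersˣ →* ℂˣ) (ωbar : V.ResidueFieldˣ →* ℂˣ) : Prop :=
  Continuous ωbar ∧
    ∀ u, ω u = ωbar (Units.map (IsLocalRing.residue V.integers : V.integers →* V.ResidueField) u)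

/-- `S(F, ψ)`: the `ℂ(Γ)`-span of the functions `g^{a,γ} ψ_b` with `g` Schwartz-Bruhat. -/
def schwartzSpace (ψ : AddChar F Circle) : Submodule (CGamma Γ) (F → CGamma Γ) :=
  Submodule.span _ {φ | ∃ (g : V.ResidueField → ℂ) (a : F) (γ : Γ) (b : F),
    IsSchwartzBruhat g ∧ φ = V.term ψ g a γ b}

/-- The position of the translated fractional ideal `a + t(γ) O` relative to the units:
either it does not meet the units, or it is contained in the units,
or it equals `O`. -/
def IsTreated (a : F) (γ : Γ) : Prop :=
  (V.ν a < min (γ : WithTop Γ) 0 ∨ (0 < V.ν a ∧ V.ν a < (γ : WithTop Γ)) ∨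
    (0 < γ ∧ (γ : WithTop Γ) ≤ V.ν a)) ∨
  (V.ν a = 0 ∧ 0 < γ) ∨
  (γ = 0 ∧ 0 ≤ V.ν a)

/-- The finite sums `∑ i, g_i^{a_i,γ_i} ψ_{b_i} p_i` with `g_i` Schwartz-Bruhat, `p_i ∈ ℂ(Γ)`,
and every pair `(a_i, γ_i)` as in `IsTreated`. -/
def treatedSpace (ψ : AddChar F Circle) : Submodule (CGamma Γ) (F → CGamma Γ) :=
  Submodule.span _ {φ | ∃ (g : V.ResidueField → ℂ) (a : F) (γ : Γ) (b : F),
    IsSchwartzBruhat g ∧ V.IsTreated a γ ∧ φ = V.term ψ g a γ b}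

end Characters

section Integration

variable [MeasurableSpace V.ResidueField]

/-- `L(F)`: the `ℂ(Γ)`-span of the lifts of Haar integrable functions. -/
def integrableFunctions (μ : Measure V.ResidueField) : Submodule (CGamma Γ) (F → CGamma Γ) :=
  Submodule.span _ {φ | ∃ (g : V.ResidueField → ℂ) (a : F) (γ : Γ),
    Integrable g μ ∧ φ = fun x => algebraMap ℂ (CGamma Γ) (V.lift g a γ x)}

/-- `L(F, ψ)`: the `ℂ(Γ)`-span of the functions `f ψ_b` with `f` in `L(F)` and `b` in `F`. -/
def integrableFunctionsChar (μ : Measure V.ResidueField) (ψ : AddChar F Circle) :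
    Submodule (CGamma Γ) (F → CGamma Γ) :=
  Submodule.span _ {φ | ∃ f ∈ V.integrableFunctions μ, ∃ b : F,
    φ = fun x => f x * algebraMap ℂ (CGamma Γ) (ψ (b * x) : ℂ)}

/-- `I` is a translation-invariant `ℂ(Γ)`-linear functional on `L(F, ψ)` whose value on the lift
`g^{a,γ}` of any Haar integrable `g` is `(∫ g) X^γ`. -/
def IsIntegralFunctional (μ : Measure V.ResidueField) (ψ : AddChar F Circle)
    (I : V.integrableFunctionsChar μ ψ →ₗ[CGamma Γ] CGamma Γ) : Prop :=
  (∀ (g : V.ResidueField → ℂ) (a : F) (γ : Γ), Integrable g μ →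
    ∀ φ : V.integrableFunctionsChar μ ψ,
      (∀ x, (φ : F → CGamma Γ) x = algebraMap ℂ (CGamma Γ) (V.lift g a γ x)) →
      I φ = algebraMap ℂ (CGamma Γ) (∫ u, g u ∂μ) * X γ) ∧
  (∀ (φ φ' : V.integrableFunctionsChar μ ψ) (y : F),
    (∀ x, (φ' : F → CGamma Γ) x = (φ : F → CGamma Γ) (x + y)) → I φ' = I φ)

open scoped Classical in
/-- The integral on `L(F, ψ)`: the unique functional as in `IsIntegralFunctional` (extended by
zero to functions outside `L(F, ψ)`). -/
def integral (μ : Measure V.ResidueField) (ψ : AddChar F Circle) (φ : F → CGamma Γ) : CGamma Γ :=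
  if h : φ ∈ V.integrableFunctionsChar μ ψ then
    Classical.epsilon (V.IsIntegralFunctional μ ψ) ⟨φ, h⟩
  else 0

variable [TopologicalSpace V.ResidueField] [IsTopologicalRing V.ResidueField]
  [LocallyCompactSpace V.ResidueField]

/-- The absolute value `|x| = |η(x)| X^{ν(x)}` of a nonzero element of `F`. -/
def absF (x : Fˣ) : CGamma Γ :=
  algebraMap ℂ (CGamma Γ) ((absK (V.η x) : ℝ) : ℂ) * X (V.ord x)

/-- `h` is an element of `L(F, ψ)` that extends `x ↦ φ(x) |x|⁻¹` from `Fˣ` to `F`. -/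
def IsMulExtension (μ : Measure V.ResidueField) (ψ : AddChar F Circle) (φ : Fˣ → CGamma Γ)
    (h : F → CGamma Γ) : Prop :=
  h ∈ V.integrableFunctionsChar μ ψ ∧ ∀ x : Fˣ, h (x : F) = φ x * (V.absF x)⁻¹

/-- `φ` is integrable over `Fˣ`. -/
def IsMulIntegrable (μ : Measure V.ResidueField) (ψ : AddChar F Circle) (φ : Fˣ → CGamma Γ) :
    Prop :=
  ∃ h, V.IsMulExtension μ ψ φ h

open scoped Classical in
/-- The integral of `φ` over `Fˣ`: the integral over `F` of the (unique) extension of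
`x ↦ φ(x) |x|⁻¹` to an element of `L(F, ψ)`. -/
def mulIntegral (μ : Measure V.ResidueField) (ψ : AddChar F Circle) (φ : Fˣ → CGamma Γ) :
    CGamma Γ :=
  if h : V.IsMulIntegrable μ ψ φ then V.integral μ ψ h.choose else 0

open scoped Classical in
/-- The integrand `f(x) ω(x) |x|^s char(x)` of the zeta integral, where `char` is the
characteristic function of the group of units of the ring of integers; for a unit `x` one has
`ν(x) = 0`, so that `|x| = |η(x)|` is a positive real number. -/
def zetaIntegrand (f : F → CGamma Γ) (ω : V.integersˣ →* ℂˣ) (s : ℂ) (x : Fˣ) : CGamma Γ :=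
  if h : x ∈ V.integers.unitGroup then
    f (x : F) * algebraMap ℂ (CGamma Γ)
      ((ω (V.integers.unitGroupMulEquiv ⟨x, h⟩) : ℂ) * ((absK (V.η x) : ℝ) : ℂ) ^ s)
  else 0

/-- The one-dimensional local zeta integral. -/
def zeta (μ : Measure V.ResidueField) (ψ : AddChar F Circle) (f : F → CGamma Γ)
    (ω : V.integersˣ →* ℂˣ) (s : ℂ) : CGamma Γ :=
  V.mulIntegral μ ψ (V.zetaIntegrand f ω s)

/-- The zeta integral of `f` is well-defined for all `s` of sufficiently large real part. -/
def ZetaDefined (μ : Measure V.ResidueField) (ψ : AddChar F Circle) (f : F → CGamma Γ)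
    (ω : V.integersˣ →* ℂˣ) : Prop :=
  ∃ σ : ℝ, ∀ s : ℂ, σ < s.re → V.IsMulIntegrable μ ψ (V.zetaIntegrand f ω s)

/-- `Z` is the entire continuation of `zeta(f, ω, s) / L(ωbar, s)`: it is an entire
`ℂ(Γ)`-valued function which equals that quotient for `Re s` sufficiently large. -/
def IsZetaContinuation (μ : Measure V.ResidueField) (ψ : AddChar F Circle) (f : F → CGamma Γ)
    (ω : V.integersˣ →* ℂˣ) (ωbar : V.ResidueFieldˣ →* ℂˣ) (Z : ℂ → CGamma Γ) : Prop :=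
  IsEntire Z ∧
    ∃ σ : ℝ, ∀ s : ℂ, σ < s.re → Z s = (localL ωbar s)⁻¹ • V.zeta μ ψ f ω s

end Integration

end SplitValuation

end LiftedZeta

end

/-! ### Residues, lifts and characters of F. -/

namespace LiftedZeta
namespace SplitValuation

variable {F Γ : Type*} [Field F] [AddCommGroup Γ] [LinearOrder Γ] [IsOrderedAddMonoid Γ]
  (V : SplitValuation F Γ)

/-! Dividing the zeta integrand by |x| leaves f(x) k_s(x̄), where k_s(u) = ω̄(u)|u|^(s-1) on Kˣ and
k_s(0) = 0 (`quasiKernel`). Since residues are 0 off the units, k_s also absorbs the characteristic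
function. Admissibility lists three positions of the ball of a lift. If the ball misses the units,
the integrand vanishes. If it lies in one residue class of units, k_s(x̄) is constant on it, and the
result is an entire function of s times a fixed element of ℂ(Γ). If it is O, the integrand is ψ_b
times the lift of u ↦ g(u - ā) k_s(u): for b ∉ O translation invariance makes the integral zero, and
for b ∈ O the character is residual and the integral is a Tate integral over K. So the statement
reduces to `TateContinuation`, in which an additive character and a translation are allowed in the
integrand.

Two facts support this reduction. First, the integral exists: every linear relation between terms
g^{a,γ} ψ_b also holds between their prescribed integrals
(`IsGoodCharacter.sum_termIntegral_eq_zero`). Restrict a relation to the ball of a term of largest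
γ. There the lifts of lower level are constant, and independence of characters on the maximal ideal
separates the frequencies modulo O. What remains is a relation on K between an integrable function
and a trigonometric polynomial; as K has infinite Haar measure, the polynomial is zero.

Second, Tate's theory holds over K. In the non-archimedean case φ(u) - φ(y⁻¹u) vanishes near 0, so
its zeta integral is a finite sum of exponentials in s, and it equals that of φ times 1 -
ω̄(y)|y|^s; y is a uniformizer, or a unit with ω̄(y) ≠ 1 (`exists_continuation_mul`). In the
archimedean case polar coordinates give the Mellin transform of a weighted spherical mean. The
weight annihilates all homogeneous polynomials except those of degrees m, m + 2, …, so the expansion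
at 0 produces only poles of Γ_ℝ(z + m) (`hasParityExpansion_sphere`,
`HasParityExpansion.exists_entire`). Normalized indicator functions and Gaussians times polynomials
realize the L-factor itself. -/

lemma mem_integers {x : F} : x ∈ V.integers ↔ 0 ≤ V.ν x := Iff.rfl

lemma tt_zero : V.tt 0 = 1 := by simp [tt]

lemma tt_add (γ δ : Γ) : V.tt (γ + δ) = V.tt γ * V.tt δ := by simp [tt]

lemma tt_ne_zero (γ : Γ) : V.tt γ ≠ 0 := Units.ne_zero _

lemma tt_neg (γ : Γ) : V.tt (-γ) = (V.tt γ)⁻¹ := by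
  refine eq_inv_of_mul_eq_one_left ?_
  rw [← tt_add, neg_add_cancel, tt_zero]

lemma ν_tt (γ : Γ) : V.ν (V.tt γ) = (γ : WithTop Γ) := V.ν_t γ

lemma ν_mul_tt_neg_nonneg {x : F} {γ : Γ} :
    0 ≤ V.ν (x * V.tt (-γ)) ↔ (γ : WithTop Γ) ≤ V.ν x := by
  rw [AddValuation.map_mul, ν_tt]
  induction V.ν x using WithTop.recTopCoe with
  | top => simp
  | coe a => norm_cast; simp

lemma ν_mul_tt_neg_pos {x : F} {γ : Γ} :
    0 < V.ν (x * V.tt (-γ)) ↔ (γ : WithTop Γ) < V.ν x := by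
  rw [AddValuation.map_mul, ν_tt]
  induction V.ν x using WithTop.recTopCoe with
  | top => simp
  | coe a => norm_cast; simp

lemma one_le_of_pos {x : F} (hx : 0 < V.ν x) : (V.one : WithTop Γ) ≤ V.ν x := by
  induction h : V.ν x using WithTop.recTopCoe with
  | top => simp
  | coe a => rw [h] at hx; exact_mod_cast V.one_le a (by exact_mod_cast hx)

lemma res_of_mem {x : F} (hx : x ∈ V.integers) :
    V.res x = IsLocalRing.residue V.integers ⟨x, hx⟩ := by simp [res, hx]

lemma res_add {x y : F} (hx : x ∈ V.integers) (hy : y ∈ V.integers) :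
    V.res (x + y) = V.res x + V.res y := by
  rw [V.res_of_mem hx, V.res_of_mem hy, V.res_of_mem (add_mem hx hy), ← map_add]; rfl

lemma res_mul {x y : F} (hx : x ∈ V.integers) (hy : y ∈ V.integers) :
    V.res (x * y) = V.res x * V.res y := by
  rw [V.res_of_mem hx, V.res_of_mem hy, V.res_of_mem (mul_mem hx hy), ← map_mul]; rfl

lemma res_neg {x : F} (hx : x ∈ V.integers) : V.res (-x) = -V.res x := by
  rw [V.res_of_mem hx, V.res_of_mem (neg_mem hx), ← map_neg]; rfl

lemma res_sub {x y : F} (hx : x ∈ V.integers) (hy : y ∈ V.integers) :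
    V.res (x - y) = V.res x - V.res y := by
  rw [sub_eq_add_neg, V.res_add hx (neg_mem hy), V.res_neg hy, ← sub_eq_add_neg]

lemma res_surjective (u : V.ResidueField) : ∃ x ∈ V.integers, V.res x = u := by
  obtain ⟨x, rfl⟩ := IsLocalRing.residue_surjective u
  exact ⟨x, x.2, by rw [V.res_of_mem x.2]⟩

lemma isUnit_integers_iff {x : F} (hx : x ∈ V.integers) :
    IsUnit (⟨x, hx⟩ : V.integers) ↔ V.ν x = 0 := by
  constructor
  · rintro ⟨u, hu⟩
    have h1 : V.ν x + V.ν ((u⁻¹ : V.integersˣ) : V.integers) = 0 := by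
      rw [← AddValuation.map_mul]
      have : ((u : V.integers) * ((u⁻¹ : V.integersˣ) : V.integers) : F) = 1 := by
        exact_mod_cast congrArg Subtype.val u.mul_inv
      rw [hu] at this
      rw [this, AddValuation.map_one]
    have h2 : 0 ≤ V.ν ((u⁻¹ : V.integersˣ) : V.integers) := (u⁻¹ : V.integersˣ).1.2
    exact le_antisymm (h1 ▸ le_add_of_nonneg_right h2) hx
  · intro h
    have hx0 : x ≠ 0 := by rintro rfl; simp at h
    have h1 : V.ν x + V.ν x⁻¹ = 0 := by
      rw [← AddValuation.map_mul, mul_inv_cancel₀ hx0, AddValuation.map_one]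
    have h2 : x⁻¹ ∈ V.integers := by rw [mem_integers]; rw [h, zero_add] at h1; exact h1.ge
    exact IsUnit.of_mul_eq_one ⟨x⁻¹, h2⟩ (Subtype.ext (mul_inv_cancel₀ hx0))

lemma res_eq_zero_iff {x : F} (hx : x ∈ V.integers) : V.res x = 0 ↔ 0 < V.ν x := by
  rw [V.res_of_mem hx, IsLocalRing.residue_eq_zero_iff, IsLocalRing.mem_maximalIdeal, mem_nonunits_iff,
    V.isUnit_integers_iff hx]
  exact ⟨fun h => lt_of_le_of_ne hx (Ne.symm h), fun h => h.ne'⟩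

lemma res_ne_zero_iff {x : F} (hx : x ∈ V.integers) : V.res x ≠ 0 ↔ V.ν x = 0 := by
  rw [Ne, V.res_eq_zero_iff hx, not_lt]
  exact ⟨fun h => le_antisymm h hx, fun h => h.le⟩

lemma mem_integers_add_iff {x y : F} (hy : y ∈ V.integers) :
    x + y ∈ V.integers ↔ x ∈ V.integers :=
  ⟨fun h => by simpa using sub_mem h hy, fun h => add_mem h hy⟩

/-- On the ball `a₀ + t(γ₀) O`, the lift `g^{a,γ}` with `γ ≤ γ₀` descends to the residue field. -/
lemma exists_lift_eq_comp_res (g : V.ResidueField → ℂ) (a a₀ : F) {γ γ₀ : Γ} (h : γ < γ₀) :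
    ∀ y ∈ V.integers, V.lift g a γ (a₀ + V.tt γ₀ * y) = V.lift g a γ a₀ := by
  intro y hy
  have h1 : 0 < V.ν (V.tt γ₀ * y * V.tt (-γ)) := by
    rw [V.ν_mul_tt_neg_pos, AddValuation.map_mul, ν_tt]
    exact lt_of_lt_of_le (by exact_mod_cast h) (le_add_of_nonneg_right hy)
  have h2 : (a₀ + V.tt γ₀ * y - a) * V.tt (-γ)
      = (a₀ - a) * V.tt (-γ) + V.tt γ₀ * y * V.tt (-γ) := by ring
  have h3 : V.tt γ₀ * y * V.tt (-γ) ∈ V.integers := h1.le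
  unfold lift
  rw [h2, V.mem_integers_add_iff h3]
  split_ifs with h4
  · rw [V.res_add h4 h3, (V.res_eq_zero_iff h3).2 h1, add_zero]
  · rfl

/-- Two balls of the same level are equal or disjoint; in the coordinate y of the second ball the
lift is a translate of g or zero. -/
lemma lift_add_tt_mul (g : V.ResidueField → ℂ) (a a₀ : F) (γ : Γ) {y : F} (hy : y ∈ V.integers) :
    V.lift g a γ (a₀ + V.tt γ * y) =
      open scoped Classical in
      if (a₀ - a) * V.tt (-γ) ∈ V.integers then g (V.res y + V.res ((a₀ - a) * V.tt (-γ))) else 0 := by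
  have h2 : (a₀ + V.tt γ * y - a) * V.tt (-γ) = (a₀ - a) * V.tt (-γ) + y := by
    rw [tt_neg]; field_simp [V.tt_ne_zero γ]; ring
  unfold lift
  rw [h2, V.mem_integers_add_iff hy]
  split_ifs with h4
  · rw [V.res_add h4 hy, add_comm]
  · rfl

section Char
variable [TopologicalSpace V.ResidueField] {ψ : AddChar F Circle}

lemma IsGoodCharacter.exists_residue (hψ : V.IsGoodCharacter ψ V.one) :
    ∃ ψb : AddChar V.ResidueField Circle, Continuous ψb ∧
      ∀ x ∈ V.integers, ψb (V.res x) = ψ x := by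
  obtain ⟨-, -, ψb, hc, h⟩ := hψ
  exact ⟨ψb, hc, fun x hx => by simpa [tt_zero] using h x hx⟩

lemma IsGoodCharacter.eq_one_of_pos (hψ : V.IsGoodCharacter ψ V.one) {x : F} (hx : 0 < V.ν x) :
    ψ x = 1 := by
  have h : x * V.tt (-V.one) ∈ V.integers := V.ν_mul_tt_neg_nonneg.2 (V.one_le_of_pos hx)
  have := hψ.1 _ h
  rwa [tt_neg, mul_comm x, mul_inv_cancel_left₀ (V.tt_ne_zero _)] at this

/-- `y ↦ ψ(c y)` is trivial on the maximal ideal exactly when `c` is integral. -/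
lemma IsGoodCharacter.forall_mul_eq_one_iff (hψ : V.IsGoodCharacter ψ V.one) (c : F) :
    (∀ z, 0 < V.ν z → ψ (c * z) = 1) ↔ c ∈ V.integers := by
  constructor
  · intro h
    by_contra hc
    rw [mem_integers, not_le] at hc
    obtain ⟨x, hx, hx1⟩ := hψ.2.1
    rw [sub_self, tt_zero, one_mul] at hx1
    have hc0 : c ≠ 0 := by rintro rfl; simp at hc
    -- Write x as c(c⁻¹x): the second factor is in the maximal ideal because ν(c) < 0 ≤ ν(x).
    refine hx1 ?_
    have h1 : 0 < V.ν (c⁻¹ * x) := by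
      have h2 : V.ν c + V.ν (c⁻¹ * x) = V.ν x := by
        rw [← AddValuation.map_mul, mul_inv_cancel_left₀ hc0]
      by_contra h3
      rw [not_lt] at h3
      have : V.ν c + V.ν (c⁻¹ * x) < 0 := lt_of_le_of_lt (add_le_of_nonpos_right h3) hc
      rw [h2] at this
      exact absurd hx (not_le.2 this)
    simpa [mul_inv_cancel_left₀ hc0] using h _ h1
  · intro hc z hz
    refine hψ.eq_one_of_pos V ?_
    rw [AddValuation.map_mul]
    exact lt_of_lt_of_le hz (le_add_of_nonneg_left hc)

end Char
end SplitValuation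
end LiftedZeta

/-! ### Independence of characters and reduction to complex coefficients. -/

namespace LiftedZeta

/-- Linear independence of characters, in summed form. -/
lemma sum_filter_eq_zero_of_characters {ι A : Type*} [AddCommGroup A] (N : AddSubgroup A)
    (s : Finset ι) (d : ι → ℂ) (χ : ι → AddChar A Circle) (χ₀ : AddChar A Circle)
    (P : ι → Prop) [DecidablePred P] (hP : ∀ i, P i ↔ ∀ z ∈ N, χ i z = χ₀ z)
    (h : ∀ z ∈ N, ∑ i ∈ s, d i * (χ i z : ℂ) = 0) : ∑ i ∈ s with P i, d i = 0 := by
  classical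
  induction hs : s.card generalizing s d with
  | zero => rw [Finset.card_eq_zero.1 hs]; simp
  | succ n ih =>
    by_cases hall : ∀ i ∈ s, P i
    · rw [Finset.filter_true_of_mem hall]
      simpa using h 0 N.zero_mem
    · push Not at hall
      obtain ⟨j, hj, hPj⟩ := hall
      rw [hP] at hPj
      push Not at hPj
      obtain ⟨z₀, hz₀, hne⟩ := hPj
      -- Evaluating at z + z₀ and subtracting χ_j(z₀) times the relation at z removes the index j.
      have key := ih (s.erase j) (fun i => d i * ((χ i z₀ : ℂ) - (χ j z₀ : ℂ))) (fun z hz => by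
        have h1 := h (z + z₀) (N.add_mem hz hz₀)
        have h2 := h z hz
        have h3 : ∑ i ∈ s, d i * ((χ i z₀ : ℂ) - (χ j z₀ : ℂ)) * (χ i z : ℂ) = 0 := by
          have h4 : ∑ i ∈ s, d i * ((χ i z₀ : ℂ) - (χ j z₀ : ℂ)) * (χ i z : ℂ)
              = ∑ i ∈ s, d i * (χ i (z + z₀) : ℂ)
                - (χ j z₀ : ℂ) * ∑ i ∈ s, d i * (χ i z : ℂ) := by
            rw [Finset.mul_sum, ← Finset.sum_sub_distrib]
            refine Finset.sum_congr rfl fun i _ => ?_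
            rw [AddChar.map_add_eq_mul, Circle.coe_mul]; ring
          rw [h4, h1, h2]; simp
        rw [← Finset.add_sum_erase _ _ hj] at h3
        simpa using h3) (by rw [Finset.card_erase_of_mem hj, hs]; rfl)
      have hjP : ¬ P j := fun hp => hne ((hP j).1 hp z₀ hz₀)
      have e1 : (s.erase j).filter P = s.filter P := by
        rw [Finset.filter_erase, Finset.erase_eq_of_notMem]
        simp [hjP]
      rw [e1] at key
      -- All indices satisfying P have the same value χ₀(z₀) at z₀, so the twisting factors form one
      -- nonzero constant that cancels.
      have e2 : ∑ i ∈ s with P i, d i * ((χ i z₀ : ℂ) - (χ j z₀ : ℂ))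
          = (∑ i ∈ s with P i, d i) * ((χ₀ z₀ : ℂ) - (χ j z₀ : ℂ)) := by
        rw [Finset.sum_mul]
        refine Finset.sum_congr rfl fun i hi => ?_
        rw [(hP i).1 (Finset.mem_filter.1 hi).2 z₀ hz₀]
      rw [e2, mul_eq_zero] at key
      refine key.resolve_right fun h0 => hne ?_
      exact Circle.coe_injective (sub_eq_zero.1 h0).symm

/-- A trigonometric polynomial that is integrable for an infinite invariant measure vanishes. -/
lemma trigonometric_eq_zero_of_integrable {ι K : Type*} [AddCommGroup K] [MeasurableSpace K]
    [MeasurableAdd K] (μ : Measure K) [μ.IsAddRightInvariant] (hμ : μ Set.univ = ⊤)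
    (s : Finset ι) (d : ι → ℂ) (χ : ι → AddChar K Circle)
    (h : Integrable (fun u => ∑ i ∈ s, d i * (χ i u : ℂ)) μ) (u : K) :
    ∑ i ∈ s, d i * (χ i u : ℂ) = 0 := by
  classical
  induction s using Finset.induction_on generalizing d u with
  | empty => simp
  | insert j s hj ih =>
    -- G(u + z) - χ_j(z)G(u) is integrable and has no χ_j term, so it vanishes by induction. Hence
    -- |G| is constant, and integrability against an infinite measure forces G = 0.
    set G : K → ℂ := fun u => ∑ i ∈ insert j s, d i * (χ i u : ℂ) with hG
    have h1 : ∀ z u, G (u + z) = (χ j z : ℂ) * G u := by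
      intro z u
      have e : ∀ u, G (u + z) - (χ j z : ℂ) * G u
          = ∑ i ∈ s, (d i * ((χ i z : ℂ) - (χ j z : ℂ))) * (χ i u : ℂ) := by
        intro u
        have h4 : G (u + z) - (χ j z : ℂ) * G u
            = ∑ i ∈ insert j s, (d i * ((χ i z : ℂ) - (χ j z : ℂ))) * (χ i u : ℂ) := by
          simp only [hG]
          rw [Finset.mul_sum, ← Finset.sum_sub_distrib]
          refine Finset.sum_congr rfl fun i _ => ?_
          rw [AddChar.map_add_eq_mul, Circle.coe_mul]; ring
        rw [h4, Finset.sum_insert hj]; simp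
      have h5 := ih (fun i => d i * ((χ i z : ℂ) - (χ j z : ℂ))) (by
        simp_rw [← e]
        exact (h.comp_add_right z).sub (h.const_mul _)) u
      rw [← e, sub_eq_zero] at h5
      exact h5
    have h2 : ∀ z, G z = (χ j z : ℂ) * G 0 := fun z => by simpa using h1 z 0
    have h3 : Integrable (fun _ : K => ‖G 0‖) μ := by
      refine h.norm.congr (Filter.Eventually.of_forall fun u => ?_)
      change ‖G u‖ = _
      rw [h2 u, norm_mul, Circle.norm_coe, one_mul]
    have h4 : G 0 = 0 := by
      rcases integrable_const_iff.1 h3 with h4 | h4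
      · simpa using h4
      · exact absurd hμ (measure_ne_top μ _)
    change G u = 0
    rw [h2, h4, mul_zero]

lemma forall_dual_sum {ι Γ : Type*} [AddCommGroup Γ] (s : Finset ι) (p : ι → CGamma Γ) (c : ι → ℂ)
    (ℓ : Module.Dual ℂ (CGamma Γ)) :
    ℓ (∑ i ∈ s, p i * algebraMap ℂ (CGamma Γ) (c i)) = ∑ i ∈ s, ℓ (p i) * c i := by
  rw [map_sum]
  refine Finset.sum_congr rfl fun i _ => ?_
  rw [mul_comm, ← Algebra.smul_def, map_smul, smul_eq_mul, mul_comm]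

/-- Linear functionals separate the points of ℂ(Γ) over ℂ. This turns relations with coefficients in
ℂ(Γ) into complex ones, where integrability makes sense. -/
lemma sum_mul_algebraMap_eq_zero_iff {ι Γ : Type*} [AddCommGroup Γ] (s : Finset ι) (p : ι → CGamma Γ) (c : ι → ℂ) :
    ∑ i ∈ s, p i * algebraMap ℂ (CGamma Γ) (c i) = 0 ↔
      ∀ ℓ : Module.Dual ℂ (CGamma Γ), ∑ i ∈ s, ℓ (p i) * c i = 0 := by
  rw [← Module.forall_dual_apply_eq_zero_iff ℂ]
  simp_rw [forall_dual_sum]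

namespace SplitValuation

variable {F Γ : Type*} [Field F] [AddCommGroup Γ] [LinearOrder Γ] [IsOrderedAddMonoid Γ]
  (V : SplitValuation F Γ)

open scoped Classical in
/-- The value of the integral on `g^{a,γ} ψ_b`, where `ψb` is the residual character of `ψ`. -/
noncomputable def termIntegral [MeasurableSpace V.ResidueField] (μ : Measure V.ResidueField)
    (ψ : AddChar F Circle) (ψb : AddChar V.ResidueField Circle) (g : V.ResidueField → ℂ)
    (a : F) (γ : Γ) (b : F) : CGamma Γ :=
  if b * V.tt γ ∈ V.integers then
    algebraMap ℂ (CGamma Γ) ((ψ (b * a) : ℂ) * ∫ u, g u * (ψb (V.res (b * V.tt γ) * u) : ℂ) ∂μ)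
      * X γ
  else 0

end SplitValuation
end LiftedZeta

/-! ### Relations between terms pass to their integrals. -/

namespace LiftedZeta
namespace SplitValuation

variable {F Γ : Type*} [Field F] [AddCommGroup Γ] [LinearOrder Γ] [IsOrderedAddMonoid Γ]
  (V : SplitValuation F Γ) [TopologicalSpace V.ResidueField] [IsTopologicalRing V.ResidueField]
  [MeasurableSpace V.ResidueField] [BorelSpace V.ResidueField]
  {μ : Measure V.ResidueField} [μ.IsAddHaarMeasure] {ψ : AddChar F Circle}

-- Moving y within its residue class changes only the characters. On the maximal ideal, ψ(β_i ·) and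
-- ψ(β₀ ·) agree exactly when β_i - β₀ ∈ O, so independence isolates one class of frequencies;
-- dividing by ψ(β₀y) leaves residual characters.
omit [IsTopologicalRing V.ResidueField] [MeasurableSpace V.ResidueField]
  [BorelSpace V.ResidueField] in
lemma IsGoodCharacter.sum_on_ball_eq_zero (hψ : V.IsGoodCharacter ψ V.one)
    {ψb : AddChar V.ResidueField Circle} (hψb : ∀ x ∈ V.integers, ψb (V.res x) = ψ x)
    {ι : Type*} (s : Finset ι) (d : ι → ℂ) (C : ι → V.ResidueField → ℂ) (β : ι → F) (β₀ : F)
    [DecidablePred fun i => β i - β₀ ∈ V.integers]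
    (h : ∀ y ∈ V.integers, ∑ i ∈ s, d i * C i (V.res y) * (ψ (β i * y) : ℂ) = 0)
    (u : V.ResidueField) :
    ∑ i ∈ s with β i - β₀ ∈ V.integers, d i * C i u * (ψb (V.res (β i - β₀) * u) : ℂ) = 0 := by
  obtain ⟨y, hy, rfl⟩ := V.res_surjective u
  let N : AddSubgroup F :=
    { carrier := {z | 0 < V.ν z}
      add_mem' := fun {x y} hx hy => lt_of_lt_of_le (lt_min hx hy) (V.ν.map_add x y)
      zero_mem' := by simp
      neg_mem' := by simp }
  have key := sum_filter_eq_zero_of_characters N s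
    (fun i => d i * C i (V.res y) * (ψ (β i * y) : ℂ)) (fun i => ψ.mulShift (β i))
    (ψ.mulShift β₀) (fun i => β i - β₀ ∈ V.integers) (fun i => by
      rw [← hψ.forall_mul_eq_one_iff]
      refine forall₂_congr fun z _ => ?_
      simp only [AddChar.mulShift_apply, sub_mul, AddChar.map_sub_eq_div, div_eq_one])
    (fun z hz => by
      have hzi : z ∈ V.integers := (show 0 < V.ν z from hz).le
      rw [← h (y + z) (add_mem hy hzi)]
      refine Finset.sum_congr rfl fun i _ => ?_
      rw [V.res_add hy hzi, (V.res_eq_zero_iff hzi).2 hz, add_zero, mul_add,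
        AddChar.map_add_eq_mul, Circle.coe_mul, AddChar.mulShift_apply]
      ring)
  have h2 := congrArg (fun t => t * (ψ (-(β₀ * y)) : ℂ)) key
  simp only [zero_mul, Finset.sum_mul] at h2
  rw [← h2]
  refine Finset.sum_congr rfl fun i hi => ?_
  have hi2 := (Finset.mem_filter.1 hi).2
  rw [← V.res_mul hi2 hy, hψb _ (mul_mem hi2 hy), sub_mul, sub_eq_add_neg,
    AddChar.map_add_eq_mul, Circle.coe_mul]
  ring

lemma integrable_mul_char {K : Type*} [CommRing K] [TopologicalSpace K] [IsTopologicalRing K]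
    [MeasurableSpace K] [BorelSpace K] {μ : Measure K} {g : K → ℂ} (hg : Integrable g μ)
    {χ : AddChar K Circle} (hχ : Continuous χ) (c : K) :
    Integrable (fun u => g u * (χ (c * u) : ℂ)) μ := by
  have h1 : Continuous fun u => (χ (c * u) : ℂ) := by fun_prop
  refine hg.mul_of_top_left (memLp_top_of_bound h1.aestronglyMeasurable 1 ?_)
  exact Filter.Eventually.of_forall fun u => (Circle.norm_coe _).le

open scoped Classical in
/-- The terms of a vanishing combination which share a ball of maximal level and whose characters
agree up to a residual one have vanishing sum, and so do their integrals. -/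
lemma IsGoodCharacter.block_eq_zero (hμ : μ Set.univ = ⊤) (hψ : V.IsGoodCharacter ψ V.one)
    {ψb : AddChar V.ResidueField Circle} (hc : Continuous ψb)
    (hψb : ∀ x ∈ V.integers, ψb (V.res x) = ψ x) {ι : Type*} (s : Finset ι)
    (p : ι → CGamma Γ) (g : ι → V.ResidueField → ℂ) (a b : ι → F) (γ : ι → Γ)
    (hg : ∀ i, Integrable (g i) μ) (i₀ : ι) (hmax : ∀ i ∈ s, γ i ≤ γ i₀)
    (h : ∀ x, ∑ i ∈ s, p i * V.term ψ (g i) (a i) (γ i) (b i) x = 0) :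
    let T := s.filter fun i => (b i - b i₀) * V.tt (γ i₀) ∈ V.integers ∧ γ i = γ i₀ ∧
      (a i₀ - a i) * V.tt (-γ i₀) ∈ V.integers
    (∀ x, ∑ i ∈ T, p i * V.term ψ (g i) (a i) (γ i) (b i) x = 0) ∧
      ∑ i ∈ T, p i * V.termIntegral μ ψ ψb (g i) (a i) (γ i) (b i) = 0 := by
  intro T
  set γ₀ := γ i₀ with hγ₀
  set a₀ := a i₀ with ha₀
  -- The lifts seen from the ball a₀ + t(γ₀)O: translates of g_i or zero at level γ₀, constants at
  -- the lower levels.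
  let C : ι → V.ResidueField → ℂ := fun i u =>
    if γ i = γ₀ then
      if (a₀ - a i) * V.tt (-γ₀) ∈ V.integers then g i (u + V.res ((a₀ - a i) * V.tt (-γ₀))) else 0
    else V.lift (g i) (a i) (γ i) a₀
  have hterm : ∀ i ∈ s, ∀ y ∈ V.integers, V.term ψ (g i) (a i) (γ i) (b i) (a₀ + V.tt γ₀ * y)
      = algebraMap ℂ (CGamma Γ)
        ((ψ (b i * a₀) : ℂ) * (C i (V.res y) * (ψ (b i * V.tt γ₀ * y) : ℂ))) := by
    intro i hi y hy
    unfold term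
    have e1 : V.lift (g i) (a i) (γ i) (a₀ + V.tt γ₀ * y) = C i (V.res y) := by
      simp only [C]
      split_ifs with h1 h2
      · rw [h1, V.lift_add_tt_mul _ _ _ _ hy, if_pos h2]
      · rw [h1, V.lift_add_tt_mul _ _ _ _ hy, if_neg h2]
      · exact V.exists_lift_eq_comp_res _ _ _ (lt_of_le_of_ne (hmax i hi) h1) y hy
    rw [e1, mul_add, AddChar.map_add_eq_mul, Circle.coe_mul, mul_assoc (b i)]
    congr 1; ring
  have hT : ∀ i, i ∈ T ↔ i ∈ s ∧ (b i - b i₀) * V.tt γ₀ ∈ V.integers ∧ γ i = γ₀ ∧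
      (a₀ - a i) * V.tt (-γ₀) ∈ V.integers := fun i => Finset.mem_filter
  have hCT : ∀ i ∈ T, ∀ u, C i u = g i (u + V.res ((a₀ - a i) * V.tt (-γ₀))) := by
    intro i hi u
    obtain ⟨-, -, h3, h4⟩ := (hT i).1 hi
    simp only [C, if_pos h3, if_pos h4]
  have hCint : ∀ i, γ i = γ₀ → Integrable (C i) μ := by
    intro i hi
    simp only [C, if_pos hi]
    split_ifs
    · exact (hg i).comp_add_right _
    · exact integrable_zero _ _ _
  have main : ∀ (ℓ : Module.Dual ℂ (CGamma Γ)) (u : V.ResidueField),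
      ∑ i ∈ T, ℓ (p i) * (ψ (b i * a₀) : ℂ) * C i u *
        (ψb (V.res ((b i - b i₀) * V.tt γ₀) * u) : ℂ) = 0 := by
    intro ℓ
    have h1 := hψ.sum_on_ball_eq_zero V hψb s (fun i => ℓ (p i) * (ψ (b i * a₀) : ℂ)) C
      (fun i => b i * V.tt γ₀) (b i₀ * V.tt γ₀) (fun y hy => by
        have h2 := h (a₀ + V.tt γ₀ * y)
        rw [Finset.sum_congr rfl fun i hi => by rw [hterm i hi y hy],
          sum_mul_algebraMap_eq_zero_iff] at h2
        rw [← h2 ℓ]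
        exact Finset.sum_congr rfl fun i _ => by ring)
    simp_rw [← sub_mul] at h1
    set s₁ := s.filter fun i => (b i - b i₀) * V.tt γ₀ ∈ V.integers with hs₁
    set f : ι → V.ResidueField → ℂ := fun i u => ℓ (p i) * (ψ (b i * a₀) : ℂ) * C i u *
        (ψb (V.res ((b i - b i₀) * V.tt γ₀) * u) : ℂ) with hf
    have h3 : ∀ u, ∑ i ∈ s₁ with γ i = γ₀, f i u + ∑ i ∈ s₁ with ¬ γ i = γ₀, f i u = 0 := by
      intro u
      rw [Finset.sum_filter_add_sum_filter_not]
      exact h1 u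
    have h4 : Integrable (fun u => ∑ i ∈ s₁ with γ i = γ₀, f i u) μ := by
      refine integrable_finsetSum _ fun i hi => ?_
      simp only [hf]
      exact integrable_mul_char ((hCint i (Finset.mem_filter.1 hi).2).const_mul _) hc _
    have h5 : ∀ u, ∑ i ∈ s₁ with ¬ γ i = γ₀, f i u
        = ∑ i ∈ s₁ with ¬ γ i = γ₀, (ℓ (p i) * (ψ (b i * a₀) : ℂ) * C i 0) *
          ((ψb.mulShift (V.res ((b i - b i₀) * V.tt γ₀)) u : Circle) : ℂ) := by
      intro u
      refine Finset.sum_congr rfl fun i hi => ?_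
      simp only [hf, C, if_neg (Finset.mem_filter.1 hi).2, AddChar.mulShift_apply]
    -- The lower levels contribute a trigonometric polynomial that is minus an integrable function,
    -- hence zero.
    have h6 : ∀ u, ∑ i ∈ s₁ with ¬ γ i = γ₀, f i u = 0 := by
      intro u
      rw [h5]
      refine trigonometric_eq_zero_of_integrable μ hμ _ _ _ ?_ u
      simp_rw [← h5]
      refine h4.neg.congr (Filter.Eventually.of_forall fun u => ?_)
      exact (eq_neg_of_add_eq_zero_right (h3 u)).symm
    intro u
    have h7 := h3 u
    rw [h6, add_zero] at h7
    rw [← h7]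
    -- Terms of level γ₀ with a ball other than that of i₀ vanish on the ball of i₀.
    refine Finset.sum_subset (fun i hi => ?_) fun i hi hi' => ?_
    · obtain ⟨h1, h2, h3, -⟩ := (hT i).1 hi
      simp [hs₁, h1, h2, h3]
    · simp only [hs₁, Finset.mem_filter] at hi
      have h8 : ¬ (a₀ - a i) * V.tt (-γ₀) ∈ V.integers := fun h8 =>
        hi' ((hT i).2 ⟨hi.1.1, hi.1.2, hi.2, h8⟩)
      simp [C, hi.2, h8]
  constructor
  · intro x
    by_cases hx : (x - a₀) * V.tt (-γ₀) ∈ V.integers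
    · obtain ⟨y, hy, rfl⟩ : ∃ y ∈ V.integers, x = a₀ + V.tt γ₀ * y := by
        refine ⟨_, hx, ?_⟩
        rw [tt_neg]; field_simp [V.tt_ne_zero γ₀]; ring
      rw [Finset.sum_congr rfl fun i hi => by rw [hterm i ((hT i).1 hi).1 y hy],
        sum_mul_algebraMap_eq_zero_iff]
      intro ℓ
      have h1 := congrArg (fun t => t * (ψ (b i₀ * V.tt γ₀ * y) : ℂ)) (main ℓ (V.res y))
      simp only [zero_mul, Finset.sum_mul] at h1
      rw [← h1]
      refine Finset.sum_congr rfl fun i hi => ?_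
      have h2 := ((hT i).1 hi).2.1
      have e : b i * V.tt γ₀ * y = (b i - b i₀) * V.tt γ₀ * y + b i₀ * V.tt γ₀ * y := by ring
      rw [← V.res_mul h2 hy, hψb _ (mul_mem h2 hy), e, AddChar.map_add_eq_mul, Circle.coe_mul]
      ring
    · refine Finset.sum_eq_zero fun i hi => ?_
      obtain ⟨-, -, h3, h4⟩ := (hT i).1 hi
      have h5 : ¬ (x - a i) * V.tt (-γ₀) ∈ V.integers := by
        have e : (x - a i) * V.tt (-γ₀) = (x - a₀) * V.tt (-γ₀) + (a₀ - a i) * V.tt (-γ₀) := by ring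
        rwa [e, V.mem_integers_add_iff h4]
      simp [term, lift, h3, h5]
  -- In the block the b_i t(γ₀) are congruent modulo O: all are integral or none is, and in the
  -- latter case all prescribed integrals are zero.
  · by_cases hb : b i₀ * V.tt γ₀ ∈ V.integers
    · have hval : ∀ i ∈ T, V.termIntegral μ ψ ψb (g i) (a i) (γ i) (b i)
          = algebraMap ℂ (CGamma Γ) ((ψ (b i * a₀) : ℂ) *
            ∫ u, C i u * (ψb (V.res (b i * V.tt γ₀) * u) : ℂ) ∂μ) * X γ₀ := by
        intro i hi
        obtain ⟨-, h2, h3, h4⟩ := (hT i).1 hi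
        have h5 : b i * V.tt γ₀ ∈ V.integers := by
          have : b i * V.tt γ₀ = (b i - b i₀) * V.tt γ₀ + b i₀ * V.tt γ₀ := by ring
          rw [this]; exact add_mem h2 hb
        rw [termIntegral, h3, if_pos h5]
        congr 2
        set δ := (a₀ - a i) * V.tt (-γ₀) with hδ
        -- Recentring from a_i to a₀ is a translation by the residue of δ on K; it also accounts for
        -- the change of ψ(b_i a_i) into ψ(b_i a₀).
        rw [← integral_add_right_eq_self _ (V.res δ), ← integral_const_mul, ← integral_const_mul]
        refine integral_congr_ae (Filter.Eventually.of_forall fun u => ?_)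
        have e1 : b i * a₀ = b i * a i + b i * V.tt γ₀ * δ := by
          rw [hδ, tt_neg]; field_simp [V.tt_ne_zero γ₀]; ring
        simp only [hCT i hi]
        rw [mul_add, AddChar.map_add_eq_mul, Circle.coe_mul, ← V.res_mul h5 h4,
          hψb _ (mul_mem h5 h4), e1, AddChar.map_add_eq_mul ψ, Circle.coe_mul]
        ring
      rw [Finset.sum_congr rfl fun i hi => by rw [hval i hi]]
      simp_rw [← mul_assoc]
      rw [← Finset.sum_mul, (sum_mul_algebraMap_eq_zero_iff _ _ _).2, zero_mul]
      intro ℓ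
      simp_rw [← integral_const_mul]
      rw [← integral_finsetSum]
      · refine (integral_congr_ae (Filter.Eventually.of_forall fun u => ?_)).trans
          (integral_zero _ _)
        have h1 := congrArg (fun t => t * (ψb (V.res (b i₀ * V.tt γ₀) * u) : ℂ)) (main ℓ u)
        simp only [zero_mul, Finset.sum_mul] at h1
        rw [← h1]
        refine Finset.sum_congr rfl fun i hi => ?_
        have h2 := ((hT i).1 hi).2.1
        have e : b i * V.tt γ₀ = (b i - b i₀) * V.tt γ₀ + b i₀ * V.tt γ₀ := by ring
        rw [e, V.res_add h2 hb, add_mul, AddChar.map_add_eq_mul, Circle.coe_mul]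
        ring
      · intro i hi
        exact ((integrable_mul_char (hCint i ((hT i).1 hi).2.2.1) hc _).const_mul _).const_mul _
    · refine Finset.sum_eq_zero fun i hi => ?_
      obtain ⟨-, h2, h3, h4⟩ := (hT i).1 hi
      have h5 : ¬ b i * V.tt γ₀ ∈ V.integers := fun h5 => hb (by
        have : b i₀ * V.tt γ₀ = b i * V.tt γ₀ - (b i - b i₀) * V.tt γ₀ := by ring
        rw [this]; exact sub_mem h5 h2)
      rw [termIntegral, h3, if_neg h5, mul_zero]

/-- Induction on the number of terms: the block of a term of maximal level sums to zero both as
functions and as integrals, so it can be discarded. This is the well-definedness of the integral. -/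
lemma IsGoodCharacter.sum_termIntegral_eq_zero (hμ : μ Set.univ = ⊤)
    (hψ : V.IsGoodCharacter ψ V.one)
    {ψb : AddChar V.ResidueField Circle} (hc : Continuous ψb)
    (hψb : ∀ x ∈ V.integers, ψb (V.res x) = ψ x) {ι : Type*} (s : Finset ι)
    (p : ι → CGamma Γ) (g : ι → V.ResidueField → ℂ) (a b : ι → F) (γ : ι → Γ)
    (hg : ∀ i, Integrable (g i) μ)
    (h : ∀ x, ∑ i ∈ s, p i * V.term ψ (g i) (a i) (γ i) (b i) x = 0) :
    ∑ i ∈ s, p i * V.termIntegral μ ψ ψb (g i) (a i) (γ i) (b i) = 0 := by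
  classical
  induction hn : s.card using Nat.strong_induction_on generalizing s with
  | _ n ih =>
    rcases s.eq_empty_or_nonempty with rfl | hs
    · simp
    obtain ⟨i₀, hi₀, hmax⟩ := s.exists_max_image γ hs
    obtain ⟨h1, h2⟩ := hψ.block_eq_zero V hμ hc hψb s p g a b γ hg i₀ hmax h
    set P : ι → Prop := fun i => (b i - b i₀) * V.tt (γ i₀) ∈ V.integers ∧ γ i = γ i₀ ∧
      (a i₀ - a i) * V.tt (-γ i₀) ∈ V.integers with hP
    rw [← Finset.sum_filter_add_sum_filter_not s P, h2, zero_add]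
    refine ih _ ?_ _ (fun x => ?_) rfl
    · rw [← hn]
      refine Finset.card_lt_card (Finset.filter_ssubset.2 ⟨i₀, hi₀, ?_⟩)
      simp [hP]
    · have h3 := h x
      rw [← Finset.sum_filter_add_sum_filter_not s P, h1 x, zero_add] at h3
      exact h3

end SplitValuation
end LiftedZeta

/-! ### Existence and basic properties of the integral on L(F, ψ). -/

namespace LiftedZeta

/-- Over a field, a linear section of the generators' map followed by the map to N defines C on the
span of v; C is then extended to M. -/
lemma exists_linearMap_of_linearCombination {k M N ι : Type*} [Field k] [AddCommGroup M]
    [Module k M] [AddCommGroup N] [Module k N] (v : ι → M) (w : ι → N)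
    (h : ∀ l : ι →₀ k, Finsupp.linearCombination k v l = 0 → Finsupp.linearCombination k w l = 0) :
    ∃ C : M →ₗ[k] N, ∀ i, C (v i) = w i := by
  set A := Finsupp.linearCombination k v
  set B := Finsupp.linearCombination k w
  obtain ⟨G, hG⟩ := A.rangeRestrict.exists_rightInverse_of_surjective A.range_rangeRestrict
  obtain ⟨C, hC⟩ := LinearMap.exists_extend (B ∘ₗ G)
  have key : ∀ x, C (A x) = B x := by
    intro x
    have h1 : C (A x) = B (G (A.rangeRestrict x)) := LinearMap.congr_fun hC (A.rangeRestrict x)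
    have h2 : A (G (A.rangeRestrict x)) = A x :=
      congrArg Subtype.val (LinearMap.congr_fun hG (A.rangeRestrict x))
    rw [h1, ← sub_eq_zero, ← map_sub]
    exact h _ (by rw [map_sub, h2, sub_self])
  refine ⟨C, fun i => ?_⟩
  simpa [A, B] using key (Finsupp.single i 1)

namespace SplitValuation

variable {F Γ : Type*} [Field F] [AddCommGroup Γ] [LinearOrder Γ] [IsOrderedAddMonoid Γ]
  (V : SplitValuation F Γ) [MeasurableSpace V.ResidueField]
  {μ : Measure V.ResidueField} {ψ : AddChar F Circle}

lemma term_mem {g : V.ResidueField → ℂ} (hg : Integrable g μ) (a : F) (γ : Γ) (b : F) :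
    V.term ψ g a γ b ∈ V.integrableFunctionsChar μ ψ := by
  refine Submodule.subset_span ⟨_, Submodule.subset_span ⟨g, a, γ, hg, rfl⟩, b, ?_⟩
  funext x
  simp [term]

omit [MeasurableSpace V.ResidueField] in
lemma lift_eq_term (g : V.ResidueField → ℂ) (a : F) (γ : Γ) :
    (fun x => algebraMap ℂ (CGamma Γ) (V.lift g a γ x)) = V.term ψ g a γ 0 := by
  funext x; simp [term]

variable (μ ψ) in
lemma integrableFunctionsChar_eq_span :
    V.integrableFunctionsChar μ ψ = Submodule.span _ {φ | ∃ (g : V.ResidueField → ℂ) (a : F) (γ : Γ)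
      (b : F), Integrable g μ ∧ φ = V.term ψ g a γ b} := by
  apply le_antisymm
  · refine Submodule.span_le.2 ?_
    rintro _ ⟨f, hf, b, rfl⟩
    induction hf using Submodule.span_induction with
    | mem f hf =>
      obtain ⟨g, a, γ, hg, rfl⟩ := hf
      refine Submodule.subset_span ⟨g, a, γ, b, hg, ?_⟩
      funext x; simp [term]
    | zero => simp only [Pi.zero_apply, zero_mul]; exact Submodule.zero_mem _
    | add f f' _ _ h h' =>
      simp only [Pi.add_apply, add_mul]
      exact Submodule.add_mem _ h h'
    | smul c f _ h =>
      simp only [Pi.smul_apply, smul_mul_assoc]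
      exact Submodule.smul_mem _ c h
  · refine Submodule.span_le.2 ?_
    rintro _ ⟨g, a, γ, b, hg, rfl⟩
    exact V.term_mem hg a γ b

omit [MeasurableSpace V.ResidueField] in
lemma lift_add (g : V.ResidueField → ℂ) (a : F) (γ : Γ) (x y : F) :
    V.lift g a γ (x + y) = V.lift g (a - y) γ x := by
  have h : x + y - a = x - (a - y) := by ring
  rw [lift, lift, h]

omit [MeasurableSpace V.ResidueField] in
lemma term_add (g : V.ResidueField → ℂ) (a : F) (γ : Γ) (b x y : F) :
    V.term ψ g a γ b (x + y)
      = algebraMap ℂ (CGamma Γ) (ψ (b * y) : ℂ) * V.term ψ g (a - y) γ b x := by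
  simp only [term, lift_add, mul_add, AddChar.map_add_eq_mul, Circle.coe_mul, map_mul]
  ring

variable [TopologicalSpace V.ResidueField] [IsTopologicalRing V.ResidueField]
  [BorelSpace V.ResidueField] [μ.IsAddHaarMeasure]

/-- The generators are all tuples (g, a, γ, b) with g integrable; compatibility with relations is
`sum_termIntegral_eq_zero`. -/
lemma IsGoodCharacter.exists_functional (hμ : μ Set.univ = ⊤) (hψ : V.IsGoodCharacter ψ V.one)
    {ψb : AddChar V.ResidueField Circle} (hc : Continuous ψb)
    (hψb : ∀ x ∈ V.integers, ψb (V.res x) = ψ x) :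
    ∃ C : (F → CGamma Γ) →ₗ[CGamma Γ] CGamma Γ, ∀ (g : V.ResidueField → ℂ) (a : F) (γ : Γ) (b : F),
      Integrable g μ → C (V.term ψ g a γ b) = V.termIntegral μ ψ ψb g a γ b := by
  let ι := {g : V.ResidueField → ℂ // Integrable g μ} × F × Γ × F
  obtain ⟨C, hC⟩ := exists_linearMap_of_linearCombination (k := CGamma Γ)
    (fun i : ι => V.term ψ i.1.1 i.2.1 i.2.2.1 i.2.2.2)
    (fun i : ι => V.termIntegral μ ψ ψb i.1.1 i.2.1 i.2.2.1 i.2.2.2) (fun l hl => by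
      rw [Finsupp.linearCombination_apply, Finsupp.sum] at hl ⊢
      refine hψ.sum_termIntegral_eq_zero V hμ hc hψb l.support l (fun i : ι => i.1.1)
        (fun i => i.2.1) (fun i => i.2.2.2) (fun i => i.2.2.1) (fun i => i.1.2) (fun x => ?_)
      have := congrFun hl x
      simpa [Finset.sum_apply] using this)
  exact ⟨C, fun g a γ b hg => hC (⟨g, hg⟩, a, γ, b)⟩

/-- The integral is an epsilon choice, so a functional has to be exhibited. Later only normalization
on lifts and translation invariance are used, never uniqueness. -/
lemma IsGoodCharacter.isIntegralFunctional_epsilon (hμ : μ Set.univ = ⊤)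
    (hψ : V.IsGoodCharacter ψ V.one) :
    V.IsIntegralFunctional μ ψ (Classical.epsilon (V.IsIntegralFunctional μ ψ)) := by
  refine Classical.epsilon_spec (p := V.IsIntegralFunctional μ ψ) ?_
  obtain ⟨ψb, hc, hψb⟩ := hψ.exists_residue V
  obtain ⟨C, hC⟩ := hψ.exists_functional V hμ hc hψb
  refine ⟨C.domRestrict _, ?_, ?_⟩
  · intro g a γ hg φ hφ
    have h1 : (φ : F → CGamma Γ) = V.term ψ g a γ 0 := by
      rw [← lift_eq_term]; funext x; exact hφ x
    rw [LinearMap.domRestrict_apply, h1, hC _ _ _ _ hg, termIntegral, if_pos (by simp)]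
    congr 2
    simp [V.res_of_mem (zero_mem _), show (⟨0, zero_mem _⟩ : V.integers) = 0 from rfl]
  · have key : ∀ φ ∈ V.integrableFunctionsChar μ ψ, ∀ y, C (fun x => φ (x + y)) = C φ := by
      intro φ hφ y
      rw [integrableFunctionsChar_eq_span] at hφ
      induction hφ using Submodule.span_induction with
      | mem f hf =>
        obtain ⟨g, a, γ, b, hg, rfl⟩ := hf
        have h1 : (fun x => V.term ψ g a γ b (x + y))
            = algebraMap ℂ (CGamma Γ) (ψ (b * y) : ℂ) • V.term ψ g (a - y) γ b := by
          funext x; rw [term_add]; rfl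
        -- Translation by y produces the factor ψ(by) and the centre a - y; the factor ψ(ba) in
        -- `termIntegral` absorbs both.
        rw [h1, map_smul, hC _ _ _ _ hg, hC _ _ _ _ hg, termIntegral, termIntegral]
        split_ifs
        · rw [smul_eq_mul, ← mul_assoc, ← map_mul, ← mul_assoc, ← Circle.coe_mul,
            ← AddChar.map_add_eq_mul, ← mul_add, add_sub_cancel]
        · simp
      | zero => rfl
      | add f f' _ _ h h' =>
        have := congrArg₂ (· + ·) h h'
        simp only [← map_add] at this
        exact this
      | smul c f _ h =>
        have := congrArg (c • ·) h
        simp only [← map_smul] at this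
        exact this
    intro φ φ' y h
    rw [LinearMap.domRestrict_apply, LinearMap.domRestrict_apply, ← key φ φ.2 y]
    congr 1
    funext x; exact h x

omit [TopologicalSpace V.ResidueField] [IsTopologicalRing V.ResidueField]
  [BorelSpace V.ResidueField] [μ.IsAddHaarMeasure] in
lemma integral_add {φ φ' : F → CGamma Γ} (h : φ ∈ V.integrableFunctionsChar μ ψ)
    (h' : φ' ∈ V.integrableFunctionsChar μ ψ) :
    V.integral μ ψ (φ + φ') = V.integral μ ψ φ + V.integral μ ψ φ' := by
  rw [integral, integral, integral, dif_pos h, dif_pos h', dif_pos (add_mem h h'), ← map_add]; rfl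

omit [TopologicalSpace V.ResidueField] [IsTopologicalRing V.ResidueField]
  [BorelSpace V.ResidueField] [μ.IsAddHaarMeasure] in
lemma integral_smul (c : CGamma Γ) {φ : F → CGamma Γ} (h : φ ∈ V.integrableFunctionsChar μ ψ) :
    V.integral μ ψ (c • φ) = c * V.integral μ ψ φ := by
  rw [integral, integral, dif_pos h, dif_pos (Submodule.smul_mem _ c h), ← smul_eq_mul, ← map_smul]
  rfl

lemma IsGoodCharacter.integral_lift (hμ : μ Set.univ = ⊤) (hψ : V.IsGoodCharacter ψ V.one)
    {g : V.ResidueField → ℂ} (hg : Integrable g μ) (a : F) (γ : Γ) :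
    V.integral μ ψ (fun x => algebraMap ℂ (CGamma Γ) (V.lift g a γ x))
      = algebraMap ℂ (CGamma Γ) (∫ u, g u ∂μ) * X γ := by
  have hm : (fun x => algebraMap ℂ (CGamma Γ) (V.lift g a γ x)) ∈ V.integrableFunctionsChar μ ψ := by
    rw [V.lift_eq_term (ψ := ψ)]; exact V.term_mem hg _ _ _
  rw [integral, dif_pos hm]
  exact (hψ.isIntegralFunctional_epsilon V hμ).1 g a γ hg _ fun _ => rfl

/-- Some z in the maximal ideal has ψ(b t(γ) z) ≠ 1. Translation by t(γ)z fixes the lift and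
multiplies the term by that number, so invariance forces the integral to be zero. -/
lemma IsGoodCharacter.integral_term_eq_zero (hμ : μ Set.univ = ⊤)
    (hψ : V.IsGoodCharacter ψ V.one)
    {g : V.ResidueField → ℂ} (hg : Integrable g μ) (a : F) {γ : Γ} {b : F}
    (hb : b * V.tt γ ∉ V.integers) : V.integral μ ψ (V.term ψ g a γ b) = 0 := by
  rw [← hψ.forall_mul_eq_one_iff] at hb
  push Not at hb
  obtain ⟨z, hz, hz1⟩ := hb
  have hm := V.term_mem (ψ := ψ) hg a γ b
  set y := V.tt γ * z
  have h1 : (fun x => V.term ψ g a γ b (x + y))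
      = algebraMap ℂ (CGamma Γ) (ψ (b * y) : ℂ) • V.term ψ g a γ b := by
    funext x
    have h2 : V.lift g (a - y) γ x = V.lift g a γ x := by
      have h3 : (x - (a - y)) * V.tt (-γ) = (x - a) * V.tt (-γ) + z := by
        rw [tt_neg]; simp only [y]; field_simp [V.tt_ne_zero γ]; ring
      have h4 : z ∈ V.integers := hz.le
      rw [lift, lift, h3, V.mem_integers_add_iff h4]
      split_ifs with h5
      · rw [V.res_add h5 h4, (V.res_eq_zero_iff h4).2 hz, add_zero]
      · rfl
    rw [term_add, Pi.smul_apply, smul_eq_mul, term, h2, term]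
  have h5 : V.integral μ ψ (fun x => V.term ψ g a γ b (x + y))
      = V.integral μ ψ (V.term ψ g a γ b) := by
    have hm' : (fun x => V.term ψ g a γ b (x + y)) ∈ V.integrableFunctionsChar μ ψ := by
      rw [h1]; exact Submodule.smul_mem _ _ hm
    rw [integral, integral, dif_pos hm, dif_pos hm']
    exact (hψ.isIntegralFunctional_epsilon V hμ).2 ⟨_, hm⟩ ⟨_, hm'⟩ y fun _ => rfl
  rw [h1, integral_smul _ _ hm] at h5
  have h6 : (algebraMap ℂ (CGamma Γ) (ψ (b * y) : ℂ) - 1) * V.integral μ ψ (V.term ψ g a γ b) = 0 := by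
    rw [sub_mul, h5, one_mul, sub_self]
  refine (mul_eq_zero.1 h6).resolve_left fun h7 => hz1 ?_
  rw [sub_eq_zero, ← map_one (algebraMap ℂ (CGamma Γ))] at h7
  have h8 := FaithfulSMul.algebraMap_injective ℂ (CGamma Γ) h7
  rw [mul_assoc]
  exact Circle.coe_injective (by simpa using h8)

end SplitValuation
end LiftedZeta

/-! ### The kernel, entire functions and the extended zeta integrand. -/

namespace LiftedZeta

section Kernel

variable {K : Type*} [Field K] [TopologicalSpace K] [IsTopologicalRing K] [LocallyCompactSpace K]

open scoped Classical in
/-- The function `u ↦ ω(u) |u| ^ s / |u|` on `Kˣ`, extended by zero to `K`. -/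
noncomputable def quasiKernel (ω : Kˣ →* ℂˣ) (s : ℂ) (u : K) : ℂ :=
  if h : u ≠ 0 then (ω (Units.mk0 u h) : ℂ) * ((absK u : ℝ) : ℂ) ^ s * ((absK u : ℝ) : ℂ)⁻¹ else 0

/-- Continuation of the local zeta integrals of the Schwartz-Bruhat functions on `K`, for the
quasi-character `ω`. -/
structure TateContinuation [MeasurableSpace K] (μ : Measure K) (ω : Kˣ →* ℂˣ) : Prop where
  integrable : ∀ g : K → ℂ, IsSchwartzBruhat g → Integrable g μ
  inv_localL : ∃ (σ : ℝ) (Z : ℂ → ℂ), Differentiable ℂ Z ∧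
    ∀ s : ℂ, σ < s.re → Z s = (localL ω s)⁻¹
  continuation : ∀ g : K → ℂ, IsSchwartzBruhat g → ∀ (a : K) (χ : AddChar K Circle), Continuous χ →
    ∃ (σ : ℝ) (Z : ℂ → ℂ), Differentiable ℂ Z ∧ ∀ s : ℂ, σ < s.re →
      Integrable (fun u => g (u - a) * (χ u : ℂ) * quasiKernel ω s u) μ ∧
      Z s = (localL ω s)⁻¹ * ∫ u, g (u - a) * (χ u : ℂ) * quasiKernel ω s u ∂μ
  exists_eq_one : ∃ g : K → ℂ, IsSchwartzBruhat g ∧ ∃ σ : ℝ, ∀ s : ℂ, σ < s.re →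
    (localL ω s)⁻¹ * ∫ u, g u * quasiKernel ω s u ∂μ = 1

lemma absK_pos {u : K} (hu : u ≠ 0) : 0 < absK u := by
  rw [absK, dif_neg hu]
  exact_mod_cast distribHaarChar_pos

end Kernel

section Entire

variable {Γ : Type*} [AddCommGroup Γ]

lemma X_zero : X (0 : Γ) = 1 := map_one _

lemma IsEntire.add {Z Z' : ℂ → CGamma Γ} (h : IsEntire Z) (h' : IsEntire Z') :
    IsEntire (fun s => Z s + Z' s) := by
  intro z
  obtain ⟨U, hU, hz, n, f, p, hf, hZ⟩ := h z
  obtain ⟨U', hU', hz', n', f', p', hf', hZ'⟩ := h' z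
  refine ⟨U ∩ U', hU.inter hU', ⟨hz, hz'⟩, n + n', Fin.append f f', Fin.append p p', ?_, ?_⟩
  · intro i
    refine Fin.addCases (fun i => ?_) (fun i => ?_) i
    · rw [Fin.append_left]; exact (hf i).mono Set.inter_subset_left
    · rw [Fin.append_right]; exact (hf' i).mono Set.inter_subset_right
  · intro w hw
    rw [Fin.sum_univ_add]
    simp [hZ w hw.1, hZ' w hw.2]

lemma IsEntire.const_mul {Z : ℂ → CGamma Γ} (h : IsEntire Z) (c : CGamma Γ) :
    IsEntire (fun s => c * Z s) := by
  intro z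
  obtain ⟨U, hU, hz, n, f, p, hf, hZ⟩ := h z
  refine ⟨U, hU, hz, n, f, fun i => c * p i, hf, fun w hw => ?_⟩
  simp only
  rw [hZ w hw, Finset.mul_sum]
  simp

lemma isEntire_smul_const {Z : ℂ → ℂ} (h : Differentiable ℂ Z) (p : CGamma Γ) :
    IsEntire (fun s => Z s • p) := fun _ =>
  ⟨Set.univ, isOpen_univ, trivial, 1, fun _ => Z, fun _ => p, fun _ => h.differentiableOn,
    fun w _ => by simp⟩

end Entire

namespace SplitValuation

variable {F Γ : Type*} [Field F] [AddCommGroup Γ] [LinearOrder Γ] [IsOrderedAddMonoid Γ]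
  (V : SplitValuation F Γ)

lemma mem_unitGroup_iff (x : Fˣ) : x ∈ V.integers.unitGroup ↔ V.ν (x : F) = 0 := by
  rw [ValuationSubring.mem_unitGroup_iff]
  constructor
  · intro h
    have h1 : (x : F) ∈ V.integers := (V.integers.valuation_le_one_iff _).1 h.le
    rw [← V.isUnit_integers_iff h1]
    exact (V.integers.valuation_eq_one_iff ⟨x, h1⟩).2 h
  · intro h
    have h1 : (x : F) ∈ V.integers := h.ge
    exact (V.integers.valuation_eq_one_iff ⟨x, h1⟩).1 ((V.isUnit_integers_iff h1).2 h)

lemma ord_eq_zero {x : Fˣ} (hx : V.ν (x : F) = 0) : V.ord x = 0 := by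
  have : ((V.ord x : Γ) : WithTop Γ) = 0 := by rw [ord, WithTop.coe_untop, hx]
  exact_mod_cast this

/-- Elements of `L(F, ψ)` are constant on a neighbourhood of zero for the valuation topology. -/
lemma exists_eq_apply_zero [TopologicalSpace V.ResidueField] [MeasurableSpace V.ResidueField]
    {μ : Measure V.ResidueField} {ψ : AddChar F Circle} (hψ : V.IsGoodCharacter ψ V.one)
    {h : F → CGamma Γ} (hh : h ∈ V.integrableFunctionsChar μ ψ) :
    ∃ γ : Γ, ∀ x, (γ : WithTop Γ) ≤ V.ν x → h x = h 0 := by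
  rw [integrableFunctionsChar_eq_span] at hh
  induction hh using Submodule.span_induction with
  | mem f hf =>
    obtain ⟨g, a, γ, b, -, rfl⟩ := hf
    obtain ⟨δ, hδ⟩ : ∃ δ : Γ, ∀ x, (δ : WithTop Γ) ≤ V.ν x → 0 < V.ν (b * x) := by
      by_cases hb : b = 0
      · exact ⟨0, fun x _ => by simp [hb]⟩
      · refine ⟨V.one - V.ord (Units.mk0 b hb), fun x hx => ?_⟩
        rw [AddValuation.map_mul]
        have h1 : V.ν b = (V.ord (Units.mk0 b hb) : WithTop Γ) := by
          rw [ord, WithTop.coe_untop]; rfl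
        rw [h1]
        refine lt_of_lt_of_le ?_ (add_le_add_right hx _)
        rw [← WithTop.coe_add, add_sub_cancel]
        exact_mod_cast V.one_pos
    -- One step beyond γ the lift is constant by `exists_lift_eq_comp_res`; beyond δ the product bx
    -- is in the maximal ideal, where ψ is trivial.
    refine ⟨max (γ + V.one) δ, fun x hx => ?_⟩
    rw [WithTop.coe_max, max_le_iff] at hx
    have hx1 : ψ (b * x) = 1 := hψ.eq_one_of_pos V (hδ x hx.2)
    have hx2 : x * V.tt (-(γ + V.one)) ∈ V.integers := V.ν_mul_tt_neg_nonneg.2 hx.1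
    have h2 := V.exists_lift_eq_comp_res g a 0
      (lt_add_of_pos_right γ V.one_pos) _ hx2
    rw [zero_add, tt_neg, mul_comm x, mul_inv_cancel_left₀ (V.tt_ne_zero _)] at h2
    simp [term, h2, hx1]
  | zero => exact ⟨0, fun _ _ => rfl⟩
  | add f f' _ _ h h' =>
    obtain ⟨γ, hγ⟩ := h
    obtain ⟨γ', hγ'⟩ := h'
    refine ⟨max γ γ', fun x hx => ?_⟩
    rw [WithTop.coe_max, max_le_iff] at hx
    simp [hγ x hx.1, hγ' x hx.2]
  | smul c f _ h =>
    obtain ⟨γ, hγ⟩ := h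
    exact ⟨γ, fun x hx => by simp [hγ x hx]⟩

/-- The difference is constant on a ball about 0 that contains some t(γ) ≠ 0, so it also vanishes at
0. Hence the extension chosen in `mulIntegral` is the explicit one. -/
lemma eq_of_eqOn_units [TopologicalSpace V.ResidueField] [MeasurableSpace V.ResidueField]
    {μ : Measure V.ResidueField} {ψ : AddChar F Circle} (hψ : V.IsGoodCharacter ψ V.one)
    {h h' : F → CGamma Γ} (hh : h ∈ V.integrableFunctionsChar μ ψ)
    (hh' : h' ∈ V.integrableFunctionsChar μ ψ) (heq : ∀ x : Fˣ, h x = h' x) : h = h' := by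
  funext x
  by_cases hx : x = 0
  · obtain ⟨γ, hγ⟩ := V.exists_eq_apply_zero hψ (sub_mem hh hh')
    have h1 := hγ (V.tt γ) (V.ν_tt γ).ge
    simp only [Pi.sub_apply, tt, heq, sub_self] at h1
    rw [hx]
    exact sub_eq_zero.1 h1.symm
  · exact heq (Units.mk0 x hx)

variable [TopologicalSpace V.ResidueField] [IsTopologicalRing V.ResidueField]
  [LocallyCompactSpace V.ResidueField] [MeasurableSpace V.ResidueField]
  {ψ : AddChar F Circle} {ω : V.integersˣ →* ℂˣ} {ωbar : V.ResidueFieldˣ →* ℂˣ}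

-- Units have ν = 0, so |x| is the complex number |x̄|. Every other x has residue 0, by convention
-- when x ∉ O, and the kernel vanishes there.
omit [MeasurableSpace V.ResidueField] in
lemma zetaIntegrand_mul_inv (hω : V.IsGoodMulCharacter ω ωbar) (f : F → CGamma Γ) (s : ℂ)
    (x : Fˣ) : V.zetaIntegrand f ω s x * (V.absF x)⁻¹
      = f x * algebraMap ℂ (CGamma Γ) (quasiKernel ωbar s (V.res x)) := by
  unfold zetaIntegrand
  split_ifs with h
  · have hν := (V.mem_unitGroup_iff x).1 h
    have hx : (x : F) ∈ V.integers := hν.ge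
    have hr : V.res x ≠ 0 := (V.res_ne_zero_iff hx).2 hν
    have hη : V.η x = V.res x := by rw [η, V.ord_eq_zero hν, neg_zero, tt_zero, mul_one]
    rw [absF, hη, V.ord_eq_zero hν, X_zero, mul_one, mul_assoc, ← map_inv₀, ← map_mul, quasiKernel,
      dif_pos hr, hω.2]
    have e : Units.map (IsLocalRing.residue V.integers : V.integers →* V.ResidueField)
        (V.integers.unitGroupMulEquiv ⟨x, h⟩) = Units.mk0 (V.res x) hr := by
      ext
      simp only [Units.coe_map, MonoidHom.coe_coe, Units.val_mk0]
      rw [V.res_of_mem hx]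
      rfl
    rw [e]
  · have hr : V.res x = 0 := by
      by_cases hx : (x : F) ∈ V.integers
      · by_contra h1
        exact h ((V.mem_unitGroup_iff x).2 ((V.res_ne_zero_iff hx).1 h1))
      · simp [res, hx]
    simp [quasiKernel, hr]

/-- The continuation statement for the zeta integral of `f`, for the explicit extension
`x ↦ f(x) ω(x̄) |x̄| ^ (s - 1)` of the integrand. -/
def HasContinuation (μ : Measure V.ResidueField) (ψ : AddChar F Circle)
    (ωbar : V.ResidueFieldˣ →* ℂˣ) (f : F → CGamma Γ) (Z : ℂ → CGamma Γ) : Prop :=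
  IsEntire Z ∧ ∃ σ : ℝ, ∀ s : ℂ, σ < s.re →
    (fun x => f x * algebraMap ℂ (CGamma Γ) (quasiKernel ωbar s (V.res x)))
      ∈ V.integrableFunctionsChar μ ψ ∧
    Z s = (localL ωbar s)⁻¹ • V.integral μ ψ
      (fun x => f x * algebraMap ℂ (CGamma Γ) (quasiKernel ωbar s (V.res x)))

variable {V} {μ : Measure V.ResidueField}

lemma HasContinuation.isZetaContinuation (hψ : V.IsGoodCharacter ψ V.one)
    (hω : V.IsGoodMulCharacter ω ωbar) {f : F → CGamma Γ} {Z : ℂ → CGamma Γ}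
    (h : V.HasContinuation μ ψ ωbar f Z) :
    V.ZetaDefined μ ψ f ω ∧ V.IsZetaContinuation μ ψ f ω ωbar Z := by
  obtain ⟨hZ, σ, hσ⟩ := h
  have key : ∀ s : ℂ, σ < s.re → V.IsMulIntegrable μ ψ (V.zetaIntegrand f ω s) := fun s hs =>
    ⟨_, (hσ s hs).1, fun x => (V.zetaIntegrand_mul_inv hω f s x).symm⟩
  refine ⟨⟨σ, key⟩, hZ, σ, fun s hs => ?_⟩
  rw [(hσ s hs).2, zeta, mulIntegral, dif_pos (key s hs)]
  congr 2
  have h1 := (key s hs).choose_spec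
  refine V.eq_of_eqOn_units hψ (hσ s hs).1 h1.1 fun x => ?_
  rw [h1.2 x, V.zetaIntegrand_mul_inv hω]

lemma HasContinuation.add {f f' : F → CGamma Γ} {Z Z' : ℂ → CGamma Γ}
    (h : V.HasContinuation μ ψ ωbar f Z) (h' : V.HasContinuation μ ψ ωbar f' Z') :
    V.HasContinuation μ ψ ωbar (f + f') (fun s => Z s + Z' s) := by
  obtain ⟨hZ, σ, hσ⟩ := h
  obtain ⟨hZ', σ', hσ'⟩ := h'
  refine ⟨hZ.add hZ', max σ σ', fun s hs => ?_⟩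
  obtain ⟨h1, h2⟩ := hσ s ((le_max_left _ _).trans_lt hs)
  obtain ⟨h1', h2'⟩ := hσ' s ((le_max_right _ _).trans_lt hs)
  have e : (fun x => (f + f') x * algebraMap ℂ (CGamma Γ) (quasiKernel ωbar s (V.res x)))
      = (fun x => f x * algebraMap ℂ (CGamma Γ) (quasiKernel ωbar s (V.res x)))
        + (fun x => f' x * algebraMap ℂ (CGamma Γ) (quasiKernel ωbar s (V.res x))) := by
    funext x; simp [add_mul]
  rw [e]
  refine ⟨add_mem h1 h1', ?_⟩
  beta_reduce
  rw [h2, h2', V.integral_add h1 h1', smul_add]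

lemma HasContinuation.smul {f : F → CGamma Γ} {Z : ℂ → CGamma Γ}
    (h : V.HasContinuation μ ψ ωbar f Z) (c : CGamma Γ) :
    V.HasContinuation μ ψ ωbar (c • f) (fun s => c * Z s) := by
  obtain ⟨hZ, σ, hσ⟩ := h
  refine ⟨hZ.const_mul c, σ, fun s hs => ?_⟩
  obtain ⟨h1, h2⟩ := hσ s hs
  have e : (fun x => (c • f) x * algebraMap ℂ (CGamma Γ) (quasiKernel ωbar s (V.res x)))
      = c • (fun x => f x * algebraMap ℂ (CGamma Γ) (quasiKernel ωbar s (V.res x))) := by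
    funext x; simp [mul_assoc]
  rw [e]
  refine ⟨Submodule.smul_mem _ c h1, ?_⟩
  beta_reduce
  rw [h2, V.integral_smul c h1, mul_smul_comm]

lemma hasContinuation_zero : V.HasContinuation μ ψ ωbar 0 0 := by
  refine ⟨fun z => ⟨Set.univ, isOpen_univ, trivial, 0, Fin.elim0, Fin.elim0, fun i => i.elim0,
    fun _ _ => by simp⟩, 0, fun s _ => ?_⟩
  have e : (fun x => (0 : F → CGamma Γ) x * algebraMap ℂ (CGamma Γ)
      (quasiKernel ωbar s (V.res x))) = 0 := by funext x; simp
  rw [e]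
  refine ⟨Submodule.zero_mem _, ?_⟩
  have := V.integral_smul (μ := μ) (ψ := ψ) 0 (Submodule.zero_mem _)
  rw [smul_zero, zero_mul] at this
  simp [this]

end SplitValuation
end LiftedZeta

/-! ### Reduction of the zeta integrals to the residue field. -/

namespace LiftedZeta
namespace SplitValuation

variable {F Γ : Type*} [Field F] [AddCommGroup Γ] [LinearOrder Γ] [IsOrderedAddMonoid Γ]
  {V : SplitValuation F Γ} [TopologicalSpace V.ResidueField] [IsTopologicalRing V.ResidueField]
  [LocallyCompactSpace V.ResidueField] [MeasurableSpace V.ResidueField] [BorelSpace V.ResidueField]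
  {μ : Measure V.ResidueField} [μ.IsAddHaarMeasure]
  {ψ : AddChar F Circle} {ωbar : V.ResidueFieldˣ →* ℂˣ}

omit [MeasurableSpace V.ResidueField] [BorelSpace V.ResidueField]  in
lemma term_mul_quasiKernel_of_ball (ωbar : V.ResidueFieldˣ →* ℂˣ) (s : ℂ) (g : V.ResidueField → ℂ)
    {a : F} {γ : Γ} (b : F) (u : V.ResidueField)
    (h : ∀ x, (γ : WithTop Γ) ≤ V.ν (x - a) → V.res x = u) :
    (fun x => V.term ψ g a γ b x * algebraMap ℂ (CGamma Γ) (quasiKernel ωbar s (V.res x)))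
      = algebraMap ℂ (CGamma Γ) (quasiKernel ωbar s u) • V.term ψ g a γ b := by
  funext x
  rw [Pi.smul_apply, smul_eq_mul, mul_comm]
  by_cases hx : (x - a) * V.tt (-γ) ∈ V.integers
  · rw [h x (V.ν_mul_tt_neg_nonneg.1 hx)]
  · simp [term, lift, hx]

omit [IsTopologicalRing V.ResidueField] [LocallyCompactSpace V.ResidueField]
  [TopologicalSpace V.ResidueField] [MeasurableSpace V.ResidueField] [BorelSpace V.ResidueField] in
lemma res_eq_of_pos {x a : F} (ha : 0 ≤ V.ν a) (h : 0 < V.ν (x - a)) : V.res x = V.res a := by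
  have h1 : x - a ∈ V.integers := h.le
  have h2 : a ∈ V.integers := ha
  rw [← sub_add_cancel x a, V.res_add h1 h2, (V.res_eq_zero_iff h1).2 h, zero_add]

omit [IsTopologicalRing V.ResidueField] [LocallyCompactSpace V.ResidueField]
  [TopologicalSpace V.ResidueField] [MeasurableSpace V.ResidueField] [BorelSpace V.ResidueField] in
lemma res_eq_zero_of_ne {x : F} (h : V.ν x ≠ 0) : V.res x = 0 := by
  by_cases hx : x ∈ V.integers
  · by_contra h1
    exact h ((V.res_ne_zero_iff hx).1 h1)
  · simp [res, hx]

-- In the first case ν(x) = ν(a) < 0 on the whole ball, in the other two ν(x) > 0: the ball contains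
-- no unit.
omit [MeasurableSpace V.ResidueField] [BorelSpace V.ResidueField] [IsTopologicalRing V.ResidueField]
  [LocallyCompactSpace V.ResidueField] [TopologicalSpace V.ResidueField] in
lemma res_eq_zero_on_ball {a : F} {γ : Γ}
    (h : V.ν a < min (γ : WithTop Γ) 0 ∨ (0 < V.ν a ∧ V.ν a < (γ : WithTop Γ)) ∨
      (0 < γ ∧ (γ : WithTop Γ) ≤ V.ν a)) (x : F) (hx : (γ : WithTop Γ) ≤ V.ν (x - a)) :
    V.res x = 0 := by
  refine res_eq_zero_of_ne ?_
  have e : x = x - a + a := by ring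
  rcases h with h | ⟨h1, h2⟩ | ⟨h1, h2⟩
  · rw [lt_min_iff] at h
    have : V.ν (x - a + a) = V.ν a := by
      rw [add_comm]
      exact AddValuation.map_add_eq_of_lt_left V.ν (h.1.trans_le hx)
    rw [← e] at this
    rw [this]; exact h.2.ne
  · have h3 : 0 < V.ν (x - a + a) :=
      lt_of_lt_of_le (lt_min (h1.trans (h2.trans_le hx)) h1) (V.ν.map_add _ _)
    rw [← e] at h3
    exact h3.ne'
  · have h1' : (0 : WithTop Γ) < (γ : WithTop Γ) := by exact_mod_cast h1
    have h3 : 0 < V.ν (x - a + a) :=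
      lt_of_lt_of_le (lt_min (h1'.trans_le hx) (h1'.trans_le h2)) (V.ν.map_add _ _)
    rw [← e] at h3
    exact h3.ne'

-- At level 0 with integral centre the ball is O, so the lift can be recentred at 0 and the kernel
-- moved inside the lifted function.
omit [MeasurableSpace V.ResidueField] [BorelSpace V.ResidueField] in
lemma term_zero_mul_quasiKernel (ωbar : V.ResidueFieldˣ →* ℂˣ) (s : ℂ) (g : V.ResidueField → ℂ)
    {a : F} (ha : a ∈ V.integers) (b : F) :
    (fun x => V.term ψ g a 0 b x * algebraMap ℂ (CGamma Γ) (quasiKernel ωbar s (V.res x)))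
      = V.term ψ (fun u => g (u - V.res a) * quasiKernel ωbar s u) 0 0 b := by
  funext x
  have h1 : x - a ∈ V.integers ↔ x ∈ V.integers := by
    rw [sub_eq_add_neg]; exact V.mem_integers_add_iff (neg_mem ha)
  rw [term, term, lift, lift, ← map_mul, neg_zero, tt_zero, mul_one, mul_one, sub_zero, h1]
  split_ifs with hx
  · rw [V.res_sub hx ha]; congr 1; ring
  · simp

omit [IsTopologicalRing V.ResidueField] [LocallyCompactSpace V.ResidueField]
  [MeasurableSpace V.ResidueField] [BorelSpace V.ResidueField] [TopologicalSpace V.ResidueField] in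
lemma term_zero_eq_lift {ψb : AddChar V.ResidueField Circle}
    (hψb : ∀ x ∈ V.integers, ψb (V.res x) = ψ x) (g : V.ResidueField → ℂ) {b : F}
    (hb : b ∈ V.integers) :
    V.term ψ g 0 0 b = fun x => algebraMap ℂ (CGamma Γ)
      (V.lift (fun u => g u * (ψb (V.res b * u) : ℂ)) 0 0 x) := by
  funext x
  rw [term, lift, lift, neg_zero, tt_zero, mul_one, sub_zero]
  split_ifs with hx
  · rw [← V.res_mul hb hx, hψb _ (mul_mem hb hx)]
  · simp

/-- One case for each position of the ball. For the ball O the cases b ∈ O (a Tate integral with a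
residual character) and b ∉ O (integral zero) are separate. -/
lemma hasContinuation_term (hμ : μ Set.univ = ⊤) (hψ : V.IsGoodCharacter ψ V.one)
    (hT : TateContinuation μ ωbar) {g : V.ResidueField → ℂ} (hg : IsSchwartzBruhat g) {a : F} {γ : Γ}
    (haγ : V.IsTreated a γ) (b : F) :
    ∃ Z, V.HasContinuation μ ψ ωbar (V.term ψ g a γ b) Z := by
  have hgi := hT.integrable g hg
  rcases haγ with h | ⟨ha, hγ⟩ | ⟨rfl, ha⟩
  · refine ⟨0, (hasContinuation_zero (μ := μ) (ψ := ψ) (ωbar := ωbar)).1, 0, fun s _ => ?_⟩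
    rw [term_mul_quasiKernel_of_ball ωbar s g b 0 (res_eq_zero_on_ball h),
      V.integral_smul _ (V.term_mem hgi a γ b)]
    simp [quasiKernel]
  -- The kernel is the constant k_s(ā), entire in s, and the integral of the term does not involve
  -- s; only the continuation of 1/L is needed.
  · obtain ⟨σ, L, hL, hσ⟩ := hT.inv_localL
    have hball : ∀ x, (γ : WithTop Γ) ≤ V.ν (x - a) → V.res x = V.res a := fun x hx =>
      res_eq_of_pos ha.ge (lt_of_lt_of_le (by exact_mod_cast hγ) hx)
    have ha0 : V.res a ≠ 0 := (V.res_ne_zero_iff ha.ge).2 ha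
    have hk : Differentiable ℂ fun s => quasiKernel ωbar s (V.res a) := by
      simp only [quasiKernel, dif_pos ha0]
      have hpos := absK_pos ha0
      refine Differentiable.mul_const (Differentiable.const_mul ?_ _) _
      intro s
      exact differentiableAt_id.const_cpow (Or.inl (by exact_mod_cast hpos.ne'))
    refine ⟨_, isEntire_smul_const (hL.mul hk) (V.integral μ ψ (V.term ψ g a γ b)), σ,
      fun s hs => ?_⟩
    rw [term_mul_quasiKernel_of_ball ωbar s g b _ hball, V.integral_smul _ (V.term_mem hgi a γ b)]
    refine ⟨Submodule.smul_mem _ _ (V.term_mem hgi a γ b), ?_⟩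
    simp only [Pi.mul_apply]
    rw [← hσ s hs, mul_smul, Algebra.smul_def (quasiKernel ωbar s (V.res a))]
  · have ha' : a ∈ V.integers := ha
    obtain ⟨ψb, hc, hψb⟩ := hψ.exists_residue V
    by_cases hb : b ∈ V.integers
    · obtain ⟨σ, Z, hZ, hσ⟩ := hT.continuation g hg (V.res a) (ψb.mulShift (V.res b))
        (hc.comp (continuous_const.mul continuous_id))
      refine ⟨_, isEntire_smul_const hZ 1, σ, fun s hs => ?_⟩
      obtain ⟨h1, h2⟩ := hσ s hs
      have e : (fun u => g (u - V.res a) * quasiKernel ωbar s u * (ψb (V.res b * u) : ℂ))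
          = fun u => g (u - V.res a) * ((ψb.mulShift (V.res b) u : Circle) : ℂ)
            * quasiKernel ωbar s u := by
        funext u; rw [AddChar.mulShift_apply]; ring
      rw [term_zero_mul_quasiKernel ωbar s g ha' b, term_zero_eq_lift hψb _ hb, e]
      rw [hψ.integral_lift V hμ h1, V.lift_eq_term (ψ := ψ)]
      refine ⟨V.term_mem h1 _ _ _, ?_⟩
      rw [h2, X_zero, mul_one, mul_smul, Algebra.algebraMap_eq_smul_one]
    -- The trivial character is used here only for the integrability of g(u - ā) k_s(u); the
    -- integral itself vanishes by oscillation.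
    · obtain ⟨σ, Z, hZ, hσ⟩ := hT.continuation g hg (V.res a) 1 (by exact continuous_const)
      refine ⟨0, (hasContinuation_zero (μ := μ) (ψ := ψ) (ωbar := ωbar)).1, σ, fun s hs => ?_⟩
      have h1 := (hσ s hs).1
      simp only [AddChar.one_apply, Circle.coe_one, mul_one] at h1
      rw [term_zero_mul_quasiKernel ωbar s g ha' b]
      refine ⟨V.term_mem h1 _ _ _, ?_⟩
      rw [hψ.integral_term_eq_zero V hμ h1 0 (by rwa [tt_zero, mul_one]), smul_zero]
      rfl

lemma exists_hasContinuation (hμ : μ Set.univ = ⊤) (hψ : V.IsGoodCharacter ψ V.one)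
    (hT : TateContinuation μ ωbar) {f : F → CGamma Γ} (hf : f ∈ V.treatedSpace ψ) :
    ∃ Z, V.HasContinuation μ ψ ωbar f Z := by
  induction hf using Submodule.span_induction with
  | mem f hf =>
    obtain ⟨g, a, γ, b, hg, haγ, rfl⟩ := hf
    exact hasContinuation_term hμ hψ hT hg haγ b
  | zero => exact ⟨0, hasContinuation_zero⟩
  | add f f' _ _ h h' =>
    obtain ⟨Z, hZ⟩ := h
    obtain ⟨Z', hZ'⟩ := h'
    exact ⟨_, hZ.add hZ'⟩
  | smul c f _ h =>
    obtain ⟨Z, hZ⟩ := h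
    exact ⟨_, hZ.smul c⟩

lemma exists_hasContinuation_one (hμ : μ Set.univ = ⊤) (hψ : V.IsGoodCharacter ψ V.one)
    (hT : TateContinuation μ ωbar) : ∃ g ∈ V.schwartzSpace ψ, g ∈ V.treatedSpace ψ ∧
      V.HasContinuation μ ψ ωbar g (fun _ => 1) := by
  obtain ⟨g, hg, σ, hσ⟩ := hT.exists_eq_one
  -- Again only integrability is taken from the continuation; the value comes from `exists_eq_one`.
  obtain ⟨σ', Z, hZ, hσ'⟩ := hT.continuation g hg 0 1 (by exact continuous_const)
  refine ⟨V.term ψ g 0 0 0, Submodule.subset_span ⟨g, 0, 0, 0, hg, rfl⟩,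
    Submodule.subset_span ⟨g, 0, 0, 0, hg, Or.inr (Or.inr ⟨rfl, by simp⟩), rfl⟩, ?_, max σ σ',
    fun s hs => ?_⟩
  · simpa using isEntire_smul_const (Γ := Γ) (differentiable_const (1 : ℂ)) 1
  · have h1 := (hσ' s ((le_max_right _ _).trans_lt hs)).1
    simp only [AddChar.one_apply, Circle.coe_one, mul_one, sub_zero] at h1
    have h2 := hσ s ((le_max_left _ _).trans_lt hs)
    have h0 : V.res 0 = 0 := (V.res_eq_zero_iff (zero_mem _)).2 (by simp)
    rw [term_zero_mul_quasiKernel ωbar s g (zero_mem _) 0, h0]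
    simp only [sub_zero]
    refine ⟨V.term_mem h1 _ _ _, ?_⟩
    rw [← lift_eq_term, hψ.integral_lift V hμ h1, X_zero, mul_one, Algebra.smul_def, ← map_mul, h2,
      map_one]

/-- The proposition on one-dimensional zeta integrals, given the continuation of the local zeta
integrals of the residue field. -/
theorem zeta_continuation (hμ : μ Set.univ = ⊤) (hψ : V.IsGoodCharacter ψ V.one)
    {ω : V.integersˣ →* ℂˣ} (hω : V.IsGoodMulCharacter ω ωbar) (hT : TateContinuation μ ωbar) :
    (∀ f ∈ V.schwartzSpace ψ, f ∈ V.treatedSpace ψ →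
      V.ZetaDefined μ ψ f ω ∧ ∃ Z, V.IsZetaContinuation μ ψ f ω ωbar Z) ∧
    ∃ g ∈ V.schwartzSpace ψ, g ∈ V.treatedSpace ψ ∧
      V.ZetaDefined μ ψ g ω ∧ V.IsZetaContinuation μ ψ g ω ωbar (fun _ => 1) := by
  constructor
  · intro f _ hf
    obtain ⟨Z, hZ⟩ := exists_hasContinuation hμ hψ hT hf
    obtain ⟨h1, h2⟩ := hZ.isZetaContinuation hψ hω
    exact ⟨h1, Z, h2⟩
  · obtain ⟨g, hg, hg', h⟩ := exists_hasContinuation_one hμ hψ hT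
    exact ⟨g, hg, hg', h.isZetaContinuation hψ hω⟩

end SplitValuation
end LiftedZeta

/-! ### The normalized absolute value and the kernel on K. -/

namespace LiftedZeta

section General

variable {K : Type*} [Field K] [TopologicalSpace K] [IsTopologicalRing K] [LocallyCompactSpace K]

lemma absK_mul (x y : K) : absK (x * y) = absK x * absK y := by
  by_cases hx : x = 0
  · simp [absK, hx]
  by_cases hy : y = 0
  · simp [absK, hy]
  rw [absK, absK, absK, dif_neg hx, dif_neg hy, dif_neg (mul_ne_zero hx hy), ← NNReal.coe_mul,
    ← map_mul]
  congr 2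
  ext; simp

lemma absK_one : absK (1 : K) = 1 := by
  rw [absK, dif_neg one_ne_zero, Units.mk0_one, map_one]; rfl

lemma absK_zero : absK (0 : K) = 0 := by simp [absK]

lemma absK_nonneg (x : K) : 0 ≤ absK x := by
  by_cases hx : x = 0
  · rw [hx, absK_zero]
  · exact (absK_pos hx).le

lemma absK_inv (x : K) : absK x⁻¹ = (absK x)⁻¹ := by
  by_cases hx : x = 0
  · simp [hx, absK_zero]
  · refine eq_inv_of_mul_eq_one_left ?_
    rw [← absK_mul, inv_mul_cancel₀ hx, absK_one]

lemma quasiKernel_zero (ω : Kˣ →* ℂˣ) (s : ℂ) : quasiKernel ω s 0 = 0 := by simp [quasiKernel]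

lemma quasiKernel_mul (ω : Kˣ →* ℂˣ) (s : ℂ) (x y : K) :
    quasiKernel ω s (x * y) = quasiKernel ω s x * quasiKernel ω s y := by
  by_cases hx : x = 0
  · simp [quasiKernel, hx]
  by_cases hy : y = 0
  · simp [quasiKernel, hy]
  have e : Units.mk0 (x * y) (mul_ne_zero hx hy) = Units.mk0 x hx * Units.mk0 y hy := by ext; simp
  rw [quasiKernel, quasiKernel, quasiKernel, dif_pos hx, dif_pos hy, dif_pos (mul_ne_zero hx hy), e,
    map_mul, absK_mul, Units.val_mul, Complex.ofReal_mul,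
    Complex.mul_cpow_ofReal_nonneg (absK_nonneg _) (absK_nonneg _), mul_inv]
  ring

lemma quasiKernel_ne_zero (ω : Kˣ →* ℂˣ) (s : ℂ) {x : K} (hx : x ≠ 0) :
    quasiKernel ω s x ≠ 0 := by
  have h : (absK x : ℂ) ≠ 0 := by exact_mod_cast (absK_pos hx).ne'
  rw [quasiKernel, dif_pos hx]
  exact mul_ne_zero (mul_ne_zero (Units.ne_zero _) (by simp [Complex.cpow_eq_zero_iff, h]))
    (inv_ne_zero h)

lemma quasiKernel_one (ω : Kˣ →* ℂˣ) (s : ℂ) : quasiKernel ω s 1 = 1 := by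
  have h := quasiKernel_mul ω s 1 1
  rw [mul_one] at h
  exact (mul_eq_left₀ (quasiKernel_ne_zero ω s one_ne_zero)).1 h.symm

lemma quasiKernel_apply_one (ω : Kˣ →* ℂˣ) {x : K} (hx : x ≠ 0) :
    quasiKernel ω 1 x = ω (Units.mk0 x hx) := by
  have h : (absK x : ℂ) ≠ 0 := by exact_mod_cast (absK_pos hx).ne'
  rw [quasiKernel, dif_pos hx, Complex.cpow_one, mul_inv_cancel_right₀ h]

/-- Isolates the dependence on s as a power of |x|. -/
lemma quasiKernel_eq (ω : Kˣ →* ℂˣ) (s : ℂ) (x : K) :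
    quasiKernel ω s x = (absK x : ℂ) ^ s * (absK x : ℂ)⁻¹ * quasiKernel ω 1 x := by
  by_cases hx : x = 0
  · simp [hx, quasiKernel_zero]
  · rw [quasiKernel_apply_one ω hx, quasiKernel, dif_pos hx]; ring

lemma norm_absK_cpow_mul_inv {x : K} (hx : x ≠ 0) (s : ℂ) :
    ‖(absK x : ℂ) ^ s * (absK x : ℂ)⁻¹‖ = absK x ^ (s.re - 1) := by
  have h := absK_pos hx
  rw [norm_mul, Complex.norm_cpow_eq_rpow_re_of_pos h, norm_inv, Complex.norm_real,
    Real.norm_of_nonneg h.le, Real.rpow_sub_one h.ne', div_eq_mul_inv]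

/-- The only complex number close to `1` with all its powers `z ^ (2 ^ n)` is `1`. -/
lemma eq_one_of_forall_pow_two_pow {z : ℂ} (h : ∀ n : ℕ, ‖z ^ 2 ^ n - 1‖ ≤ 1 / 2) : z = 1 := by
  by_contra hz
  have h0 : 0 < ‖z - 1‖ := norm_pos_iff.2 (sub_ne_zero.2 hz)
  have key : ∀ n : ℕ, (3 / 2 : ℝ) ^ n * ‖z - 1‖ ≤ ‖z ^ 2 ^ n - 1‖ := by
    intro n
    induction n with
    | zero => simp
    | succ n ih =>
      -- The second factor is 2 plus a number of norm at most 1/2, so each squaring multiplies the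
      -- distance to 1 by at least 3/2.
      have e : z ^ 2 ^ (n + 1) - 1 = (z ^ 2 ^ n - 1) * (z ^ 2 ^ n + 1) := by
        rw [pow_succ 2 n, pow_mul]; ring
      have h1 : (3 / 2 : ℝ) ≤ ‖z ^ 2 ^ n + 1‖ := by
        have h2 : ‖(2 : ℂ)‖ ≤ ‖z ^ 2 ^ n + 1‖ + ‖z ^ 2 ^ n - 1‖ := by
          have : (2 : ℂ) = (z ^ 2 ^ n + 1) - (z ^ 2 ^ n - 1) := by ring
          nth_rw 1 [this]
          exact norm_sub_le _ _
        rw [Complex.norm_two] at h2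
        linarith [h n]
      rw [e, norm_mul, pow_succ]
      calc (3 / 2 : ℝ) ^ n * (3 / 2) * ‖z - 1‖ = ((3 / 2 : ℝ) ^ n * ‖z - 1‖) * (3 / 2) := by ring
        _ ≤ _ := mul_le_mul ih h1 (by norm_num) (norm_nonneg _)
  obtain ⟨n, hn⟩ := pow_unbounded_of_one_lt (1 / ‖z - 1‖) (by norm_num : (1 : ℝ) < 3 / 2)
  rw [div_lt_iff₀ h0] at hn
  linarith [key n, h n]

variable [MeasurableSpace K] [BorelSpace K] (μ : Measure K) [μ.IsAddHaarMeasure] [μ.Regular]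

lemma measure_mul_image (y : K) (hy : y ≠ 0) (S : Set K) :
    μ ((fun x => y * x) '' S) = ENNReal.ofReal (absK y) * μ S := by
  have h := distribHaarChar_mul μ (Units.mk0 y hy) S
  rw [absK, dif_neg hy, ENNReal.ofReal_coe_nnreal, h]
  rfl

lemma integral_comp_mul_left (y : K) (hy : y ≠ 0) (f : K → ℂ) :
    ∫ u, f (y * u) ∂μ = ((absK y : ℝ) : ℂ)⁻¹ * ∫ u, f u ∂μ := by
  have hc : Continuous fun x : K => y * x := continuous_const.mul continuous_id
  have hc' : Continuous fun x : K => y⁻¹ * x := continuous_const.mul continuous_id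
  let e : K ≃ₜ K :=
    { toFun := fun x => y * x
      invFun := fun x => y⁻¹ * x
      left_inv := fun x => inv_mul_cancel_left₀ hy x
      right_inv := fun x => mul_inv_cancel_left₀ hy x
      continuous_toFun := hc
      continuous_invFun := hc' }
  have h1 : μ.map e.toMeasurableEquiv = ENNReal.ofReal (absK y)⁻¹ • μ := by
    ext S hS
    rw [MeasurableEquiv.map_apply, Measure.smul_apply, smul_eq_mul, ← absK_inv,
      ← measure_mul_image μ y⁻¹ (inv_ne_zero hy)]
    congr 1
    ext x
    simp only [Set.mem_preimage, Set.mem_image]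
    constructor
    · intro hx
      exact ⟨_, hx, inv_mul_cancel_left₀ hy x⟩
    · rintro ⟨z, hz, rfl⟩
      change y * (y⁻¹ * z) ∈ S
      rwa [mul_inv_cancel_left₀ hy]
  have h2 := integral_map_equiv (μ := μ) e.toMeasurableEquiv f
  rw [h1, integral_smul_measure] at h2
  change _ = ∫ u, f (y * u) ∂μ at h2
  rw [← h2, ENNReal.toReal_ofReal (inv_nonneg.2 (absK_nonneg y)), Complex.real_smul,
    Complex.ofReal_inv]

end General

end LiftedZeta

/-! ### Non-archimedean fields: topology and absolute value. -/

namespace LiftedZeta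

section Nonarch

open ValuativeRel Topology

variable (K : Type*) [Field K] [TopologicalSpace K] [ValuativeRel K] [IsNonarchimedeanLocalField K]

lemma exists_valuation_eq_zpow : ∃ ϖ : K, ϖ ≠ 0 ∧ valuation K ϖ < 1 ∧
    ∀ x : K, x ≠ 0 → ∃ n : ℤ, valuation K x = valuation K ϖ ^ n := by
  let e := IsNonarchimedeanLocalField.valueGroupWithZeroIsoInt K
  obtain ⟨ϖ, hϖ⟩ := valuation_surjective (K := K) (e.symm (WithZero.exp (-1)))
  have h1 : e (valuation K ϖ) = WithZero.exp (-1) := by rw [hϖ, OrderMonoidIso.apply_symm_apply]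
  refine ⟨ϖ, ?_, ?_, fun x hx => ?_⟩
  · rintro rfl
    rw [map_zero, map_zero] at h1
    exact WithZero.exp_ne_zero h1.symm
  · rw [← map_lt_map_iff e, h1, map_one, ← WithZero.exp_zero, WithZero.exp_lt_exp]
    norm_num
  · have h2 : e (valuation K x) ≠ 0 := by simpa using hx
    refine ⟨-(WithZero.log (e (valuation K x))), EquivLike.injective e ?_⟩
    rw [map_zpow₀, h1, ← WithZero.exp_zsmul]
    simp [WithZero.exp_log h2]

instance countable_valueGroupWithZero : Countable (ValueGroupWithZero K) :=
  have : Countable (WithZero (Multiplicative ℤ)) := inferInstanceAs (Countable (Option ℤ))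
  (EquivLike.injective (IsNonarchimedeanLocalField.valueGroupWithZeroIsoInt K)).countable

instance t2Space_of_isNonarchimedeanLocalField : T2Space K := by
  refine IsTopologicalAddGroup.t2Space_of_zero_sep fun x hx => ⟨{y | valuation K y < valuation K x},
    (IsValuativeTopology.hasBasis_nhds_zero' K).mem_of_mem (by simpa using hx), by simp⟩

/-- Together with σ-compactness this gives regularity of Haar measures, which the scaling lemma
`measure_mul_image` requires. -/
instance pseudoMetrizableSpace_of_isNonarchimedeanLocalField :
    TopologicalSpace.PseudoMetrizableSpace K := by
  let := IsTopologicalAddGroup.rightUniformSpace K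
  have := isUniformAddGroup_of_addCommGroup (G := K)
  have : (𝓝 (0 : K)).IsCountablyGenerated :=
    (IsValuativeTopology.hasBasis_nhds_zero' K).isCountablyGenerated
  have := IsUniformAddGroup.uniformity_countably_generated (α := K)
  exact UniformSpace.pseudoMetrizableSpace

instance sigmaCompactSpace_of_isNonarchimedeanLocalField : SigmaCompactSpace K := by
  refine isSigmaCompact_univ_iff.1 ?_
  have h : (Set.univ : Set K) = ⋃ γ : ValueGroupWithZero K, {x | valuation K x ≤ γ} := by
    ext x; simp only [Set.mem_univ, Set.mem_iUnion, true_iff]; exact ⟨valuation K x, le_refl (valuation K x)⟩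
  rw [h]
  exact isSigmaCompact_iUnion_of_isCompact _ fun γ =>
    IsNonarchimedeanLocalField.isCompact_closedBall K γ

variable {K}

lemma eventually_valuation_lt {γ : ValueGroupWithZero K} (hγ : γ ≠ 0) (x : K) :
    ∀ᶠ y in 𝓝 x, valuation K (y - x) < γ :=
  (IsValuativeTopology.hasBasis_nhds' x).mem_of_mem hγ

lemma isOpen_valuation_le {γ : ValueGroupWithZero K} (hγ : γ ≠ 0) :
    IsOpen {x | valuation K x ≤ γ} := by
  refine isOpen_iff_mem_nhds.2 fun x hx => ?_
  filter_upwards [eventually_valuation_lt hγ x] with y hy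
  rw [← sub_add_cancel y x]
  exact (Valuation.map_add _ _ _).trans (max_le hy.le hx)

lemma isOpen_valuation_lt (γ : ValueGroupWithZero K) :
    IsOpen {x | valuation K x < γ} := by
  refine isOpen_iff_mem_nhds.2 fun x hx => ?_
  filter_upwards [eventually_valuation_lt (ne_zero_of_lt hx) x] with y hy
  rw [← sub_add_cancel y x]
  exact (Valuation.map_add _ _ _).trans_lt (max_lt hy hx)

lemma eventually_valuation_eq {x : K} (hx : x ≠ 0) :
    ∀ᶠ y in 𝓝 x, valuation K y = valuation K x := by
  filter_upwards [eventually_valuation_lt (γ := valuation K x) (by simpa using hx) x] with y hy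
  exact Valuation.map_eq_of_sub_lt _ hy

/-- Multiplication by z maps the ring of integers onto itself, and that ring has finite positive
measure. -/
lemma absK_of_valuation_eq_one {z : K} (hz : valuation K z = 1) : absK z = 1 := by
  borelize K
  let μ : Measure K := Measure.addHaar
  have h0 : z ≠ 0 := by rintro rfl; simp at hz
  set O : Set K := {x | valuation K x ≤ 1}
  have h1 := measure_mul_image μ z h0 O
  have h2 : (fun x => z * x) '' O = O := by
    ext x
    constructor
    · rintro ⟨y, hy, rfl⟩
      simpa [O, hz] using hy
    · intro hx
      refine ⟨z⁻¹ * x, ?_, mul_inv_cancel_left₀ h0 x⟩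
      simpa [O, hz] using hx
  have h3 : μ O ≠ ⊤ := (IsNonarchimedeanLocalField.isCompact_closedBall K 1).measure_ne_top
  have h4 : μ O ≠ 0 := ((isOpen_valuation_le one_ne_zero).measure_pos μ ⟨0, by simp⟩).ne'
  rw [h2] at h1
  have h5 : ENNReal.ofReal (absK z) = 1 := (ENNReal.mul_eq_right h4 h3).1 h1.symm
  rwa [ENNReal.ofReal_eq_one] at h5

/-- The ring of integers is mapped into the maximal ideal, whose measure is smaller because its
complement, the units, is open and nonempty. -/
lemma absK_lt_one_of_valuation_lt_one {z : K} (hz : valuation K z < 1) : absK z < 1 := by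
  borelize K
  let μ : Measure K := Measure.addHaar
  by_cases h0 : z = 0
  · rw [h0, absK_zero]; exact one_pos
  set O : Set K := {x | valuation K x ≤ 1}
  have h1 := measure_mul_image μ z h0 O
  set P : Set K := {x | valuation K x < 1}
  have h2 : (fun x => z * x) '' O ⊆ P := by
    rintro _ ⟨y, hy, rfl⟩
    change valuation K (z * y) < 1
    rw [map_mul]
    exact mul_lt_one_of_lt_of_le hz hy
  have h3 : μ O ≠ ⊤ := (IsNonarchimedeanLocalField.isCompact_closedBall K 1).measure_ne_top
  have h6 : μ P < μ O := by
    have hPO : P ⊆ O := fun x hx => (show valuation K x < 1 from hx).le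
    have h7 : O \ P = {x | valuation K x = 1} := by
      ext x
      simp only [O, P, Set.mem_sdiff, Set.mem_ofPred_eq, not_lt]
      exact ⟨fun h => le_antisymm h.1 h.2, fun h => ⟨h.le, h.ge⟩⟩
    have h8 : 0 < μ (O \ P) := by
      rw [h7]
      refine IsOpen.measure_pos μ (isOpen_iff_mem_nhds.2 fun x hx => ?_) ⟨1, by simp⟩
      have hx' : valuation K x = 1 := hx
      have hx0 : x ≠ 0 := by rintro rfl; simp at hx'
      filter_upwards [eventually_valuation_eq hx0] with y hy
      exact hy.trans hx
    have h9 := measure_sdiff_add_inter (μ := μ) O (isOpen_valuation_lt (K := K) 1).measurableSet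
    rw [Set.inter_eq_right.2 hPO] at h9
    rw [← h9, add_comm]
    exact ENNReal.lt_add_right (measure_ne_top_of_subset hPO h3) h8.ne'
  have h10 : ENNReal.ofReal (absK z) * μ O < 1 * μ O := by
    rw [← h1, one_mul]
    exact (measure_mono h2).trans_lt h6
  have h11 := lt_of_mul_lt_mul_right' h10
  rwa [ENNReal.ofReal_lt_one] at h11

lemma absK_le_one_iff {z : K} : absK z ≤ 1 ↔ valuation K z ≤ 1 := by
  constructor
  · intro h
    by_contra h1
    rw [not_le] at h1
    have h0 : z ≠ 0 := by rintro rfl; simp at h1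
    have h2 : absK z⁻¹ < 1 := absK_lt_one_of_valuation_lt_one (by
      rw [map_inv₀]; exact inv_lt_one_of_one_lt₀ h1)
    rw [absK_inv] at h2
    exact absurd h (not_le.2 ((inv_lt_one₀ (absK_pos h0)).1 h2))
  · intro h
    rcases h.lt_or_eq with h | h
    · exact (absK_lt_one_of_valuation_lt_one h).le
    · exact (absK_of_valuation_eq_one h).le

lemma absK_lt_one_iff {z : K} : absK z < 1 ↔ valuation K z < 1 := by
  constructor
  · intro h
    refine lt_of_le_of_ne (absK_le_one_iff.1 h.le) fun h1 => ?_
    exact h.ne (absK_of_valuation_eq_one h1)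
  · exact absK_lt_one_of_valuation_lt_one

-- A generator ϖ of the value group is a uniformizer: a valuation below 1 is a power of that of ϖ
-- with exponent at least 1.
variable (K) in
lemma isUniformizer_uniformizer : IsUniformizer (uniformizer K) := by
  refine Classical.epsilon_spec (p := fun p : Kˣ => IsUniformizer p) ?_
  obtain ⟨ϖ, h0, h1, h2⟩ := exists_valuation_eq_zpow K
  have hv0 : 0 < valuation K ϖ := by simpa [zero_lt_iff] using h0
  refine ⟨Units.mk0 ϖ h0, absK_lt_one_iff.2 h1, fun x hx => ?_⟩
  have key : valuation K ((x : K) * ϖ⁻¹) ≤ 1 := by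
    rw [absK_lt_one_iff] at hx
    obtain ⟨n, hn⟩ := h2 x x.ne_zero
    rw [map_mul, map_inv₀, hn]
    rw [hn] at hx
    have hn1 : 1 ≤ n := by
      by_contra h3
      have : n ≤ 0 := by omega
      exact absurd hx (not_lt.2 (one_le_zpow_of_nonpos₀ hv0 h1.le this))
    rw [← zpow_neg_one, ← zpow_add₀ hv0.ne']
    exact zpow_le_one₀ hv0 h1.le (by omega)
  rw [← absK_le_one_iff, absK_mul, absK_inv, ← div_eq_mul_inv, div_le_one (absK_pos h0)] at key
  exact key

end Nonarch
end LiftedZeta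

/-! ### Non-archimedean fields: local constancy and convergence. -/

namespace LiftedZeta

section Nonarch

open ValuativeRel Topology

variable {K : Type*} [Field K] [TopologicalSpace K] [ValuativeRel K] [IsNonarchimedeanLocalField K]

/-- A character of `K` is trivial near zero. -/
lemma eventually_addChar_eq_one (χ : AddChar K Circle) (hχ : Continuous χ) :
    ∀ᶠ x in 𝓝 (0 : K), χ x = 1 := by
  have h1 : ∀ᶠ x in 𝓝 (0 : K), ‖(χ x : ℂ) - 1‖ ≤ 1 / 2 := by
    have h2 : Continuous fun x => ‖(χ x : ℂ) - 1‖ := by fun_prop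
    have h3 := h2.continuousAt (x := (0 : K))
    refine (h3.eventually_lt_const (u := 1 / 2) (by simp)).mono fun x hx => hx.le
  obtain ⟨γ, hγ, hU⟩ := (IsValuativeTopology.hasBasis_nhds_zero' K).mem_iff.1 h1
  have hmem : ∀ᶠ x in 𝓝 (0 : K), valuation K x < γ :=
    (IsValuativeTopology.hasBasis_nhds_zero' K).mem_of_mem hγ
  refine hmem.mono fun x hx => Circle.coe_injective ?_
  rw [Circle.coe_one]
  refine eq_one_of_forall_pow_two_pow fun n => ?_
  -- Integers have valuation at most 1, so all multiples 2^n x stay in the ball and χ(x) satisfies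
  -- the no-small-subgroups criterion.
  have h3 : valuation K ((2 ^ n : ℕ) • x) < γ := by
    rw [nsmul_eq_mul, map_mul]
    have : valuation K ((2 ^ n : ℕ) : K) ≤ 1 :=
      (Valuation.mem_integer_iff _ _).1 (natCast_mem ((valuation K).integer) _)
    exact (mul_le_of_le_one_left' this).trans_lt hx
  have h4 : ‖(χ ((2 ^ n : ℕ) • x) : ℂ) - 1‖ ≤ 1 / 2 := hU h3
  rwa [AddChar.map_nsmul_eq_pow, Circle.coe_pow] at h4

/-- Near `1`, a quasi-character is trivial, and so is the absolute value. -/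
lemma eventually_quasiKernel_eq_one (ω : Kˣ →* ℂˣ) (hω : Continuous ω) :
    ∀ᶠ x in 𝓝 (1 : K), absK x = 1 ∧ ∀ s, quasiKernel ω s x = 1 := by
  have h1 : ∀ᶠ u in 𝓝 (1 : Kˣ), ‖(ω u : ℂ) - 1‖ ≤ 1 / 2 := by
    have h2 : Continuous fun u => ‖(ω u : ℂ) - 1‖ := by fun_prop
    have h3 := h2.continuousAt (x := (1 : Kˣ))
    refine (h3.eventually_lt_const (u := 1 / 2) (by simp)).mono fun x hx => hx.le
  rw [Units.isEmbedding_val₀.isInducing.nhds_eq_comap] at h1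
  obtain ⟨U, hU, hUω⟩ := h1
  obtain ⟨γ, hγ, hγU⟩ := (IsValuativeTopology.hasBasis_nhds' ((1 : Kˣ) : K)).mem_iff.1 hU
  rw [Units.val_one] at hγU
  have hmin : min γ 1 ≠ 0 := by
    rcases min_choice γ 1 with h | h <;> rw [h] <;> simp [hγ]
  refine (eventually_valuation_lt hmin (1 : K)).mono fun x hx => ?_
  -- With radius at most 1, the ball around 1 is stable under powers.
  have key : ∀ n : ℕ, valuation K (x ^ n - 1) < min γ 1 := by
    intro n
    induction n with
    | zero => simpa [zero_lt_iff] using hmin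
    | succ n ih =>
      have e : x ^ (n + 1) - 1 = (x ^ n - 1) * x + (x - 1) := by ring
      have h1 : valuation K x = 1 := by
        have := Valuation.map_one_add_of_lt (valuation K) (hx.trans_le (min_le_right _ _))
        simpa using this
      rw [e]
      refine (Valuation.map_add _ _ _).trans_lt (max_lt ?_ hx)
      rwa [map_mul, h1, mul_one]
  have hv : valuation K x = 1 := by
    have := Valuation.map_one_add_of_lt (valuation K) (hx.trans_le (min_le_right _ _))
    simpa using this
  have hx0 : x ≠ 0 := by rintro rfl; simp at hv
  have ha : absK x = 1 := absK_of_valuation_eq_one hv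
  refine ⟨ha, fun s => ?_⟩
  rw [quasiKernel_eq, ha, quasiKernel_apply_one ω hx0]
  simp only [Complex.ofReal_one, Complex.one_cpow, inv_one, mul_one, one_mul]
  refine eq_one_of_forall_pow_two_pow fun n => ?_
  have h4 : (Units.mk0 x hx0) ^ 2 ^ n ∈ Units.val ⁻¹' U := by
    refine hγU ?_
    have := (key (2 ^ n)).trans_le (min_le_left _ _)
    simpa using this
  simpa using hUω h4

/-- Multiplicativity transports triviality near 1 to local constancy near u, uniformly in s. -/
lemma eventually_quasiKernel_eq (ω : Kˣ →* ℂˣ) (hω : Continuous ω) {u : K} (hu : u ≠ 0) :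
    ∀ᶠ x in 𝓝 u, absK x = absK u ∧ ∀ s, quasiKernel ω s x = quasiKernel ω s u := by
  have h1 : Filter.Tendsto (fun x => u⁻¹ * x) (𝓝 u) (𝓝 1) := by
    have : ContinuousAt (fun x => u⁻¹ * x) u := by fun_prop
    rw [← inv_mul_cancel₀ hu]
    exact this
  filter_upwards [h1.eventually (eventually_quasiKernel_eq_one ω hω)] with x hx
  have e : x = u * (u⁻¹ * x) := (mul_inv_cancel_left₀ hu x).symm
  refine ⟨?_, fun s => ?_⟩
  · rw [e, absK_mul, hx.1, mul_one]
  · rw [e, quasiKernel_mul, hx.2, mul_one]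

variable [MeasurableSpace K] [BorelSpace K]

lemma measurable_quasiKernel (ω : Kˣ →* ℂˣ) (hω : Continuous ω) (s : ℂ) :
    Measurable (quasiKernel ω s) := by
  refine measurable_of_continuousOn_compl_singleton 0 fun u hu => ?_
  refine ContinuousAt.continuousWithinAt ?_
  refine (continuousAt_const (y := quasiKernel ω s u)).congr ?_
  filter_upwards [eventually_quasiKernel_eq ω hω hu] with x hx using (hx.2 s).symm

lemma measurable_absK : Measurable (absK : K → ℝ) := by
  refine measurable_of_continuousOn_compl_singleton 0 fun u hu => ?_
  refine ContinuousAt.continuousWithinAt ?_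
  refine (continuousAt_const (y := absK u)).congr ?_
  filter_upwards [eventually_quasiKernel_eq (1 : Kˣ →* ℂˣ) continuous_const hu] with x hx
    using hx.1.symm

variable (μ : Measure K) [μ.IsAddHaarMeasure]

-- For large Re s the kernel at ϖ has norm at most 1. An integral element is ϖ^m times a unit, so
-- the maximum over the compact set of units bounds the kernel on O.
omit [MeasurableSpace K] [BorelSpace K] in
lemma exists_quasiKernel_bound (ω : Kˣ →* ℂˣ) (hω : Continuous ω) :
    ∃ σ : ℝ, ∀ s : ℂ, σ < s.re → ∃ C : ℝ, ∀ u : K, valuation K u ≤ 1 → ‖quasiKernel ω s u‖ ≤ C := by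
  obtain ⟨ϖ, h0, h1, h2⟩ := exists_valuation_eq_zpow K
  have hq1 : absK ϖ < 1 := absK_lt_one_of_valuation_lt_one h1
  have hq0 := absK_pos h0
  have hlim : Filter.Tendsto (fun x : ℝ => absK ϖ ^ (x - 1) * ‖quasiKernel ω 1 ϖ‖) Filter.atTop
      (𝓝 0) := by
    have h3 := (tendsto_rpow_atTop_of_base_lt_one (absK ϖ) (by linarith) hq1).comp
      (Filter.tendsto_atTop_add_const_right Filter.atTop (-1 : ℝ) Filter.tendsto_id)
    simpa [Function.comp_def, sub_eq_add_neg] using h3.mul_const ‖quasiKernel ω 1 ϖ‖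
  obtain ⟨σ, hσ⟩ := Filter.eventually_atTop.1 (hlim.eventually_le_const one_pos)
  refine ⟨σ, fun s hs => ?_⟩
  have hϖ : ‖quasiKernel ω s ϖ‖ ≤ 1 := by
    rw [quasiKernel_eq, norm_mul, norm_absK_cpow_mul_inv h0]
    exact hσ _ hs.le
  have hU : IsCompact {x : K | valuation K x = 1} := by
    refine (IsNonarchimedeanLocalField.isCompact_closedBall K 1).of_isClosed_subset ?_
      fun x hx => le_of_eq hx
    have e : {x : K | valuation K x = 1} = {x | valuation K x ≤ 1} \ {x | valuation K x < 1} := by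
      ext x
      simp only [Set.mem_sdiff, Set.mem_ofPred_eq, not_lt]
      exact ⟨fun h => ⟨h.le, h.ge⟩, fun h => le_antisymm h.1 h.2⟩
    rw [e]
    exact (IsNonarchimedeanLocalField.isCompact_closedBall K 1).isClosed.sdiff
      (isOpen_valuation_lt 1)
  obtain ⟨C, hC⟩ := hU.exists_bound_of_continuousOn (f := quasiKernel ω s) fun u hu => by
    have hu0 : u ≠ 0 := by rintro rfl; simp at hu
    refine ContinuousAt.continuousWithinAt ?_
    refine (continuousAt_const (y := quasiKernel ω s u)).congr ?_
    filter_upwards [eventually_quasiKernel_eq ω hω hu0] with x hx using (hx.2 s).symm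
  refine ⟨max C 0, fun u hu => ?_⟩
  by_cases hu0 : u = 0
  · rw [hu0, quasiKernel_zero, norm_zero]; exact le_max_right _ _
  have hv0 : 0 < valuation K ϖ := by simpa [zero_lt_iff] using h0
  obtain ⟨n, hn⟩ := h2 u hu0
  have hn0 : 0 ≤ n := by
    by_contra h3
    have h4 : 1 < valuation K u := by
      rw [hn]; exact one_lt_zpow_of_neg₀ hv0 h1 (by omega)
    exact absurd hu (not_le.2 h4)
  obtain ⟨m, rfl⟩ := Int.eq_ofNat_of_zero_le hn0
  have e : u = ϖ ^ m * (u / ϖ ^ m) := by field_simp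
  have hw : valuation K (u / ϖ ^ m) = 1 := by
    rw [map_div₀, hn, map_pow, zpow_natCast, div_self (pow_ne_zero _ hv0.ne')]
  have hpow : ∀ m : ℕ, ‖quasiKernel ω s (ϖ ^ m)‖ ≤ 1 := by
    intro m
    induction m with
    | zero => simp [quasiKernel_one]
    | succ m ih =>
      rw [pow_succ, quasiKernel_mul, norm_mul]
      exact mul_le_one₀ ih (norm_nonneg _) hϖ
  rw [e, quasiKernel_mul, norm_mul]
  calc _ ≤ 1 * C := mul_le_mul (hpow m) (hC _ hw) (norm_nonneg _) zero_le_one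
    _ ≤ _ := by rw [one_mul]; exact le_max_left _ _

/-- Near 0 the kernel is bounded as above, elsewhere by compactness of the support. The abscissa σ
serves all φ at once, so φ and its dilate can be treated together. -/
lemma exists_integrable_mul_quasiKernel (ω : Kˣ →* ℂˣ) (hω : Continuous ω) :
    ∃ σ : ℝ, ∀ φ : K → ℂ, Continuous φ → HasCompactSupport φ → ∀ s : ℂ, σ < s.re →
      Integrable (fun u => φ u * quasiKernel ω s u) μ := by
  obtain ⟨σ, hσ⟩ := exists_quasiKernel_bound ω hω
  refine ⟨σ, fun φ hφ hc s hs => ?_⟩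
  obtain ⟨C, hC⟩ := hσ s hs
  have hS : IsCompact (tsupport φ \ {x | valuation K x < 1}) :=
    (show IsCompact (tsupport φ) from hc).diff (isOpen_valuation_lt 1)
  obtain ⟨D, hD⟩ := hS.exists_bound_of_continuousOn (f := quasiKernel ω s) fun u hu => by
    have hu0 : u ≠ 0 := by rintro rfl; exact hu.2 (by simp)
    refine ContinuousAt.continuousWithinAt ?_
    refine (continuousAt_const (y := quasiKernel ω s u)).congr ?_
    filter_upwards [eventually_quasiKernel_eq ω hω hu0] with x hx using (hx.2 s).symm
  have hφi : Integrable φ μ := hφ.integrable_of_hasCompactSupport hc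
  refine (hφi.norm.const_mul (max C D)).mono'
    (hφ.aestronglyMeasurable.mul (measurable_quasiKernel ω hω s).aestronglyMeasurable)
    (Filter.Eventually.of_forall fun u => ?_)
  rw [norm_mul, mul_comm]
  by_cases hu : u ∈ tsupport φ
  · refine mul_le_mul_of_nonneg_right ?_ (norm_nonneg _)
    by_cases hu1 : valuation K u < 1
    · exact (hC u hu1.le).trans (le_max_left _ _)
    · exact (hD u ⟨hu, hu1⟩).trans (le_max_right _ _)
  · rw [image_eq_zero_of_notMem_tsupport hu]; simp

/-- The zeta integral of a test function supported away from zero is entire. -/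
lemma exists_entire_of_eventually_eq_zero (ω : Kˣ →* ℂˣ) (hω : Continuous ω) {φ : K → ℂ}
    (hφ : Continuous φ) (hc : HasCompactSupport φ) (h0 : ∀ᶠ u in 𝓝 0, φ u = 0) :
    ∃ Z : ℂ → ℂ, Differentiable ℂ Z ∧ ∀ s, Z s = ∫ u, φ u * quasiKernel ω s u ∂μ := by
  classical
  have h0' : (0 : K) ∉ tsupport φ := notMem_tsupport_iff_eventuallyEq.2 h0
  have hS : CompactSpace (tsupport φ) := isCompact_iff_compactSpace.1 hc
  have hloc : IsLocallyConstant fun u : tsupport φ => absK (u : K) := by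
    rw [IsLocallyConstant.iff_eventually_eq]
    intro u
    have hu : (u : K) ≠ 0 := fun h => h0' (h ▸ u.2)
    exact (continuous_subtype_val.tendsto u).eventually
      ((eventually_quasiKernel_eq ω hω hu).mono fun x hx => hx.1)
  have hfin := hloc.range_finite
  set T := hfin.toFinset with hT
  have hf : Integrable (fun u => φ u * quasiKernel ω 1 u) μ := by
    refine Continuous.integrable_of_hasCompactSupport ?_ hc.mul_right
    rw [continuous_iff_continuousAt]
    intro u
    by_cases hu : u = 0
    · rw [hu]
      refine (continuousAt_const (y := (0 : ℂ))).congr ?_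
      filter_upwards [h0] with x hx
      rw [hx, zero_mul]
    · refine hφ.continuousAt.mul ?_
      refine (continuousAt_const (y := quasiKernel ω 1 u)).congr ?_
      filter_upwards [eventually_quasiKernel_eq ω hω hu] with x hx using (hx.2 1).symm
  have hTpos : ∀ r ∈ T, 0 < r := by
    intro r hr
    obtain ⟨u, rfl⟩ := hfin.mem_toFinset.1 hr
    exact absK_pos fun h => h0' (h ▸ u.2)
  -- |u| takes finitely many positive values on the support, so sorting by them gives a finite sum
  -- of exponentials in s.
  refine ⟨fun s => ∑ r ∈ T, ((r : ℂ) ^ s * (r : ℂ)⁻¹) *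
    ∫ u, Set.indicator {u | absK u = r} (fun u => φ u * quasiKernel ω 1 u) u ∂μ, ?_, fun s => ?_⟩
  · refine Differentiable.fun_sum fun r hr => ?_
    refine Differentiable.mul_const (Differentiable.mul_const ?_ _) _
    intro s
    exact differentiableAt_id.const_cpow (Or.inl (by exact_mod_cast (hTpos r hr).ne'))
  · simp_rw [← integral_const_mul]
    rw [← integral_finsetSum]
    · refine integral_congr_ae (Filter.Eventually.of_forall fun u => ?_)
      simp only
      by_cases hu : u ∈ tsupport φ
      · have hr : absK u ∈ T := hfin.mem_toFinset.2 ⟨⟨u, hu⟩, rfl⟩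
        rw [Finset.sum_eq_single_of_mem _ hr]
        · rw [Set.indicator_of_mem (by simp), quasiKernel_eq ω s]; ring
        · intro r _ hne
          rw [Set.indicator_of_notMem (by simpa using hne.symm), mul_zero]
      · have hφ0 := image_eq_zero_of_notMem_tsupport hu
        simp [Set.indicator_apply, hφ0]
    · intro r _
      exact (hf.indicator (measurable_absK (measurableSet_singleton r))).const_mul _

/-- Substituting u = yv yields ω(y)|y|^(s-1) from the kernel and |y| from the measure. -/
lemma zeta_sub_comp_inv_mul (ω : Kˣ →* ℂˣ) {φ : K → ℂ} {s : ℂ} {y : K} (hy : y ≠ 0)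
    (hint : Integrable (fun u => φ u * quasiKernel ω s u) μ)
    (hint' : Integrable (fun u => φ (y⁻¹ * u) * quasiKernel ω s u) μ) :
    ∫ u, (φ u - φ (y⁻¹ * u)) * quasiKernel ω s u ∂μ
      = (1 - (ω (Units.mk0 y hy) : ℂ) * (absK y : ℂ) ^ s) * ∫ u, φ u * quasiKernel ω s u ∂μ := by
  have h1 : ∀ u, φ (y⁻¹ * u) * quasiKernel ω s u
      = quasiKernel ω s y * (φ (y⁻¹ * u) * quasiKernel ω s (y⁻¹ * u)) := by
    intro u
    rw [mul_left_comm, ← quasiKernel_mul, mul_inv_cancel_left₀ hy]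
  simp_rw [sub_mul]
  rw [integral_sub hint hint']
  simp_rw [h1]
  rw [integral_const_mul, integral_comp_mul_left μ y⁻¹ (inv_ne_zero hy)
    (fun u => φ u * quasiKernel ω s u), absK_inv, quasiKernel, dif_pos hy]
  have : (absK y : ℂ) ≠ 0 := by exact_mod_cast (absK_pos hy).ne'
  push_cast
  field_simp

end Nonarch
end LiftedZeta

/-! ### Non-archimedean Tate theory. -/

namespace LiftedZeta

section Nonarch

open ValuativeRel Topology

variable {K : Type*} [Field K] [TopologicalSpace K] [ValuativeRel K] [IsNonarchimedeanLocalField K]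

omit [ValuativeRel K] [IsNonarchimedeanLocalField K] in
lemma IsSchwartzBruhat.isLocallyConstant (hR : ¬ IsRealLocalField K) (hC : ¬ IsComplexLocalField K)
    {g : K → ℂ} (hg : IsSchwartzBruhat g) : IsLocallyConstant g ∧ HasCompactSupport g := by
  rcases hg with ⟨e, φ, he, -⟩ | ⟨e, φ, he, -⟩ | h
  · exact absurd ⟨e, he⟩ hR
  · exact absurd ⟨e, he⟩ hC
  · exact h.2

lemma isLocallyConstant_addChar {χ : AddChar K Circle} (hχ : Continuous χ) :
    IsLocallyConstant fun u => (χ u : ℂ) := by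
  rw [IsLocallyConstant.iff_eventually_eq]
  intro u
  have h1 : Filter.Tendsto (fun x => x - u) (𝓝 u) (𝓝 0) := by
    have : ContinuousAt (fun x => x - u) u := by fun_prop
    rw [← sub_self u]
    exact this
  filter_upwards [h1.eventually (eventually_addChar_eq_one χ hχ)] with x hx
  rw [← sub_add_cancel x u, AddChar.map_add_eq_mul, hx, one_mul]

variable [MeasurableSpace K] [BorelSpace K] (μ : Measure K) [μ.IsAddHaarMeasure]

/-- The zeta integral of a locally constant function of compact support is entire up to a factor
`1 - ω(y) |y| ^ s`, for every `y`. -/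
lemma exists_continuation_mul (ω : Kˣ →* ℂˣ) (hω : Continuous ω) {φ : K → ℂ}
    (hφ : IsLocallyConstant φ) (hc : HasCompactSupport φ) {y : K} (hy : y ≠ 0) :
    ∃ (σ : ℝ) (Z : ℂ → ℂ), Differentiable ℂ Z ∧ ∀ s : ℂ, σ < s.re →
      Integrable (fun u => φ u * quasiKernel ω s u) μ ∧
      Z s = (1 - (ω (Units.mk0 y hy) : ℂ) * (absK y : ℂ) ^ s) *
        ∫ u, φ u * quasiKernel ω s u ∂μ := by
  obtain ⟨σ, hσ⟩ := exists_integrable_mul_quasiKernel μ ω hω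
  have hcy : HasCompactSupport fun u => φ (y⁻¹ * u) :=
    hc.comp_homeomorph (Homeomorph.mulLeft₀ y⁻¹ (inv_ne_zero hy))
  have hφy : Continuous fun u => φ (y⁻¹ * u) := hφ.continuous.comp (continuous_const_mul _)
  -- Both functions equal φ(0) near 0, so the possible singularity of the kernel is removed.
  have h0 : ∀ᶠ u in 𝓝 (0 : K), φ u - φ (y⁻¹ * u) = 0 := by
    have h1 := (IsLocallyConstant.iff_eventually_eq φ).1 hφ 0
    have h2 : Filter.Tendsto (fun u : K => y⁻¹ * u) (𝓝 0) (𝓝 0) := by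
      have : ContinuousAt (fun u : K => y⁻¹ * u) 0 := by fun_prop
      simpa [ContinuousAt] using this
    filter_upwards [h1, h2.eventually h1] with u hu hu'
    rw [hu, hu', sub_self]
  obtain ⟨Z, hZ, hZs⟩ := exists_entire_of_eventually_eq_zero μ ω hω (hφ.continuous.sub hφy)
    (hc.sub hcy) h0
  refine ⟨σ, Z, hZ, fun s hs => ⟨hσ φ hφ.continuous hc s hs, ?_⟩⟩
  rw [hZs, ← zeta_sub_comp_inv_mul μ ω hy (hσ φ hφ.continuous hc s hs) (hσ _ hφy hcy s hs)]
  rfl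

omit [MeasurableSpace K] [BorelSpace K] in
lemma localL_eq_nonarchL (hR : ¬ IsRealLocalField K) (hC : ¬ IsComplexLocalField K)
    (ω : Kˣ →* ℂˣ) (s : ℂ) : localL ω s = nonarchL ω s := by
  rw [localL, dif_neg hR, dif_neg hC]

omit [MeasurableSpace K] [BorelSpace K] in
lemma absK_uniformizer_ne_zero : ((absK (uniformizer K : K) : ℝ) : ℂ) ≠ 0 := by
  exact_mod_cast (absK_pos (uniformizer K).ne_zero).ne'

omit [MeasurableSpace K] [BorelSpace K] in
lemma isClopen_isCompact_absK_le_one :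
    IsClopen {x : K | absK x ≤ 1} ∧ IsCompact {x : K | absK x ≤ 1} := by
  have h : {x : K | absK x ≤ 1} = {x | valuation K x ≤ 1} := by ext x; exact absK_le_one_iff
  have h1 := IsNonarchimedeanLocalField.isCompact_closedBall K 1
  rw [h]
  exact ⟨⟨h1.isClosed, isOpen_valuation_le one_ne_zero⟩, h1⟩

omit [MeasurableSpace K] [BorelSpace K] in
lemma exists_compactOpen_quasiKernel_eq_one (ω : Kˣ →* ℂˣ) (hω : Continuous ω) :
    ∃ B : Set K, IsClopen B ∧ IsCompact B ∧ B.Nonempty ∧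
      ∀ u ∈ B, ∀ s, quasiKernel ω s u = 1 := by
  obtain ⟨γ, hγ, hU⟩ := (IsValuativeTopology.hasBasis_nhds' (1 : K)).mem_iff.1
    (eventually_quasiKernel_eq_one ω hω)
  obtain ⟨ϖ, h0, h1, -⟩ := exists_valuation_eq_zpow K
  have hv0 : valuation K ϖ ≠ 0 := by simpa using h0
  have hne : γ * valuation K ϖ ≠ 0 := mul_ne_zero hγ hv0
  -- A closed ball of slightly smaller radius is compact and open and lies inside the open ball of
  -- radius γ.
  have hlt : γ * valuation K ϖ < γ := mul_lt_of_lt_one_right (zero_lt_iff.2 hγ) h1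
  have e : {x : K | valuation K (x - 1) ≤ γ * valuation K ϖ}
      = (Homeomorph.subRight (1 : K)) ⁻¹' {x | valuation K x ≤ γ * valuation K ϖ} := rfl
  have hc := IsNonarchimedeanLocalField.isCompact_closedBall K (γ * valuation K ϖ)
  refine ⟨{x | valuation K (x - 1) ≤ γ * valuation K ϖ}, ?_, ?_, ⟨1, by simp⟩, fun u hu s => ?_⟩
  · rw [e]
    exact ⟨hc.isClosed.preimage (Homeomorph.continuous _),
      (isOpen_valuation_le hne).preimage (Homeomorph.continuous _)⟩
  · rw [e]
    exact (Homeomorph.isCompact_preimage _).2 hc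
  · exact (hU (show valuation K (u - 1) < γ from lt_of_le_of_lt hu hlt)).2 s

omit [MeasurableSpace K] [BorelSpace K] in
open scoped Classical in
lemma isSchwartzBruhat_indicator {B : Set K} (hB : IsClopen B) (hc : IsCompact B) (c : ℂ) :
    IsSchwartzBruhat fun u => if u ∈ B then c else 0 := by
  refine Or.inr (Or.inr ⟨⟨inferInstance, inferInstance⟩, ?_, ?_⟩)
  · rw [IsLocallyConstant.iff_eventually_eq]
    intro u
    by_cases hu : u ∈ B
    · filter_upwards [hB.isOpen.mem_nhds hu] with x hx
      simp [hx, hu]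
    · filter_upwards [hB.compl.isOpen.mem_nhds hu] with x hx
      have hx' : x ∉ B := hx
      simp [hx', hu]
  · exact HasCompactSupport.intro hc fun x hx => by simp [hx]

/-- Unramified: for the normalized indicator of O the factor 1 - ω(p)|p|^s replaces it by the
normalized indicator of the units, where the kernel is 1. Ramified: L = 1, and the indicator of a
small compact open set on which the kernel is 1 suffices. -/
lemma exists_zeta_eq_localL (hR : ¬ IsRealLocalField K) (hC : ¬ IsComplexLocalField K)
    (ω : Kˣ →* ℂˣ) (hω : Continuous ω) :
    ∃ g : K → ℂ, IsSchwartzBruhat g ∧ ∃ σ : ℝ, ∀ s : ℂ, σ < s.re →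
      (localL ω s)⁻¹ * ∫ u, g u * quasiKernel ω s u ∂μ = 1 := by
  classical
  have hint : ∀ B : Set K, IsOpen B → IsCompact B → B.Nonempty → μ.real B ≠ 0 := by
    intro B hB hc hne
    rw [Measure.real, ENNReal.toReal_ne_zero]
    exact ⟨(hB.measure_pos μ hne).ne', hc.measure_ne_top⟩
  by_cases hram : ∀ u : Kˣ, absK (u : K) = 1 → ω u = 1
  · obtain ⟨hclo, hcpt⟩ := isClopen_isCompact_absK_le_one (K := K)
    set p := uniformizer K
    set O : Set K := {x | absK x ≤ 1}
    set B : Set K := {x | absK x = 1} with hB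
    have hp := isUniformizer_uniformizer K
    have hBO : IsOpen B := by
      refine isOpen_iff_mem_nhds.2 fun u hu => ?_
      have hu' : absK u = 1 := hu
      have hu0 : u ≠ 0 := by rintro rfl; simp [absK_zero] at hu'
      filter_upwards [eventually_quasiKernel_eq ω hω hu0] with x hx
      exact hx.1.trans hu
    have hBc : IsCompact B := by
      have e : B = O \ {x | valuation K x < 1} := by
        ext x
        simp only [B, O, Set.mem_sdiff, Set.mem_ofPred_eq, ← absK_lt_one_iff, not_lt]
        exact ⟨fun h => ⟨h.le, h.ge⟩, fun h => le_antisymm h.1 h.2⟩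
      rw [e]
      exact hcpt.diff (isOpen_valuation_lt 1)
    have hμB := hint B hBO hBc ⟨1, absK_one⟩
    set c : ℂ := ((μ.real B : ℝ) : ℂ)⁻¹
    set g : K → ℂ := fun u => if u ∈ O then c else 0 with hg
    have hgSB := isSchwartzBruhat_indicator hclo hcpt c
    have hglc := hgSB.isLocallyConstant hR hC
    obtain ⟨σ, hσ⟩ := exists_integrable_mul_quasiKernel μ ω hω
    refine ⟨g, hgSB, σ, fun s hs => ?_⟩
    rw [localL_eq_nonarchL hR hC, nonarchL, if_pos hram, inv_inv]
    have hp0 : (p : K) ≠ 0 := p.ne_zero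
    have hcy : HasCompactSupport fun u => g ((p : K)⁻¹ * u) :=
      hglc.2.comp_homeomorph (Homeomorph.mulLeft₀ (p : K)⁻¹ (inv_ne_zero hp0))
    have hφy : Continuous fun u => g ((p : K)⁻¹ * u) :=
      hglc.1.continuous.comp (continuous_const_mul _)
    have key := zeta_sub_comp_inv_mul μ ω hp0 (hσ g hglc.1.continuous hglc.2 s hs)
      (hσ _ hφy hcy s hs)
    rw [Units.mk0_val] at key
    rw [← key]
    -- Maximality of |p| below 1 says that p⁻¹u is integral as soon as |u| < 1, so the difference
    -- lives on |u| = 1.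
    have e : ∀ u, (g u - g ((p : K)⁻¹ * u)) * quasiKernel ω s u = B.indicator (fun _ => c) u := by
      intro u
      by_cases hu0 : u = 0
      · have h0 : (0 : K) ∉ B := by simp [hB, absK_zero]
        rw [hu0, Set.indicator_of_notMem h0, quasiKernel_zero, mul_zero]
      have hpu : (p : K)⁻¹ * u ∈ O ↔ absK u ≤ absK (p : K) := by
        change absK ((p : K)⁻¹ * u) ≤ 1 ↔ _
        rw [absK_mul, absK_inv, inv_mul_le_iff₀ (absK_pos hp0), mul_one]
      rcases lt_trichotomy (absK u) 1 with h1 | h1 | h1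
      · have h2 : u ∈ O := h1.le
        have h3 : (p : K)⁻¹ * u ∈ O := hpu.2 (hp.2 (Units.mk0 u hu0) h1)
        have h4 : u ∉ B := h1.ne
        simp [hg, h2, h3, h4]
      · have h2 : u ∈ O := h1.le
        have h3 : (p : K)⁻¹ * u ∉ O := fun h => by
          have := (hpu.1 h).trans_lt hp.1
          exact this.ne h1
        have h4 : u ∈ B := h1
        have h5 : quasiKernel ω s u = 1 := by
          rw [quasiKernel, dif_pos hu0, hram _ h1, h1]; simp
        simp [hg, h2, h3, h4, h5]
      · have h2 : u ∉ O := not_le.2 h1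
        have h3 : (p : K)⁻¹ * u ∉ O := fun h => by
          have := (hpu.1 h).trans_lt hp.1
          exact absurd h1 this.not_gt
        have h4 : u ∉ B := h1.ne'
        simp [hg, h2, h3, h4]
    simp_rw [e]
    rw [integral_indicator hBO.measurableSet, setIntegral_const, Complex.real_smul]
    exact mul_inv_cancel₀ (by exact_mod_cast hμB)
  · obtain ⟨B, hB, hBc, hne, hB1⟩ := exists_compactOpen_quasiKernel_eq_one ω hω
    have hμB := hint B hB.isOpen hBc hne
    refine ⟨_, isSchwartzBruhat_indicator hB hBc ((μ.real B : ℝ) : ℂ)⁻¹, 0, fun s _ => ?_⟩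
    rw [localL_eq_nonarchL hR hC, nonarchL, if_neg hram, inv_one, one_mul]
    have e : ∀ u, (if u ∈ B then ((μ.real B : ℝ) : ℂ)⁻¹ else 0) * quasiKernel ω s u
        = B.indicator (fun _ => ((μ.real B : ℝ) : ℂ)⁻¹) u := by
      intro u
      by_cases hu : u ∈ B
      · simp [hu, hB1 u hu s]
      · simp [hu]
    simp_rw [e]
    rw [integral_indicator hB.isOpen.measurableSet, setIntegral_const, Complex.real_smul]
    exact mul_inv_cancel₀ (by exact_mod_cast hμB)

/-- In `exists_continuation_mul` a uniformizer makes the factor equal to 1/L if ω is unramified; a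
unit with ω(y) ≠ 1 makes it a nonzero constant if ω is ramified. -/
theorem tateContinuation_of_nonarch (hR : ¬ IsRealLocalField K) (hC : ¬ IsComplexLocalField K)
    (ω : Kˣ →* ℂˣ) (hω : Continuous ω) : TateContinuation μ ω where
  integrable g hg := by
    obtain ⟨h1, h2⟩ := hg.isLocallyConstant hR hC
    exact h1.continuous.integrable_of_hasCompactSupport h2
  inv_localL := by
    by_cases hram : ∀ u : Kˣ, absK (u : K) = 1 → ω u = 1
    · refine ⟨0, fun s => 1 - (ω (uniformizer K) : ℂ) * ((absK (uniformizer K : K) : ℝ) : ℂ) ^ s,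
        ?_, fun s _ => ?_⟩
      · refine (differentiable_const _).sub ((differentiable_const _).mul fun s => ?_)
        exact differentiableAt_id.const_cpow (Or.inl absK_uniformizer_ne_zero)
      · rw [localL_eq_nonarchL hR hC, nonarchL, if_pos hram, inv_inv]
    · refine ⟨0, fun _ => 1, differentiable_const _, fun s _ => ?_⟩
      rw [localL_eq_nonarchL hR hC, nonarchL, if_neg hram, inv_one]
  continuation g hg a χ hχ := by
    obtain ⟨h1, h2⟩ := hg.isLocallyConstant hR hC
    have hφ : IsLocallyConstant fun u => g (u - a) * (χ u : ℂ) :=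
      (h1.comp_continuous (continuous_sub_right a)).mul (isLocallyConstant_addChar hχ)
    have hc : HasCompactSupport fun u => g (u - a) * (χ u : ℂ) :=
      (h2.comp_homeomorph (Homeomorph.subRight a)).mul_right
    by_cases hram : ∀ u : Kˣ, absK (u : K) = 1 → ω u = 1
    · obtain ⟨σ, Z, hZ, hσ⟩ := exists_continuation_mul μ ω hω hφ hc (uniformizer K).ne_zero
      refine ⟨σ, Z, hZ, fun s hs => ⟨(hσ s hs).1, ?_⟩⟩
      rw [(hσ s hs).2, localL_eq_nonarchL hR hC, nonarchL, if_pos hram, inv_inv, Units.mk0_val]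
    · have hram' := hram
      push Not at hram'
      obtain ⟨y, hy, hy1⟩ := hram'
      obtain ⟨σ, Z, hZ, hσ⟩ := exists_continuation_mul μ ω hω hφ hc y.ne_zero
      have hne : (1 - (ω y : ℂ)) ≠ 0 := fun h => hy1 (by
        ext; rw [Units.val_one]; exact (sub_eq_zero.1 h).symm)
      refine ⟨σ, fun s => (1 - (ω y : ℂ))⁻¹ * Z s, hZ.const_mul _, fun s hs => ⟨(hσ s hs).1, ?_⟩⟩
      simp only
      rw [(hσ s hs).2, localL_eq_nonarchL hR hC, nonarchL, if_neg hram, Units.mk0_val, hy,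
        Complex.ofReal_one, Complex.one_cpow, mul_one, inv_mul_cancel_left₀ hne, inv_one, one_mul]
  exists_eq_one := exists_zeta_eq_localL μ hR hC ω hω

/-- Multiplication by ϖ maps K onto K but scales measure by |ϖ| < 1. -/
lemma measure_univ_eq_top_of_nonarch : μ Set.univ = ⊤ := by
  by_contra h
  obtain ⟨ϖ, h0, h1, -⟩ := exists_valuation_eq_zpow K
  have h2 := measure_mul_image μ ϖ h0 Set.univ
  have h3 : (fun x => ϖ * x) '' Set.univ = Set.univ := by
    rw [Set.image_univ, Set.range_eq_univ]
    exact fun x => ⟨ϖ⁻¹ * x, mul_inv_cancel_left₀ h0 x⟩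
  rw [h3] at h2
  have h4 := (ENNReal.mul_eq_right (isOpen_univ.measure_pos μ Set.univ_nonempty).ne' h).1 h2.symm
  rw [ENNReal.ofReal_eq_one] at h4
  exact (absK_lt_one_of_valuation_lt_one h1).ne h4

end Nonarch
end LiftedZeta

/-! ### Mellin transforms divided by a Gamma factor. -/

namespace LiftedZeta

section Mellin

open Set Filter Asymptotics Topology Complex

/-- `∏ i < k, (s + 2 i) / (2 π)`, which is `Γ_ℝ(s + 2 k) / Γ_ℝ(s)`. -/
noncomputable def gammaRatio (k : ℕ) (s : ℂ) : ℂ :=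
  ∏ i ∈ Finset.range k, ((s + 2 * i) / 2 / Real.pi)

lemma differentiable_gammaRatio (k : ℕ) : Differentiable ℂ (gammaRatio k) := by
  unfold gammaRatio
  refine Differentiable.fun_finsetProd fun i _ => ?_
  fun_prop

/-- Iterates Γ_ℝ(s + 2) = Γ_ℝ(s) s/(2π). The bound on Re s keeps s + 2k away from the poles of Γ_ℝ.
-/
lemma inv_Gammaℝ_mul_Gammaℝ_add (k : ℕ) (s : ℂ) (hs : -(2 * k : ℝ) < s.re) :
    (Gammaℝ s)⁻¹ * Gammaℝ (s + 2 * k) = gammaRatio k s := by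
  induction k generalizing s with
  | zero =>
    have h : Gammaℝ s ≠ 0 := Gammaℝ_ne_zero_of_re_pos (by simpa using hs)
    simp [gammaRatio, h]
  | succ k ih =>
    have e : gammaRatio (k + 1) s = gammaRatio k (s + 2) * (s / 2 / Real.pi) := by
      rw [gammaRatio, Finset.prod_range_succ', gammaRatio]
      congr 1
      · refine Finset.prod_congr rfl fun i _ => ?_
        push_cast; ring
      · simp
    have h1 : s + 2 * ((k + 1 : ℕ) : ℂ) = s + 2 + 2 * k := by push_cast; ring
    rw [e, h1]
    -- `Gammaℝ` takes the value 0 at its poles, so the left side is 0 here, in agreement with the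
    -- factor s on the right.
    by_cases h0 : s = 0
    · have : Gammaℝ 0 = 0 := Gammaℝ_eq_zero_iff.2 ⟨0, by simp⟩
      simp [h0, this]
    · rw [← ih (s + 2) (by push_cast at hs; simp only [add_re, re_ofNat]; linarith),
        Gammaℝ_add_two h0]
      have h2 : (Real.pi : ℂ) ≠ 0 := by exact_mod_cast Real.pi_ne_zero
      by_cases h3 : Gammaℝ s = 0
      · simp [h3]
      · field_simp

/-- The Gaussian `exp (-π x²)`. -/
noncomputable def gaussian (x : ℝ) : ℂ := (Real.exp (-Real.pi * x ^ 2) : ℂ)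

lemma continuous_gaussian : Continuous gaussian := by unfold gaussian; fun_prop

lemma mellin_gaussian {w : ℂ} (hw : 0 < w.re) : mellin gaussian w = Gammaℝ w / 2 := by
  have h1 := mellin_comp_rpow (fun t : ℝ => (Real.exp (-Real.pi * t) : ℂ)) w 2
  have h2 : (fun t : ℝ => (Real.exp (-Real.pi * t ^ (2 : ℝ)) : ℂ)) = gaussian := by
    funext t; simp [gaussian]
  rw [h2] at h1
  rw [h1]
  have h3 := integral_cpow_mul_exp_neg_mul_Ioi (a := w / 2) (r := Real.pi)
    (by simpa using hw) Real.pi_pos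
  have h4 : mellin (fun t : ℝ => (Real.exp (-Real.pi * t) : ℂ)) (w / 2)
      = (1 / (Real.pi : ℂ)) ^ (w / 2) * Gamma (w / 2) := by
    rw [← h3, mellin]
    refine setIntegral_congr_fun measurableSet_Ioi fun t _ => ?_
    simp
  rw [Complex.ofReal_ofNat, h4, Gammaℝ_def, one_div, inv_cpow _ _ (by
    rw [Complex.arg_ofReal_of_nonneg Real.pi_pos.le]; exact Real.pi_pos.ne), ← cpow_neg,
    Complex.real_smul]
  norm_num
  ring_nf

lemma isBigO_atTop_pow_mul_gaussian (j : ℕ) (N : ℝ) :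
    (fun x : ℝ => (x : ℂ) ^ j * gaussian x) =O[atTop] (fun x : ℝ => x ^ (-N)) := by
  have h1 := (rpow_mul_exp_neg_mul_sq_isLittleO_exp_neg Real.pi_pos (j : ℝ)).isBigO.trans
    (isLittleO_exp_neg_mul_rpow_atTop (a := 1 / 2) (by norm_num) (-N)).isBigO
  rw [← isBigO_norm_left]
  refine h1.norm_left.congr_left fun x => ?_
  simp only [gaussian, norm_mul, norm_pow, Complex.norm_real, Real.rpow_natCast]

/-- Subtraction from `Φ` of the first terms of its expansion
`Φ(x) ~ (∑ c_l x ^ (m + 2 l)) exp (-π x²)` at zero. -/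
noncomputable def mellinRemainder (Φ : ℝ → ℂ) (m : ℕ) (c : ℕ → ℂ) (k : ℕ) (x : ℝ) : ℂ :=
  Φ x - (∑ l ∈ Finset.range k, c l * (x : ℂ) ^ (m + 2 * l)) * gaussian x

/-- Continuous, rapidly decaying functions on `(0, ∞)` with an asymptotic expansion at zero in
which only the exponents `m, m + 2, m + 4, …` occur. -/
structure HasParityExpansion (Φ : ℝ → ℂ) (m : ℕ) (c : ℕ → ℂ) : Prop where
  continuousOn : ContinuousOn Φ (Ioi 0)
  decay : ∀ N : ℕ, Φ =O[atTop] fun x : ℝ => x ^ (-(N : ℝ))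
  expansion : ∀ k : ℕ, mellinRemainder Φ m c k =O[𝓝[>] 0] fun x : ℝ => x ^ (m + 2 * k)

variable {Φ : ℝ → ℂ} {m : ℕ} {c : ℕ → ℂ}

namespace HasParityExpansion

variable (h : HasParityExpansion Φ m c)
include h

lemma locallyIntegrableOn (k : ℕ) : LocallyIntegrableOn (mellinRemainder Φ m c k) (Ioi 0) := by
  refine ContinuousOn.locallyIntegrableOn ?_ measurableSet_Ioi
  refine h.continuousOn.sub (Continuous.continuousOn ?_)
  have := continuous_gaussian
  fun_prop

lemma remainder_isBigO_atTop (k N : ℕ) :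
    mellinRemainder Φ m c k =O[atTop] fun x : ℝ => x ^ (-(N : ℝ)) := by
  refine (h.decay N).sub ?_
  simp_rw [Finset.sum_mul, mul_assoc]
  exact IsBigO.fun_sum fun l _ => (isBigO_atTop_pow_mul_gaussian _ _).const_mul_left _

lemma remainder_isBigO_zero (k : ℕ) :
    mellinRemainder Φ m c k =O[𝓝[>] 0] fun x : ℝ => x ^ (-(-((m + 2 * k : ℕ) : ℝ))) := by
  simpa only [neg_neg, Real.rpow_natCast] using h.expansion k

lemma mellinConvergent (k : ℕ) {w : ℂ} (hw : -((m + 2 * k : ℕ) : ℝ) < w.re) :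
    MellinConvergent (mellinRemainder Φ m c k) w := by
  obtain ⟨N, hN⟩ := exists_nat_gt w.re
  exact mellinConvergent_of_isBigO_rpow (h.locallyIntegrableOn k) (h.remainder_isBigO_atTop k N) hN
    (h.remainder_isBigO_zero k) hw

lemma differentiableAt_mellin (k : ℕ) {w : ℂ} (hw : -((m + 2 * k : ℕ) : ℝ) < w.re) :
    DifferentiableAt ℂ (mellin (mellinRemainder Φ m c k)) w := by
  obtain ⟨N, hN⟩ := exists_nat_gt w.re
  exact mellin_differentiableAt_of_isBigO_rpow (h.locallyIntegrableOn k)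
    (h.remainder_isBigO_atTop k N) hN (h.remainder_isBigO_zero k) hw

end HasParityExpansion

lemma mellin_pow_mul_gaussian (j : ℕ) (a : ℂ) {w : ℂ} (hw : -(j : ℝ) < w.re) :
    mellin (fun x : ℝ => a * (x : ℂ) ^ j * gaussian x) w = a * Gammaℝ (w + j) / 2 := by
  have h1 := mellin_cpow_smul gaussian w (j : ℂ)
  simp only [cpow_natCast, smul_eq_mul] at h1
  rw [mellin_gaussian (by simp; linarith)] at h1
  have h2 := mellin_const_smul (fun x : ℝ => (x : ℂ) ^ j * gaussian x) w a
  simp only [smul_eq_mul] at h2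
  simp_rw [mul_assoc, h2, h1]
  ring

/-- The continuation of `mellin Φ w / Γ_ℝ(w + m)` to `re w > - (m + 2 k)`. -/
noncomputable def mellinQuotient (Φ : ℝ → ℂ) (m : ℕ) (c : ℕ → ℂ) (k : ℕ) (w : ℂ) : ℂ :=
  (∑ l ∈ Finset.range k, c l / 2 * gammaRatio l (w + m)) +
    (Gammaℝ (w + m))⁻¹ * mellin (mellinRemainder Φ m c k) w

namespace HasParityExpansion

variable (h : HasParityExpansion Φ m c)
include h

lemma differentiableAt_mellinQuotient (k : ℕ) {w : ℂ} (hw : -((m + 2 * k : ℕ) : ℝ) < w.re) :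
    DifferentiableAt ℂ (mellinQuotient Φ m c k) w := by
  refine DifferentiableAt.add ?_ (DifferentiableAt.mul ?_ (h.differentiableAt_mellin k hw))
  · refine DifferentiableAt.fun_sum fun l _ => DifferentiableAt.const_mul ?_ _
    exact ((differentiable_gammaRatio l).comp (differentiable_id.add_const _)) w
  · exact (differentiable_Gammaℝ_inv.comp (differentiable_id.add_const _)) w

/-- Successive remainders differ by c_k x^(m+2k) times the Gaussian, whose Mellin transform is c_k
Γ_ℝ(w + m + 2k)/2. Divided by Γ_ℝ(w + m) this is the new polynomial term, so the continuations
agree. -/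
lemma mellinQuotient_succ (k : ℕ) {w : ℂ} (hw : -((m + 2 * k : ℕ) : ℝ) < w.re) :
    mellinQuotient Φ m c (k + 1) w = mellinQuotient Φ m c k w := by
  have h1 := h.mellinConvergent k hw
  have hw' : -((m + 2 * (k + 1) : ℕ) : ℝ) < w.re := by push_cast at hw ⊢; linarith
  have h2 := h.mellinConvergent (k + 1) hw'
  have e : ∀ x, mellinRemainder Φ m c k x - mellinRemainder Φ m c (k + 1) x
      = c k * (x : ℂ) ^ (m + 2 * k) * gaussian x := by
    intro x
    simp only [mellinRemainder, Finset.sum_range_succ]; ring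
  have h3 := (hasMellin_sub h1 h2).2
  simp_rw [e] at h3
  rw [mellin_pow_mul_gaussian _ _ hw] at h3
  have h4 := inv_Gammaℝ_mul_Gammaℝ_add k (w + m) (by
    push_cast at hw; simp only [add_re, natCast_re]; linarith)
  have h5 : w + ((m + 2 * k : ℕ) : ℂ) = w + m + 2 * k := by push_cast; ring
  rw [h5] at h3
  have h6 : mellin (mellinRemainder Φ m c k) w
      = c k * Gammaℝ (w + m + 2 * k) / 2 + mellin (mellinRemainder Φ m c (k + 1)) w := by
    rw [h3]; ring
  rw [mellinQuotient, mellinQuotient, Finset.sum_range_succ, h6, ← h4]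
  ring

lemma mellinQuotient_eq {k k' : ℕ} (hk : k ≤ k') {w : ℂ} (hw : -((m + 2 * k : ℕ) : ℝ) < w.re) :
    mellinQuotient Φ m c k' w = mellinQuotient Φ m c k w := by
  induction k', hk using Nat.le_induction with
  | base => rfl
  | succ n hn ih =>
    rw [h.mellinQuotient_succ n, ih]
    refine lt_of_le_of_lt ?_ hw
    have : (k : ℝ) ≤ n := by exact_mod_cast hn
    push_cast; linarith

/-- The quotient of the Mellin transform by `Γ_ℝ(w + m)` is entire. -/
theorem exists_entire : ∃ Z : ℂ → ℂ, Differentiable ℂ Z ∧ ∀ w : ℂ, 0 < w.re →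
    MellinConvergent Φ w ∧ Z w = (Gammaℝ (w + m))⁻¹ * mellin Φ w := by
  have hR : mellinRemainder Φ m c 0 = Φ := by funext x; simp [mellinRemainder]
  have hk : ∀ w : ℂ, ∀ k : ℕ, |w.re| < k → -((m + 2 * k : ℕ) : ℝ) < w.re := by
    intro w k hk
    have := neg_abs_le w.re
    push_cast
    have h1 : (0 : ℝ) ≤ m := Nat.cast_nonneg _
    have h2 : (0 : ℝ) ≤ k := Nat.cast_nonneg _
    linarith
  -- The order of expansion is chosen from |Re w|; near w the function agrees with the quotient of
  -- the fixed order K(w), which gives differentiability.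
  let K : ℂ → ℕ := fun w => ⌊|w.re|⌋₊ + 1
  have hK : ∀ w, |w.re| < K w := fun w => by
    simpa [K] using Nat.lt_floor_add_one |w.re|
  refine ⟨fun w => mellinQuotient Φ m c (K w) w, fun w => ?_, fun w hw => ⟨?_, ?_⟩⟩
  · have h1 := h.differentiableAt_mellinQuotient _ (hk w _ (hK w))
    refine h1.congr_of_eventuallyEq ?_
    have h2 : ∀ᶠ z : ℂ in 𝓝 w, |z.re| < K w :=
      (continuous_re.abs.continuousAt (x := w)).eventually_lt_const (hK w)
    filter_upwards [h2] with z hz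
    rcases le_total (K z) (K w) with h3 | h3
    · exact (h.mellinQuotient_eq h3 (hk z _ (hK z))).symm
    · exact h.mellinQuotient_eq h3 (hk z _ hz)
  · have h1 := h.mellinConvergent 0 (w := w) (lt_of_le_of_lt (by simp) hw)
    rwa [hR] at h1
  · simp only
    rw [h.mellinQuotient_eq (Nat.zero_le _) (lt_of_le_of_lt (by simp) hw), mellinQuotient, hR]
    simp

end HasParityExpansion

end Mellin

/-! ### Continuous homomorphisms from ℝ to ℂˣ. -/

section OneParameter

/-- A continuous homomorphism from `(ℝ, +)` to the multiplicative group of `ℂ` is exponential. -/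
lemma exists_eq_exp_of_continuous {f : ℝ → ℂ} (hf : Continuous f) (h0 : f 0 = 1)
    (hadd : ∀ x y, f (x + y) = f x * f y) : ∃ c : ℂ, ∀ x : ℝ, f x = Complex.exp (c * x) := by
  -- If all these integrals vanished, differentiating at 0 would give f(0) = 0.
  obtain ⟨a, ha⟩ : ∃ a : ℝ, (∫ t in (0 : ℝ)..a, f t) ≠ 0 := by
    by_contra hcon
    push Not at hcon
    have h1 : HasDerivAt (fun x => ∫ t in (0 : ℝ)..x, f t) (f 0) 0 :=
      intervalIntegral.integral_hasDerivAt_right (hf.intervalIntegrable _ _)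
        hf.aestronglyMeasurable.stronglyMeasurableAtFilter hf.continuousAt
    have h2 : (fun x => ∫ t in (0 : ℝ)..x, f t) = fun _ => 0 := funext hcon
    rw [h2] at h1
    have h3 := h1.unique (hasDerivAt_const _ _)
    rw [h0] at h3
    exact one_ne_zero h3
  set A := ∫ t in (0 : ℝ)..a, f t
  -- f is a multiple of an integral of itself over a moving interval, so continuity upgrades to
  -- differentiability.
  have key : ∀ x, f x = (∫ t in x..(x + a), f t) * A⁻¹ := by
    intro x
    rw [eq_mul_inv_iff_mul_eq₀ ha, ← intervalIntegral.integral_const_mul]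
    simp_rw [← hadd]
    rw [intervalIntegral.integral_comp_add_left (fun t => f t) x, add_zero]
  have hF : ∀ x, HasDerivAt (fun x => ∫ t in (0 : ℝ)..x, f t) (f x) x := fun x =>
    intervalIntegral.integral_hasDerivAt_right (hf.intervalIntegrable _ _)
      hf.aestronglyMeasurable.stronglyMeasurableAtFilter hf.continuousAt
  have hdiff : DifferentiableAt ℝ f 0 := by
    have e : f = fun x => ((∫ t in (0 : ℝ)..(x + a), f t) - ∫ t in (0 : ℝ)..x, f t) * A⁻¹ := by
      funext x
      rw [key x, intervalIntegral.integral_interval_sub_left (hf.intervalIntegrable _ _)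
        (hf.intervalIntegrable _ _)]
    rw [e]
    exact (((hF (0 + a)).comp_add_const 0 a).differentiableAt.sub
      (hF 0).differentiableAt).mul_const _
  set c := deriv f 0
  have hder : ∀ x, HasDerivAt f (f x * c) x := by
    intro x
    have h1 : HasDerivAt (fun y => f x * f (y - x)) (f x * c) x := by
      have h2 : HasDerivAt f c (x - x) := by rw [sub_self]; exact hdiff.hasDerivAt
      exact (h2.comp_sub_const x x).const_mul _
    refine h1.congr_of_eventuallyEq (Filter.Eventually.of_forall fun y => ?_)
    simp only
    rw [← hadd, add_sub_cancel]
  refine ⟨c, fun x => ?_⟩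
  have hg : ∀ x : ℝ, HasDerivAt (fun x : ℝ => f x * Complex.exp (-(c * x))) 0 x := by
    intro x
    have h1 : HasDerivAt (fun x : ℝ => Complex.exp (-(c * x))) (Complex.exp (-(c * x)) * -(c * 1)) x :=
      ((Complex.ofRealCLM.hasDerivAt (x := x)).const_mul c).neg.cexp
    refine ((hder x).mul h1).congr_deriv ?_
    ring
  have hconst := is_const_of_deriv_eq_zero (fun x => (hg x).differentiableAt)
    (fun x => (hg x).deriv) x 0
  simp only [h0, Complex.ofReal_zero, mul_zero, neg_zero, Complex.exp_zero, mul_one] at hconst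
  rw [Complex.exp_neg, mul_inv_eq_one₀ (Complex.exp_ne_zero _)] at hconst
  exact hconst

end OneParameter

end LiftedZeta

/-! ### Taylor expansion and weighted spherical means. -/

namespace LiftedZeta

section Taylor

open Set Filter Topology
open scoped ContDiff

variable {E : Type*} [NormedAddCommGroup E] [NormedSpace ℝ E]

/-- The Taylor polynomials at zero of a smooth function on a normed space, with remainder
estimate on the unit ball. -/
lemma exists_taylor [ProperSpace E] {f : E → ℂ} (hf : ContDiff ℝ ∞ f) :
    ∃ p : ∀ j : ℕ, ContinuousMultilinearMap ℝ (fun _ : Fin j => E) ℂ, ∀ k : ℕ, ∃ C : ℝ,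
      ∀ x, ‖x‖ ≤ 1 → ‖f x - ∑ j ∈ Finset.range k, p j (fun _ => x)‖ ≤ C * ‖x‖ ^ k := by
  refine ⟨fun j => ((j.factorial : ℝ)⁻¹) • iteratedFDeriv ℝ j f 0, fun k => ?_⟩
  have hcont : ∀ j : ℕ, Continuous (iteratedFDeriv ℝ j f) := fun j =>
    hf.continuous_iteratedFDeriv (by exact_mod_cast le_top)
  obtain ⟨C, hC⟩ := (isCompact_closedBall (0 : E) 1).exists_bound_of_continuousOn
    (hcont k).continuousOn
  -- Restriction to the ray t ↦ tx reduces the estimate to the one-variable Taylor theorem on [0,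
  -- 1].
  have hder : ∀ (j : ℕ) (x : E) (t : ℝ), iteratedDeriv j (fun t : ℝ => f (t • x)) t
      = iteratedFDeriv ℝ j f (t • x) fun _ => x := by
    intro j x t
    have h := ContinuousLinearMap.iteratedFDeriv_comp_right
      (ContinuousLinearMap.toSpanSingleton ℝ x) hf t (i := j) (by exact_mod_cast le_top)
    rw [iteratedDeriv_eq_iteratedFDeriv]
    have e : (fun t : ℝ => f (t • x)) = f ∘ (ContinuousLinearMap.toSpanSingleton ℝ x) := by
      funext t; simp
    rw [e, h]
    simp
  -- The Taylor bound with n terms beyond the constant has order n + 1, so order 0 is plain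
  -- boundedness on the unit ball.
  cases k with
  | zero =>
    refine ⟨C, fun x hx => ?_⟩
    have := hC x (by simpa using hx)
    simpa using this
  | succ n =>
    refine ⟨C / n.factorial, fun x hx => ?_⟩
    have hg : ContDiff ℝ ∞ (fun t : ℝ => f (t • x)) := by
      exact hf.comp (contDiff_id.smul contDiff_const)
    have hu : UniqueDiffOn ℝ (Icc (0 : ℝ) 1) := uniqueDiffOn_Icc zero_lt_one
    have hw : ∀ (j : ℕ), ∀ t ∈ Icc (0 : ℝ) 1, iteratedDerivWithin j (fun t : ℝ => f (t • x))
        (Icc 0 1) t = iteratedFDeriv ℝ j f (t • x) fun _ => x := by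
      intro j t ht
      rw [iteratedDerivWithin_eq_iteratedDeriv hu
        ((hg.of_le (by exact_mod_cast le_top)).contDiffAt) ht, hder]
    have h := taylor_mean_remainder_bound (f := fun t : ℝ => f (t • x)) (n := n) (x := 1)
      (C := C * ‖x‖ ^ (n + 1)) zero_le_one ((hg.of_le (by exact_mod_cast le_top)).contDiffOn)
      (by simp) (fun t ht => by
        rw [hw _ t ht]
        refine (ContinuousMultilinearMap.le_opNorm _ _).trans ?_
        rw [Finset.prod_const, Finset.card_univ, Fintype.card_fin]
        gcongr
        refine hC _ ?_
        rw [mem_closedBall_zero_iff, norm_smul, Real.norm_of_nonneg ht.1]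
        exact mul_le_one₀ ht.2 (norm_nonneg _) hx)
    rw [taylor_within_apply] at h
    simp only [one_smul, sub_zero, one_pow, mul_one] at h
    have e : ∑ j ∈ Finset.range (n + 1), ((j.factorial : ℝ)⁻¹ • iteratedFDeriv ℝ j f 0) (fun _ => x)
        = ∑ j ∈ Finset.range (n + 1), (j.factorial : ℝ)⁻¹ •
          iteratedDerivWithin j (fun t : ℝ => f (t • x)) (Icc 0 1) 0 := by
      refine Finset.sum_congr rfl fun j _ => ?_
      rw [hw j 0 (by simp), zero_smul]
      rfl
    rw [e]
    refine h.trans (le_of_eq ?_)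
    ring

end Taylor

section Sphere

open Set Filter Topology Asymptotics Metric
open scoped ContDiff Pointwise

variable {E : Type*} [NormedAddCommGroup E] [NormedSpace ℝ E] [FiniteDimensional ℝ E]
  [MeasurableSpace E] [BorelSpace E] (ν : Measure E) [ν.IsAddHaarMeasure]

/-- Integration in polar coordinates. -/
lemma integral_eq_integral_sphere [Nontrivial E] {f : E → ℂ} (hf : Integrable f ν) :
    ∫ x, f x ∂ν = ∫ r in Ioi (0 : ℝ), (r ^ (Module.finrank ℝ E - 1) : ℝ) •
      ∫ θ : sphere (0 : E) 1, f (r • (θ : E)) ∂ν.toSphere := by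
  have mp := ν.measurePreserving_homeomorphUnitSphereProd
  have me := (homeomorphUnitSphereProd E).measurableEmbedding
  set G : sphere (0 : E) 1 × Ioi (0 : ℝ) → ℂ := fun p => f ((p.2 : ℝ) • (p.1 : E))
  have hG : ∀ x : ({0}ᶜ : Set E), G (homeomorphUnitSphereProd E x) = f x := by
    intro x
    have : ‖(x : E)‖ ≠ 0 := norm_ne_zero_iff.2 x.2
    simp [G, smul_smul, this]
  have h1 : ∫ x, f x ∂ν = ∫ p, G p ∂ν.toSphere.prod (.volumeIoiPow (Module.finrank ℝ E - 1)) := by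
    rw [← mp.integral_comp me]
    simp_rw [hG]
    rw [integral_subtype_comap (measurableSet_singleton _).compl, restrict_compl_singleton]
  have h2 : Integrable G (ν.toSphere.prod (.volumeIoiPow (Module.finrank ℝ E - 1))) := by
    rw [← mp.integrable_comp_emb me]
    have : G ∘ homeomorphUnitSphereProd E = fun x : ({0}ᶜ : Set E) => f x := funext hG
    rw [this]
    have h3 := hf.integrableOn (s := ({0}ᶜ : Set E))
    rwa [integrableOn_iff_comap_subtypeVal (measurableSet_singleton _).compl] at h3
  rw [h1, integral_prod_symm _ h2, Measure.volumeIoiPow]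
  simp only [ENNReal.ofReal]
  rw [integral_withDensity_eq_integral_smul (by fun_prop),
    integral_subtype_comap measurableSet_Ioi (fun r : ℝ => Real.toNNReal
      (r ^ (Module.finrank ℝ E - 1)) • ∫ θ : sphere (0 : E) 1, f (r • (θ : E)) ∂ν.toSphere)]
  refine setIntegral_congr_fun measurableSet_Ioi fun r hr => ?_
  rw [NNReal.smul_def, Real.coe_toNNReal _ (pow_nonneg (le_of_lt hr) _)]

omit [FiniteDimensional ℝ E] [ν.IsAddHaarMeasure] in
/-- The measure on the sphere is invariant under linear isometries. -/
lemma integral_sphere_comp_isometry (T : E ≃ₗᵢ[ℝ] E) (hT : MeasurePreserving T ν ν) (h : E → ℂ) :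
    ∫ θ : sphere (0 : E) 1, h (T θ) ∂ν.toSphere = ∫ θ : sphere (0 : E) 1, h θ ∂ν.toSphere := by
  let T' : sphere (0 : E) 1 ≃ₜ sphere (0 : E) 1 :=
    { toFun := fun θ => ⟨T θ, by simp⟩
      invFun := fun θ => ⟨T.symm θ, by simp⟩
      left_inv := fun θ => by simp
      right_inv := fun θ => by simp
      continuous_toFun := by fun_prop
      continuous_invFun := by fun_prop }
  have hT' : ∀ θ, (T' θ : E) = T θ := fun _ => rfl
  have mp : MeasurePreserving T' ν.toSphere ν.toSphere := by
    refine ⟨T'.measurable, ?_⟩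
    ext s hs
    rw [Measure.map_apply T'.measurable hs, ν.toSphere_apply' hs,
      ν.toSphere_apply' (T'.measurable hs)]
    congr 1
    -- The sphere measure of a set is defined through the cone over it, and linear isometries carry
    -- cones to cones.
    have e : Ioo (0 : ℝ) 1 • (Subtype.val '' (T' ⁻¹' s)) = T ⁻¹' (Ioo (0 : ℝ) 1 • (Subtype.val '' s)) := by
      ext x
      simp only [Set.mem_smul, mem_preimage, mem_image]
      constructor
      · rintro ⟨r, hr, _, ⟨θ, hθ, rfl⟩, rfl⟩
        exact ⟨r, hr, _, ⟨T' θ, hθ, rfl⟩, by rw [hT', map_smul]⟩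
      · rintro ⟨r, hr, _, ⟨θ, hθ, rfl⟩, h1⟩
        refine ⟨r, hr, _, ⟨T'.symm θ, by simpa using hθ, rfl⟩, T.injective ?_⟩
        rw [map_smul, ← hT', T'.apply_symm_apply, h1]
    rw [e, hT.measure_preimage_emb T.toHomeomorph.measurableEmbedding]
  exact mp.integral_comp T'.measurableEmbedding fun θ => h θ


variable {w : sphere (0 : E) 1 → ℂ} (hw : Continuous w)
include hw

/-- The weighted spherical means of a smooth rapidly decaying function have an expansion at zero
in powers `m, m + 2, …` if the weight annihilates the other homogeneous polynomials. -/
theorem hasParityExpansion_sphere {φ : E → ℂ} (hφ : ContDiff ℝ ∞ φ)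
    (hdec : ∀ N : ℕ, ∃ C : ℝ, ∀ x, ‖x‖ ^ N * ‖φ x‖ ≤ C)
    (hsq : ContDiff ℝ ∞ fun x : E => ‖x‖ ^ 2) {m : ℕ}
    (hm : ∀ (j : ℕ) (p : ContinuousMultilinearMap ℝ (fun _ : Fin j => E) ℂ),
      (¬ ∃ l, j = m + 2 * l) → ∫ θ : sphere (0 : E) 1, p (fun _ => (θ : E)) * w θ ∂ν.toSphere = 0) :
    ∃ c, HasParityExpansion
      (fun r : ℝ => ∫ θ : sphere (0 : E) 1, φ (r • (θ : E)) * w θ ∂ν.toSphere) m c := by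
  obtain ⟨W, hW⟩ := (isCompact_univ : IsCompact (univ : Set (sphere (0 : E) 1)))
    |>.exists_bound_of_continuousOn hw.continuousOn
  have hW' : ∀ θ, ‖w θ‖ ≤ W := fun θ => hW θ (mem_univ _)
  have hI : ∀ h : sphere (0 : E) 1 → ℂ, Continuous h → Integrable h ν.toSphere := by
    intro h hc
    exact hc.integrable_of_hasCompactSupport (HasCompactSupport.of_compactSpace _)
  -- The expansion to be proved has Gaussian factors, so the Taylor expansion is applied to φ
  -- divided by the Gaussian; smoothness of ‖x‖² makes the quotient smooth.
  set f : E → ℂ := fun x => φ x * (Real.exp (Real.pi * ‖x‖ ^ 2) : ℂ) with hfdef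
  have hf : ContDiff ℝ ∞ f := by
    refine hφ.mul ?_
    exact Complex.ofRealCLM.contDiff.comp (Real.contDiff_exp.comp (contDiff_const.mul hsq))
  obtain ⟨p, hp⟩ := exists_taylor hf
  set a : ℕ → ℂ := fun j => ∫ θ : sphere (0 : E) 1, p j (fun _ => (θ : E)) * w θ ∂ν.toSphere
  have hcp : ∀ j, Continuous fun x : E => p j (fun _ => x) := fun j =>
    (p j).cont.comp (continuous_pi fun _ => continuous_id)
  have hcφ := hφ.continuous
  refine ⟨fun l => a (m + 2 * l), ⟨?_, ?_, ?_⟩⟩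
  · refine Continuous.continuousOn ?_
    obtain ⟨C, hC⟩ := hdec 0
    refine continuous_of_dominated (bound := fun _ => C * W) ?_ ?_ ?_ ?_
    · intro r
      exact (Continuous.mul (by fun_prop) hw).aestronglyMeasurable
    · intro r
      refine Eventually.of_forall fun θ => ?_
      rw [norm_mul]
      have := hC (r • (θ : E))
      rw [pow_zero, one_mul] at this
      exact mul_le_mul this (hW' θ) (norm_nonneg _) ((norm_nonneg _).trans this)
    · exact integrable_const _
    · refine Eventually.of_forall fun θ => ?_
      fun_prop
  · intro N
    obtain ⟨C, hC⟩ := hdec N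
    refine IsBigO.of_bound (C * W * ν.toSphere.real univ) ?_
    filter_upwards [eventually_gt_atTop 0] with r hr
    rw [Real.rpow_neg hr.le, Real.rpow_natCast, norm_inv, norm_pow, Real.norm_of_nonneg hr.le]
    have : ∀ θ : sphere (0 : E) 1, ‖φ (r • (θ : E)) * w θ‖ ≤ C * W * (r ^ N)⁻¹ := by
      intro θ
      have h1 := hC (r • (θ : E))
      rw [norm_smul, norm_eq_of_mem_sphere, mul_one, Real.norm_of_nonneg hr.le] at h1
      have hrN : 0 < r ^ N := pow_pos hr N
      have hC0 : 0 ≤ C := le_trans (by positivity) h1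
      rw [norm_mul, mul_right_comm]
      refine mul_le_mul ?_ (hW' θ) (norm_nonneg _) (by positivity)
      rw [le_mul_inv_iff₀ hrN, mul_comm]
      exact h1
    refine (norm_integral_le_of_norm_le_const (Eventually.of_forall this)).trans (le_of_eq ?_)
    ring
  · intro k
    obtain ⟨C, hC⟩ := hp (m + 2 * k)
    refine IsBigO.of_bound (C * W * ν.toSphere.real univ) ?_
    filter_upwards [Ioo_mem_nhdsGT (zero_lt_one' ℝ)] with r hr
    have hr0 : 0 < r := hr.1
    have hhom : ∀ (j : ℕ) (x : E), p j (fun _ => r • x) = (r : ℂ) ^ j * p j (fun _ => x) := by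
      intro j x
      have := (p j).map_smul_univ (fun _ => r) (fun _ => x)
      simpa using this
    -- The full Taylor sum of order m + 2k loses all degrees not of the form m + 2l, because w
    -- annihilates them.
    have hsum : ∑ l ∈ Finset.range k, a (m + 2 * l) * (r : ℂ) ^ (m + 2 * l)
        = ∑ j ∈ Finset.range (m + 2 * k), a j * (r : ℂ) ^ j := by
      refine Finset.sum_of_injOn (fun l => m + 2 * l) ?_ ?_ ?_ ?_
      · intro x _ y _ hxy
        simp only at hxy
        omega
      · intro x hx
        simp only [Finset.coe_range, mem_Iio] at hx ⊢
        omega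
      · intro j hj hj'
        rw [show a j = 0 from hm j (p j) ?_, zero_mul]
        rintro ⟨l, rfl⟩
        refine hj' ⟨l, ?_, rfl⟩
        simp only [Finset.coe_range, mem_Iio, Finset.mem_range] at hj ⊢
        omega
      · intro l _; rfl
    have hfφ : ∀ θ : sphere (0 : E) 1, φ (r • (θ : E)) = gaussian r * f (r • (θ : E)) := by
      intro θ
      rw [hfdef, gaussian]
      simp only [norm_smul, norm_eq_of_mem_sphere, mul_one, Real.norm_of_nonneg hr0.le]
      rw [mul_left_comm, ← Complex.ofReal_mul, ← Real.exp_add]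
      simp
    have hrem : mellinRemainder (fun r : ℝ => ∫ θ : sphere (0 : E) 1, φ (r • (θ : E)) * w θ
        ∂ν.toSphere) m (fun l => a (m + 2 * l)) k r
        = gaussian r * ∫ θ : sphere (0 : E) 1, (f (r • (θ : E)) -
          ∑ j ∈ Finset.range (m + 2 * k), p j (fun _ => r • (θ : E))) * w θ ∂ν.toSphere := by
      rw [mellinRemainder, hsum]
      simp_rw [hfφ, mul_assoc]
      rw [integral_const_mul]
      simp_rw [sub_mul, Finset.sum_mul, hhom, mul_assoc]
      have hcf := hf.continuous
      have hc1 : Continuous fun θ : sphere (0 : E) 1 => f (r • (θ : E)) * w θ :=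
        Continuous.mul (by fun_prop) hw
      rw [integral_sub (hI _ hc1), integral_finsetSum]
      · simp_rw [integral_const_mul]
        rw [mul_sub, Finset.mul_sum]
        congr 1
        refine Finset.sum_congr rfl fun j _ => ?_
        ring
      · intro j _
        exact (hI _ (((hcp j).comp continuous_subtype_val).mul hw)).const_mul _
      · refine integrable_finsetSum _ fun j _ => ?_
        exact (hI _ (((hcp j).comp continuous_subtype_val).mul hw)).const_mul _
    rw [hrem, norm_mul, norm_pow, Real.norm_of_nonneg hr0.le]
    have hg1 : ‖gaussian r‖ ≤ 1 := by
      rw [gaussian, Complex.norm_real, Real.norm_of_nonneg (Real.exp_pos _).le, Real.exp_le_one_iff]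
      have := Real.pi_pos
      nlinarith [sq_nonneg r]
    have hb : ∀ θ : sphere (0 : E) 1, ‖(f (r • (θ : E)) -
        ∑ j ∈ Finset.range (m + 2 * k), p j (fun _ => r • (θ : E))) * w θ‖
        ≤ C * W * r ^ (m + 2 * k) := by
      intro θ
      have hn : ‖r • (θ : E)‖ = r := by
        rw [norm_smul, norm_eq_of_mem_sphere, mul_one, Real.norm_of_nonneg hr0.le]
      have h1 := hC (r • (θ : E)) (hn.trans_le hr.2.le)
      rw [hn] at h1
      rw [norm_mul, mul_right_comm]
      exact mul_le_mul h1 (hW' θ) (norm_nonneg _) ((norm_nonneg _).trans h1)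
    refine (mul_le_of_le_one_left (norm_nonneg _) hg1).trans ?_
    refine (norm_integral_le_of_norm_le_const (Eventually.of_forall hb)).trans (le_of_eq ?_)
    ring

end Sphere

end LiftedZeta

/-! ### Gaussians as Schwartz functions. -/

namespace LiftedZeta

section GaussianSchwartz

open scoped ContDiff

variable {E : Type*} [NormedAddCommGroup E] [InnerProductSpace ℝ E]

/-- Gaussians are Schwartz functions. -/
lemma exists_schwartzMap_gaussian {b : ℝ} (hb : 0 < b) :
    ∃ φ : SchwartzMap E ℂ, ∀ x, φ x = (Real.exp (-b * ‖x‖ ^ 2) : ℂ) := by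
  have htg : (fun x : E => -b * ‖x‖ ^ 2).HasTemperateGrowth :=
    (Function.HasTemperateGrowth.const (-b)).mul (Function.hasTemperateGrowth_norm_sq E)
  have hexp : ContDiff ℝ ∞ (fun x : E => Real.exp (-b * ‖x‖ ^ 2)) :=
    Real.contDiff_exp.comp htg.1
  have hsm : ContDiff ℝ ∞ (fun x : E => (Real.exp (-b * ‖x‖ ^ 2) : ℂ)) :=
    Complex.ofRealCLM.contDiff.comp hexp
  refine ⟨⟨fun x => (Real.exp (-b * ‖x‖ ^ 2) : ℂ), hsm, fun k n => ?_⟩, fun x => rfl⟩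
  obtain ⟨l, C, hC, hle⟩ := htg.norm_iteratedFDeriv_le_uniform n
  -- The summand 1 in C + 1 gives D ≥ 1, so D ≤ D^i for i ≥ 1, the form of bound required by the
  -- composition estimate.
  set D : E → ℝ := fun x => (C + 1) * (1 + ‖x‖) ^ l with hD
  have hD1 : ∀ x, 1 ≤ D x := fun x => by
    have : (1 : ℝ) ≤ (1 + ‖x‖) ^ l := one_le_pow₀ (by linarith [norm_nonneg x])
    simp only [hD]
    nlinarith
  have h1 : ∀ x, ‖iteratedFDeriv ℝ n (fun x : E => Real.exp (-b * ‖x‖ ^ 2)) x‖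
      ≤ n.factorial * Real.exp (-b * ‖x‖ ^ 2) * D x ^ n := by
    intro x
    refine norm_iteratedFDeriv_comp_le (N := ∞) Real.contDiff_exp htg.1
      (by exact_mod_cast le_top) x (fun i _ => ?_) (fun i hi hin => ?_)
    · rw [norm_iteratedFDeriv_eq_norm_iteratedDeriv, iteratedDeriv_eq_iterate, Real.iter_deriv_exp,
        Real.norm_of_nonneg (Real.exp_pos _).le]
    · refine (hle i hin x).trans (le_trans ?_ (le_self_pow₀ (hD1 x) (by omega)))
      simp only [hD]
      gcongr
      linarith
  have h2 : ∀ x, ‖iteratedFDeriv ℝ n (fun x : E => (Real.exp (-b * ‖x‖ ^ 2) : ℂ)) x‖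
      ≤ n.factorial * Real.exp (-b * ‖x‖ ^ 2) * D x ^ n := by
    intro x
    refine le_trans (le_of_eq ?_) (h1 x)
    exact Complex.ofRealLI.norm_iteratedFDeriv_comp_left (hexp.contDiffAt) (by exact_mod_cast le_top)
  obtain ⟨M, hM⟩ : ∃ M : ℝ, ∀ t : ℝ, 0 ≤ t →
      (1 + t) ^ (k + l * n) * Real.exp (-b * t ^ 2) ≤ M := by
    -- The exponential series bounds the power by exp(2b(1 + t)), and b(t - 1)² ≥ 0 gives -bt² ≤
    -- -2b(1 + t) + 3b.
    refine ⟨(k + l * n).factorial / (2 * b) ^ (k + l * n) * Real.exp (3 * b), fun t ht => ?_⟩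
    have h3 := Real.pow_div_factorial_le_exp (2 * b * (1 + t)) (by positivity) (k + l * n)
    have h4 : Real.exp (-b * t ^ 2) ≤ Real.exp (-(2 * b * (1 + t))) * Real.exp (3 * b) := by
      rw [← Real.exp_add, Real.exp_le_exp]
      nlinarith [mul_nonneg hb.le (sq_nonneg (t - 1))]
    rw [div_le_iff₀ (by positivity), mul_pow] at h3
    calc (1 + t) ^ (k + l * n) * Real.exp (-b * t ^ 2)
        ≤ (Real.exp (2 * b * (1 + t)) * (k + l * n).factorial / (2 * b) ^ (k + l * n)) *
          (Real.exp (-(2 * b * (1 + t))) * Real.exp (3 * b)) := by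
          refine mul_le_mul ?_ h4 (Real.exp_pos _).le (by positivity)
          rw [le_div_iff₀ (by positivity), mul_comm]
          exact h3
      _ = _ := by
          rw [Real.exp_neg]
          field_simp
  refine ⟨n.factorial * (C + 1) ^ n * M, fun x => ?_⟩
  have h3 := hM ‖x‖ (norm_nonneg _)
  calc ‖x‖ ^ k * ‖iteratedFDeriv ℝ n (fun x : E => (Real.exp (-b * ‖x‖ ^ 2) : ℂ)) x‖
      ≤ (1 + ‖x‖) ^ k * (n.factorial * Real.exp (-b * ‖x‖ ^ 2) * D x ^ n) := by
        gcongr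
        · linarith
        · exact h2 x
    _ = n.factorial * (C + 1) ^ n * ((1 + ‖x‖) ^ (k + l * n) * Real.exp (-b * ‖x‖ ^ 2)) := by
        simp only [hD, mul_pow, pow_add, pow_mul]; ring
    _ ≤ _ := by gcongr

end GaussianSchwartz

end LiftedZeta

/-! ### Integrals against a homogeneous angular kernel. -/

namespace LiftedZeta

section Angular

open Set Filter Topology Metric
open scoped ContDiff

variable {E : Type*} [NormedAddCommGroup E] [InnerProductSpace ℝ E] [FiniteDimensional ℝ E]
  [MeasurableSpace E] [BorelSpace E] (ν : Measure E) [ν.IsAddHaarMeasure]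

/-- `W` is homogeneous of degree zero, its restriction to the sphere annihilates all homogeneous
polynomials of degrees other than `m, m + 2, …`, and `W P = ‖·‖ ^ m`. -/
structure IsAngular (W P : E → ℂ) (m : ℕ) : Prop where
  continuousOn : ContinuousOn W {0}ᶜ
  smul : ∀ r : ℝ, 0 < r → ∀ x, W (r • x) = W x
  integral_eq_zero : ∀ (j : ℕ) (p : ContinuousMultilinearMap ℝ (fun _ : Fin j => E) ℂ),
    (¬ ∃ l, j = m + 2 * l) → ∫ θ : sphere (0 : E) 1, p (fun _ => (θ : E)) * W θ ∂ν.toSphere = 0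
  temperate : P.HasTemperateGrowth
  mul_eq : ∀ x, x ≠ 0 → P x * W x = (‖x‖ : ℂ) ^ m

/-- The function `‖x‖ ^ (z - dim E) W(x)`. -/
noncomputable def angularKernel (W : E → ℂ) (z : ℂ) (x : E) : ℂ :=
  (‖x‖ : ℂ) ^ (z - Module.finrank ℝ E) * W x

variable {ν} {W P : E → ℂ} {m : ℕ} (hW : IsAngular ν W P m)
include hW

namespace IsAngular

omit [FiniteDimensional ℝ E] [BorelSpace E] [ν.IsAddHaarMeasure] in
lemma continuous_sphere : Continuous fun θ : sphere (0 : E) 1 => W θ :=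
  hW.continuousOn.comp_continuous continuous_subtype_val fun θ => by
    simpa using ne_zero_of_mem_unit_sphere θ

omit [BorelSpace E] [ν.IsAddHaarMeasure] in
lemma exists_bound : ∃ C, 0 ≤ C ∧ ∀ x, x ≠ 0 → ‖W x‖ ≤ C := by
  obtain ⟨C, hC⟩ := (isCompact_univ : IsCompact (univ : Set (sphere (0 : E) 1)))
    |>.exists_bound_of_continuousOn hW.continuous_sphere.continuousOn
  refine ⟨max C 0, le_max_right _ _, fun x hx => le_max_of_le_left ?_⟩
  have hx' : 0 < ‖x‖ := norm_pos_iff.2 hx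
  have h1 := hC ⟨‖x‖⁻¹ • x, by simp [norm_smul, hx'.ne']⟩ (mem_univ _)
  simpa only [hW.smul _ (inv_pos.2 hx')] using h1

lemma aestronglyMeasurable_kernel [Nontrivial E] (z : ℂ) :
    AEStronglyMeasurable (angularKernel W z) ν := by
  rw [← restrict_compl_singleton (μ := ν) 0]
  refine ContinuousOn.aestronglyMeasurable ?_ (measurableSet_singleton _).compl
  refine ContinuousOn.mul ?_ hW.continuousOn
  refine ContinuousOn.cpow_const (by fun_prop) fun x hx => ?_
  left
  simpa using hx

/-- For Re z ≥ dim E the radial factor is bounded near 0 and dominated by 1 + ‖x‖^N everywhere;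
Schwartz decay does the rest. -/
lemma integrable_mul_kernel [Nontrivial E] (g : SchwartzMap E ℂ) {χ : E → ℂ} (hχ : Continuous χ)
    (hχ1 : ∀ x, ‖χ x‖ ≤ 1) {z : ℂ} (hz : (Module.finrank ℝ E : ℝ) ≤ z.re) :
    Integrable (fun x => g x * χ x * angularKernel W z x) ν := by
  obtain ⟨C, hC0, hC⟩ := hW.exists_bound
  obtain ⟨N, hN⟩ := exists_nat_gt (z.re - Module.finrank ℝ E)
  have hi : Integrable (fun x => C * (‖x‖ ^ 0 * ‖g x‖ + ‖x‖ ^ N * ‖g x‖)) ν :=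
    ((g.integrable_pow_mul ν 0).add (g.integrable_pow_mul ν N)).const_mul C
  refine hi.mono' ((g.continuous.mul hχ).aestronglyMeasurable.mul
    (hW.aestronglyMeasurable_kernel z)) ?_
  have h0 : ∀ᵐ x ∂ν, x ≠ 0 := by simp [ae_iff]
  filter_upwards [h0] with x hx
  have hx' : 0 < ‖x‖ := norm_pos_iff.2 hx
  have hp : ‖x‖ ^ (z.re - Module.finrank ℝ E) ≤ 1 + ‖x‖ ^ N := by
    rcases le_total ‖x‖ 1 with h | h
    · have := Real.rpow_le_one hx'.le h (sub_nonneg.2 hz)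
      have h2 : 0 ≤ ‖x‖ ^ N := by positivity
      linarith
    · have := Real.rpow_le_rpow_of_exponent_le h hN.le
      rw [Real.rpow_natCast] at this
      linarith
  rw [angularKernel, norm_mul, norm_mul, norm_mul, Complex.norm_cpow_eq_rpow_re_of_pos hx']
  simp only [Complex.sub_re, Complex.natCast_re]
  calc ‖g x‖ * ‖χ x‖ * (‖x‖ ^ (z.re - Module.finrank ℝ E) * ‖W x‖)
      ≤ ‖g x‖ * 1 * ((1 + ‖x‖ ^ N) * C) := by
        gcongr
        · exact hχ1 x
        · exact hC x hx
    _ = _ := by ring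

/-- In polar coordinates r^(d-1) · r^(z-d) = r^(z-1), and W depends only on the direction. -/
lemma integral_mul_kernel [Nontrivial E] {h : E → ℂ} {z : ℂ}
    (hi : Integrable (fun x => h x * angularKernel W z x) ν) :
    ∫ x, h x * angularKernel W z x ∂ν
      = mellin (fun r : ℝ => ∫ θ : sphere (0 : E) 1, h (r • (θ : E)) * W θ ∂ν.toSphere) z := by
  rw [integral_eq_integral_sphere ν hi, mellin]
  refine setIntegral_congr_fun measurableSet_Ioi fun r hr => ?_
  have hr0 : 0 < r := hr
  have e : ∀ θ : sphere (0 : E) 1, h (r • (θ : E)) * angularKernel W z (r • (θ : E))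
      = (r : ℂ) ^ (z - Module.finrank ℝ E) * (h (r • (θ : E)) * W θ) := by
    intro θ
    rw [angularKernel, hW.smul r hr0, norm_smul, norm_eq_of_mem_sphere, mul_one,
      Real.norm_of_nonneg hr0.le]
    ring
  simp only [e]
  rw [integral_const_mul, Complex.real_smul, ← mul_assoc, smul_eq_mul]
  congr 1
  have hr1 : (r : ℂ) ≠ 0 := by exact_mod_cast hr0.ne'
  rw [Complex.ofReal_pow, ← Complex.cpow_natCast, ← Complex.cpow_add _ _ hr1]
  congr 1
  have : 1 ≤ Module.finrank ℝ E := Module.finrank_pos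
  push_cast [Nat.cast_sub this]
  ring

/-- The integral against the kernel, divided by `Γ_ℝ(z + m)`, continues to an entire function. -/
theorem exists_entire [Nontrivial E] (g : SchwartzMap E ℂ) {χ : E → ℂ} (hχ : ContDiff ℝ ∞ χ)
    (hχ1 : ∀ x, ‖χ x‖ ≤ 1) : ∃ Z : ℂ → ℂ, Differentiable ℂ Z ∧
      ∀ z : ℂ, (Module.finrank ℝ E : ℝ) ≤ z.re →
        Z z = (Complex.Gammaℝ (z + m))⁻¹ * ∫ x, g x * χ x * angularKernel W z x ∂ν := by
  obtain ⟨c, hc⟩ := hasParityExpansion_sphere ν hW.continuous_sphere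
    (φ := fun x => g x * χ x) ((g.smooth ⊤).mul hχ) (fun N => by
      obtain ⟨C, -, hC⟩ := g.decay N 0
      refine ⟨C, fun x => ?_⟩
      have h1 := hC x
      rw [norm_iteratedFDeriv_zero] at h1
      rw [norm_mul, ← mul_assoc]
      exact (mul_le_of_le_one_right (by positivity) (hχ1 x)).trans h1)
    (contDiff_norm_sq ℝ) hW.integral_eq_zero
  obtain ⟨Z, hZ, h⟩ := hc.exists_entire
  refine ⟨Z, hZ, fun z hz => ?_⟩
  have hd : (0 : ℝ) < Module.finrank ℝ E := by exact_mod_cast Module.finrank_pos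
  rw [(h z (hd.trans_le hz)).2,
    hW.integral_mul_kernel (hW.integrable_mul_kernel g hχ.continuous hχ1 hz)]

/-- A Gaussian times a polynomial has a pure Gamma factor as its integral. -/
theorem exists_integral_eq [Nontrivial E] (a : ℂ) {β : ℝ} (hβ : 0 < β) :
    ∃ g : SchwartzMap E ℂ, ∀ z : ℂ, (Module.finrank ℝ E : ℝ) ≤ z.re →
      ∫ x, g x * angularKernel W z x ∂ν
        = a * (β : ℂ) ^ (-(z + m)) * Complex.Gammaℝ (z + m) := by
  obtain ⟨G, hG⟩ := exists_schwartzMap_gaussian (E := E) (b := Real.pi * β ^ 2)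
    (mul_pos Real.pi_pos (pow_pos hβ 2))
  set v : ℝ := ν.toSphere.real univ
  have hv : (v : ℂ) ≠ 0 := by
    have : v ≠ 0 := by
      exact ENNReal.toReal_ne_zero.2 ⟨Measure.measure_univ_ne_zero.2 ν.toSphere_ne_zero,
        measure_ne_top _ _⟩
    exact_mod_cast this
  -- P W = ‖x‖^m makes the spherical integral equal to its total mass v times a radial function; the
  -- 2 cancels the half in the Mellin transform of the Gaussian, and dilation by β gives β^(-(z+m)).
  refine ⟨(2 * a / v) • SchwartzMap.smulLeftCLM ℂ P G, fun z hz => ?_⟩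
  have hg : ∀ x, ((2 * a / v) • SchwartzMap.smulLeftCLM ℂ P G) x
      = 2 * a / v * (P x * (Real.exp (-(Real.pi * β ^ 2) * ‖x‖ ^ 2) : ℂ)) := by
    intro x
    simp [SchwartzMap.smulLeftCLM_apply_apply hW.temperate, hG]
  have hi := hW.integrable_mul_kernel ((2 * a / v) • SchwartzMap.smulLeftCLM ℂ P G)
    (χ := fun _ => 1) continuous_const (fun x => by simp) hz
  simp only [mul_one] at hi
  rw [hW.integral_mul_kernel hi]
  have hd : (0 : ℝ) < Module.finrank ℝ E := by exact_mod_cast Module.finrank_pos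
  have e : mellin (fun r : ℝ => ∫ θ : sphere (0 : E) 1,
        ((2 * a / v) • SchwartzMap.smulLeftCLM ℂ P G) (r • (θ : E)) * W θ ∂ν.toSphere) z
      = mellin (fun r : ℝ => (2 * a) • ((r : ℂ) ^ (m : ℂ) • gaussian (β * r))) z := by
    refine setIntegral_congr_fun measurableSet_Ioi fun r hr => ?_
    have hr0 : 0 < r := hr
    have e1 : ∀ θ : sphere (0 : E) 1,
        ((2 * a / v) • SchwartzMap.smulLeftCLM ℂ P G) (r • (θ : E)) * W θ
        = 2 * a / v * ((r : ℂ) ^ m * gaussian (β * r)) := by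
      intro θ
      have h1 := hW.mul_eq (r • (θ : E))
        (smul_ne_zero hr0.ne' (ne_zero_of_mem_unit_sphere θ))
      rw [hW.smul r hr0] at h1
      rw [hg, mul_assoc, mul_right_comm, h1, norm_smul, norm_eq_of_mem_sphere, mul_one,
        Real.norm_of_nonneg hr0.le, gaussian]
      congr 4
      ring_nf
    simp only [e1]
    rw [integral_const, Complex.real_smul, Complex.cpow_natCast, show ν.toSphere.real univ = v from rfl]
    simp only [smul_eq_mul]
    field_simp
  rw [e, mellin_const_smul, mellin_cpow_smul, mellin_comp_mul_left _ _ hβ, mellin_gaussian]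
  · simp only [smul_eq_mul]
    ring
  · simp only [Complex.add_re, Complex.natCast_re]
    have : (0 : ℝ) ≤ m := Nat.cast_nonneg _
    linarith

end IsAngular

end Angular

end LiftedZeta

/-! ### Additive characters and transfer to an archimedean residue field. -/

namespace LiftedZeta

section AdditiveCharacter

open Set Filter Topology
open scoped ContDiff

variable {𝕜 : Type*} [RCLike 𝕜]

/-- Continuous additive characters of `ℝ` and `ℂ` are smooth. -/
lemma contDiff_addChar {χ : AddChar 𝕜 Circle} (hχ : Continuous χ) :
    ContDiff ℝ ∞ fun x => (χ x : ℂ) := by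
  -- On each real line the character is exponential; real and imaginary parts then make it a product
  -- of two such exponentials.
  have key : ∀ v : 𝕜, ∃ c : ℂ, ∀ t : ℝ, (χ ((t : 𝕜) * v) : ℂ) = Complex.exp (c * t) := by
    intro v
    refine exists_eq_exp_of_continuous (f := fun t : ℝ => (χ ((t : 𝕜) * v) : ℂ)) ?_ (by simp)
      fun x y => ?_
    · have : Continuous fun t : ℝ => (t : 𝕜) * v := RCLike.continuous_ofReal.mul continuous_const
      exact continuous_subtype_val.comp (hχ.comp this)
    · simp [add_mul, AddChar.map_add_eq_mul]
  obtain ⟨c₁, h₁⟩ := key 1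
  obtain ⟨c₂, h₂⟩ := key RCLike.I
  have e : (fun x : 𝕜 => (χ x : ℂ)) = fun x => Complex.exp (c₁ * (RCLike.re x : ℝ)) *
      Complex.exp (c₂ * (RCLike.im x : ℝ)) := by
    funext x
    rw [← h₁, ← h₂, mul_one, ← Circle.coe_mul, ← AddChar.map_add_eq_mul, RCLike.re_add_im]
  rw [e]
  refine ContDiff.mul ?_ ?_
  · exact (contDiff_const.mul (Complex.ofRealCLM.contDiff.comp
      (RCLike.reCLM (K := 𝕜)).contDiff)).cexp
  · exact (contDiff_const.mul (Complex.ofRealCLM.contDiff.comp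
      (RCLike.imCLM (K := 𝕜)).contDiff)).cexp

end AdditiveCharacter

section ArchimedeanTransfer

open Set Filter Topology

variable {𝕜 : Type*} [RCLike 𝕜] {K : Type*} [Field K] [TopologicalSpace K]
  [MeasurableSpace K] [BorelSpace K] {e : K ≃+* 𝕜} (he : IsHomeomorph e)
include he

lemma measurableEmbedding_of_isHomeomorph [MeasurableSpace 𝕜] [BorelSpace 𝕜] :
    MeasurableEmbedding e :=
  (he.homeomorph e).measurableEmbedding

variable [IsTopologicalRing K] (μ : Measure K) [μ.IsAddHaarMeasure]

lemma isAddHaarMeasure_map_ringEquiv [MeasurableSpace 𝕜] [BorelSpace 𝕜] :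
    (μ.map e).IsAddHaarMeasure :=
  e.toAddEquiv.isAddHaarMeasure_map μ he.continuous
    (e.toEquiv.continuous_symm_iff.2 he.isOpenMap)

variable [LocallyCompactSpace K]

lemma regular_of_isHomeomorph : μ.Regular := by
  have := (he.homeomorph e).secondCountableTopology
  have : T2Space K := (he.homeomorph e).symm.t2Space
  infer_instance

lemma measure_univ_eq_top_of_isHomeomorph : μ univ = ⊤ := by
  have : NoncompactSpace K := (he.homeomorph e).symm.isClosedEmbedding.noncompactSpace
  exact measure_univ_of_isAddLeftInvariant μ

variable [MeasurableSpace 𝕜] [BorelSpace 𝕜]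

-- Multiplication by x carries the unit ball to the ball of radius ‖e x‖, whose Haar measure scales
-- by the real dimension.
include μ in
lemma absK_eq_norm_pow (x : K) : absK x = ‖e x‖ ^ Module.finrank ℝ 𝕜 := by
  have hd : Module.finrank ℝ 𝕜 ≠ 0 := Module.finrank_pos.ne'
  rcases eq_or_ne x 0 with rfl | hx
  · simp [absK_zero, hd]
  have := isAddHaarMeasure_map_ringEquiv he μ
  have := regular_of_isHomeomorph he μ
  have hx' : e x ≠ 0 := by simpa using hx
  have h1 := measure_mul_image μ x hx (e ⁻¹' Metric.ball 0 1)
  have h2 : (fun y => x * y) '' (e ⁻¹' Metric.ball 0 1) = e ⁻¹' Metric.ball 0 ‖e x‖ := by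
    ext y
    simp only [mem_image, mem_preimage, mem_ball_zero_iff]
    constructor
    · rintro ⟨z, hz, rfl⟩
      rw [map_mul, norm_mul]
      exact mul_lt_of_lt_one_right (norm_pos_iff.2 hx') hz
    · intro hy
      refine ⟨x⁻¹ * y, ?_, mul_inv_cancel_left₀ hx y⟩
      rw [map_mul, map_inv₀, norm_mul, norm_inv]
      exact (inv_mul_lt_one₀ (norm_pos_iff.2 hx')).2 hy
  have hm : ∀ r, μ (e ⁻¹' Metric.ball 0 r) = μ.map e (Metric.ball 0 r) := fun r =>
    ((measurableEmbedding_of_isHomeomorph he).map_apply μ _).symm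
  rw [h2, hm, hm, Measure.addHaar_ball _ _ (norm_nonneg _)] at h1
  have h3 := (ENNReal.mul_left_inj (Metric.measure_ball_pos (μ.map e) 0 one_pos).ne'
    measure_ball_lt_top.ne).1 h1
  rw [ENNReal.ofReal_eq_ofReal_iff (by positivity) (absK_nonneg x)] at h3
  exact h3.symm

variable {ω : Kˣ →* ℂˣ} {c : ℂ} {W P : 𝕜 → ℂ} {m : ℕ}

include μ in
lemma quasiKernel_eq_angularKernel
    (hω : ∀ u : Kˣ, (ω u : ℂ) = (‖e u‖ : ℂ) ^ c * W (e u)) (s : ℂ) {u : K} (hu : u ≠ 0) :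
    quasiKernel ω s u = angularKernel W (Module.finrank ℝ 𝕜 * s + c) (e u) := by
  have hx : e u ≠ 0 := by simpa using hu
  have hn : (‖e u‖ : ℂ) ≠ 0 := by simpa using hx
  rw [quasiKernel, dif_pos hu, hω, Units.val_mk0, absK_eq_norm_pow he μ, angularKernel,
    add_sub_right_comm, Complex.cpow_add _ _ hn, Complex.cpow_sub _ _ hn, Complex.cpow_natCast]
  have h1 : ((‖e u‖ ^ Module.finrank ℝ 𝕜 : ℝ) : ℂ) ^ s
      = (‖e u‖ : ℂ) ^ (Module.finrank ℝ 𝕜 * s) := by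
    have hp : (‖e u‖ : ℂ) ^ Module.finrank ℝ 𝕜 ≠ 0 := pow_ne_zero _ hn
    rw [Complex.ofReal_pow, Complex.cpow_def_of_ne_zero hp, Complex.cpow_def_of_ne_zero hn,
      ← Complex.ofReal_pow, ← Complex.ofReal_log (by positivity), Real.log_pow,
      ← Complex.ofReal_log (norm_nonneg _)]
    push_cast
    ring_nf
  rw [h1, Complex.ofReal_pow]
  ring

/-- Tate's local theory for a quasi-character of `ℝˣ` or `ℂˣ`, from its angular component. -/
theorem tateContinuation_of_isAngular [(μ.map e).IsAddHaarMeasure]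
    (hω : ∀ u : Kˣ, (ω u : ℂ) = (‖e u‖ : ℂ) ^ c * W (e u)) (hW : IsAngular (μ.map e) W P m)
    {a : ℂ} (ha : a ≠ 0) {β : ℝ} (hβ : 0 < β)
    (hL : ∀ s, localL ω s = a * (β : ℂ) ^ (-(Module.finrank ℝ 𝕜 * s + c + m)) *
      Complex.Gammaℝ (Module.finrank ℝ 𝕜 * s + c + m))
    (hS : ∀ g : K → ℂ, IsSchwartzBruhat g ↔ ∃ φ : SchwartzMap 𝕜 ℂ, ∀ x, g x = φ (e x)) :
    TateContinuation μ ω := by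
  have hβ' : (β : ℂ) ≠ 0 := by exact_mod_cast hβ.ne'
  have hemb := measurableEmbedding_of_isHomeomorph he
  set d : ℕ := Module.finrank ℝ 𝕜 with hd
  have hd1 : (1 : ℝ) ≤ d := by exact_mod_cast (Module.finrank_pos : 0 < Module.finrank ℝ 𝕜)
  -- The two kernels are only compared off 0, which is a null set.
  have hae : ∀ᵐ x ∂μ, x ≠ 0 := by
    have h0 : ∀ᵐ x ∂(μ.map e), x ≠ 0 := by simp [ae_iff]
    filter_upwards [(hemb.ae_map_iff).1 h0] with x hx h
    exact hx (by simp [h])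
  -- As d ≥ 1 and Re s > 0, Re(ds + c) ≥ Re s + Re c > d, the range of absolute convergence.
  have hre : ∀ s : ℂ, |d - c.re| < s.re → (d : ℝ) ≤ (d * s + c : ℂ).re := by
    intro s hs
    have h1 := le_abs_self (d - c.re)
    have h2 : 0 < s.re := (abs_nonneg _).trans_lt hs
    simp only [Complex.add_re, Complex.mul_re, Complex.natCast_re, Complex.natCast_im, zero_mul,
      sub_zero]
    nlinarith
  have hLinv : ∀ s, (localL ω s)⁻¹ = a⁻¹ * (β : ℂ) ^ (d * s + c + m) *
      (Complex.Gammaℝ (d * s + c + m))⁻¹ := by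
    intro s
    rw [hL, mul_inv, mul_inv, Complex.cpow_neg, inv_inv]
  have hdiff : Differentiable ℂ fun s : ℂ => a⁻¹ * (β : ℂ) ^ (d * s + c + m) := by
    refine Differentiable.const_mul ?_ _
    exact Differentiable.const_cpow (by fun_prop) (Or.inl hβ')
  have hint : ∀ (h : 𝕜 → ℂ) (s : ℂ), (fun u => h (e u) * quasiKernel ω s u) =ᵐ[μ]
      fun u => (fun x => h x * angularKernel W (d * s + c) x) (e u) := by
    intro h s
    filter_upwards [hae] with u hu
    rw [quasiKernel_eq_angularKernel he μ hω s hu]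
  have hintegral : ∀ (h : 𝕜 → ℂ) (s : ℂ), ∫ u, h (e u) * quasiKernel ω s u ∂μ
      = ∫ x, h x * angularKernel W (d * s + c) x ∂(μ.map e) := by
    intro h s
    rw [integral_congr_ae (hint h s), hemb.integral_map]
  refine ⟨fun g hg => ?_, ⟨0, _, ?_, fun s _ => (hLinv s).symm⟩, fun g hg b χ hχ => ?_, ?_⟩
  · obtain ⟨φ, hφ⟩ := (hS g).1 hg
    have h1 := hemb.integrable_map_iff.1 (φ.integrable (μ := μ.map e))
    exact h1.congr (Eventually.of_forall fun x => (hφ x).symm)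
  · exact hdiff.mul (Complex.differentiable_Gammaℝ_inv.comp (by fun_prop))
  · obtain ⟨φ, hφ⟩ := (hS g).1 hg
    set χ' : AddChar 𝕜 Circle := χ.compAddMonoidHom (e.symm : 𝕜 →+ K)
    have hχ' : Continuous χ' := hχ.comp (e.toEquiv.continuous_symm_iff.2 he.isOpenMap)
    have hχ1 : ∀ x, ‖(χ' x : ℂ)‖ ≤ 1 := fun x => (Circle.norm_coe _).le
    obtain ⟨Z, hZ, h⟩ := hW.exists_entire (SchwartzMap.compSubConstCLM ℂ (e b) φ)
      (contDiff_addChar hχ') hχ1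
    set H : 𝕜 → ℂ := fun x => SchwartzMap.compSubConstCLM ℂ (e b) φ x * (χ' x : ℂ)
    have heq : ∀ u, g (u - b) * (χ u : ℂ) = H (e u) := by
      intro u
      simp [H, hφ, χ']
    refine ⟨|d - c.re|, fun s => a⁻¹ * (β : ℂ) ^ (d * s + c + m) * Z (d * s + c),
      hdiff.mul (hZ.comp (by fun_prop)), fun s hs => ⟨?_, ?_⟩⟩
    · simp_rw [heq]
      have h1 : Integrable (fun x => H x * angularKernel W (d * s + c) x) (μ.map e) :=
        hW.integrable_mul_kernel (SchwartzMap.compSubConstCLM ℂ (e b) φ)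
          (contDiff_addChar hχ').continuous hχ1 (hre s hs)
      exact (hemb.integrable_map_iff.1 h1).congr (hint H s).symm
    · simp_rw [heq]
      rw [hintegral H s, hLinv, h _ (hre s hs)]
      ring
  · obtain ⟨φ, hφ⟩ := hW.exists_integral_eq a hβ
    refine ⟨fun u => φ (e u), (hS _).2 ⟨φ, fun _ => rfl⟩, |d - c.re|, fun s hs => ?_⟩
    rw [hintegral, hφ _ (hre s hs), ← hL]
    refine inv_mul_cancel₀ ?_
    rw [hL]
    refine mul_ne_zero (mul_ne_zero ha ?_) (Complex.Gammaℝ_ne_zero_of_re_pos ?_)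
    · simp [Complex.cpow_eq_zero_iff, hβ']
    · have h1 := hre s hs
      have h2 : (0 : ℝ) ≤ m := Nat.cast_nonneg _
      rw [Complex.add_re, Complex.natCast_re]
      linarith

end ArchimedeanTransfer

end LiftedZeta

/-! ### Schwartz–Bruhat functions and positive quasi-characters for ℝ and ℂ. -/

namespace LiftedZeta

section RealComplex

open Set Filter Topology Metric

/-- Such a function is constant, and compact support in a noncompact space gives it a zero. This
disposes of the locally constant alternative in `IsSchwartzBruhat` for archimedean K. -/
lemma eq_zero_of_isLocallyConstant {K : Type*} [TopologicalSpace K] [PreconnectedSpace K]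
    [NoncompactSpace K] {g : K → ℂ} (hg : IsLocallyConstant g) (hc : HasCompactSupport g) :
    g = 0 := by
  obtain ⟨x, hx⟩ : ∃ x, g x = 0 := by
    by_contra h
    push Not at h
    have h1 : tsupport g = univ := by
      rw [tsupport, eq_univ_of_forall (s := Function.support g) h, closure_univ]
    exact noncompact_univ K (h1 ▸ hc)
  funext y
  rw [hg.apply_eq_of_preconnectedSpace y x, hx, Pi.zero_apply]

variable {K : Type*} [Field K] [TopologicalSpace K]

omit [TopologicalSpace K] in
lemma not_real_and_complex (e : K ≃+* ℝ) (e' : K ≃+* ℂ) : False := by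
  have h : (e (e'.symm Complex.I)) * (e (e'.symm Complex.I)) = -1 := by
    rw [← map_mul, ← map_mul, Complex.I_mul_I]
    simp
  nlinarith [mul_self_nonneg (e (e'.symm Complex.I))]

lemma isSchwartzBruhat_iff_real {e : K ≃+* ℝ} (he : IsHomeomorph e) (g : K → ℂ) :
    IsSchwartzBruhat g ↔ ∃ φ : SchwartzMap ℝ ℂ, ∀ x, g x = φ (e x) := by
  constructor
  · rintro (⟨e', φ, -, h⟩ | ⟨e', φ, -, -⟩ | ⟨-, h1, h2⟩)
    · refine ⟨φ, fun x => ?_⟩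
      -- ℝ has only one ring endomorphism, so the choice of isomorphism is irrelevant.
      have h1 : ((e.symm.trans e' : ℝ ≃+* ℝ) : ℝ →+* ℝ) = RingHom.id ℝ := Subsingleton.elim _ _
      have h2 := congrArg (fun f : ℝ →+* ℝ => f (e x)) h1
      simp only [RingHom.coe_coe, RingEquiv.coe_trans, Function.comp_apply,
        RingEquiv.symm_apply_apply, RingHom.id_apply] at h2
      rw [h, h2]
    · exact (not_real_and_complex e e').elim
    · have : NoncompactSpace K := (he.homeomorph e).symm.isClosedEmbedding.noncompactSpace
      have : PreconnectedSpace K :=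
        (he.homeomorph e).symm.surjective.denseRange.preconnectedSpace (he.homeomorph e).symm.continuous
      exact ⟨0, fun x => by rw [eq_zero_of_isLocallyConstant h1 h2]; rfl⟩
  · rintro ⟨φ, h⟩
    exact Or.inl ⟨e, φ, he, h⟩

lemma isSchwartzBruhat_iff_complex {e : K ≃+* ℂ} (he : IsHomeomorph e) (g : K → ℂ) :
    IsSchwartzBruhat g ↔ ∃ φ : SchwartzMap ℂ ℂ, ∀ x, g x = φ (e x) := by
  constructor
  · rintro (⟨e', φ, -, -⟩ | ⟨e', φ, he', h⟩ | ⟨-, h1, h2⟩)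
    · exact (not_real_and_complex e' e).elim
    · have hc : Continuous ((e.symm.trans e' : ℂ ≃+* ℂ) : ℂ →+* ℂ) :=
        he'.continuous.comp (e.toEquiv.continuous_symm_iff.2 he.isOpenMap)
      have key : ∀ x, e' x = ((e.symm.trans e' : ℂ ≃+* ℂ) : ℂ →+* ℂ) (e x) := fun x => by simp
      -- Two topological isomorphisms with ℂ differ at most by conjugation, which preserves Schwartz
      -- functions.
      rcases Complex.ringHom_eq_id_or_conj_of_continuous hc with h1 | h1
      · exact ⟨φ, fun x => by rw [h, key, h1, RingHom.id_apply]⟩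
      · refine ⟨SchwartzMap.compCLMOfContinuousLinearEquiv ℂ Complex.conjCLE φ, fun x => ?_⟩
        rw [h, key, h1]
        rfl
    · have : NoncompactSpace K := (he.homeomorph e).symm.isClosedEmbedding.noncompactSpace
      have : PreconnectedSpace K :=
        (he.homeomorph e).symm.surjective.denseRange.preconnectedSpace (he.homeomorph e).symm.continuous
      exact ⟨0, fun x => by rw [eq_zero_of_isLocallyConstant h1 h2]; rfl⟩
  · rintro ⟨φ, h⟩
    exact Or.inr (Or.inl ⟨e, φ, he, h⟩)

/-- A quasi-character of `ℝˣ` or `ℂˣ` is a complex power on the positive real numbers. -/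
lemma exists_cpow_of_pos {𝕜 : Type*} [RCLike 𝕜] {ω : 𝕜ˣ →* ℂˣ} (hω : Continuous ω) :
    ∃ c : ℂ, ∀ (u : 𝕜ˣ) (r : ℝ), 0 < r → (u : 𝕜) = (r : 𝕜) → (ω u : ℂ) = (r : ℂ) ^ c := by
  have hne : ∀ t : ℝ, ((Real.exp t : ℝ) : 𝕜) ≠ 0 := fun t => by simp
  let U : ℝ → 𝕜ˣ := fun t => Units.mk0 _ (hne t)
  have hU : Continuous U := by
    refine Units.continuous_iff.2 ⟨?_, ?_⟩
    · exact RCLike.continuous_ofReal.comp Real.continuous_exp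
    · have : Continuous fun t : ℝ => ((Real.exp t : ℝ) : 𝕜) :=
        RCLike.continuous_ofReal.comp Real.continuous_exp
      exact (this.inv₀ hne).congr fun t => by simp [U]
  obtain ⟨c, hc⟩ := exists_eq_exp_of_continuous (f := fun t => (ω (U t) : ℂ))
    (Units.continuous_val.comp (hω.comp hU))
    (by
      have : U 0 = 1 := Units.ext (by simp [U])
      simp [this])
    (fun x y => by
      have : U (x + y) = U x * U y := Units.ext (by simp [U, Real.exp_add])
      simp [this])
  refine ⟨c, fun u r hr hu => ?_⟩
  have h1 : u = U (Real.log r) := Units.ext (by simp [U, Real.exp_log hr, hu])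
  rw [h1, hc, Complex.cpow_def_of_ne_zero (by exact_mod_cast hr.ne'), Complex.ofReal_log hr.le,
    mul_comm]

end RealComplex

end LiftedZeta

/-! ### The real case. -/

namespace LiftedZeta

section Real

open Set Filter Topology Metric

/-- The sign of a real number, to the power `N`. -/
noncomputable def realAngular (N : ℕ) (x : ℝ) : ℂ := ((x / ‖x‖ : ℝ) : ℂ) ^ N

/-- Under x ↦ -x the integrand gets the sign (-1)^(j+N), so its integral vanishes for j + N odd.
With N ≤ 1, evenness means j = N + 2l. -/
lemma isAngular_real (ν : Measure ℝ) [ν.IsAddHaarMeasure] {N : ℕ} (hN : N ≤ 1) :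
    IsAngular ν (realAngular N) (fun x => (x : ℂ) ^ N) N where
  continuousOn := by
    unfold realAngular
    refine ContinuousOn.pow (Complex.continuous_ofReal.comp_continuousOn ?_) N
    exact continuousOn_id.div continuous_norm.continuousOn fun x hx => by simpa using hx
  smul r hr x := by
    rw [realAngular, realAngular, norm_smul, smul_eq_mul, Real.norm_of_nonneg hr.le,
      mul_div_mul_left _ _ hr.ne']
  integral_eq_zero j p h := by
    have hodd : Odd (j + N) := by
      rw [← Nat.not_even_iff_odd]
      rintro ⟨l, hl⟩
      exact h ⟨l - N, by omega⟩
    have h1 := integral_sphere_comp_isometry ν (LinearIsometryEquiv.neg ℝ)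
      (Measure.measurePreserving_neg ν) fun x => p (fun _ => x) * realAngular N x
    have h2 : ∀ x : ℝ, p (fun _ => -x) * realAngular N (-x)
        = -(p (fun _ => x) * realAngular N x) := by
      intro x
      have h3 := p.map_smul_univ (fun _ => -1) (fun _ => x)
      simp only [smul_eq_mul, neg_mul, one_mul, Finset.prod_const, Finset.card_univ,
        Fintype.card_fin] at h3
      have h4 : realAngular N (-x) = (-1) ^ N * realAngular N x := by
        rw [realAngular, realAngular, ← mul_pow, norm_neg]
        push_cast
        ring
      rw [h3, h4, Complex.real_smul]
      push_cast
      rw [mul_mul_mul_comm, ← pow_add, hodd.neg_one_pow, neg_one_mul]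
    simp only [LinearIsometryEquiv.coe_neg, h2, integral_neg] at h1
    exact self_eq_neg.1 h1.symm
  temperate := Function.HasTemperateGrowth.pow Function.Complex.hasTemperateGrowth_ofReal N
  mul_eq x hx := by
    have hx' : ‖x‖ ≠ 0 := norm_ne_zero_iff.2 hx
    rw [realAngular, ← mul_pow, ← Complex.ofReal_mul, mul_div_assoc', ← sq, ← sq_abs,
      ← Real.norm_eq_abs, sq, mul_div_cancel_right₀ _ hx']

/-- A quasi-character of `ℝˣ` is `sgn ^ N |·| ^ c`. -/
lemma real_quasicharacter {ω : ℝˣ →* ℂˣ} (hω : Continuous ω) :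
    ∃ N : ℕ, N ≤ 1 ∧ (N : ℂ) = (if ω (-1) = 1 then 0 else 1) ∧
      ∀ u : ℝˣ, (ω u : ℂ) = (‖(u : ℝ)‖ : ℂ) ^ realExponent ω * realAngular N u := by
  obtain ⟨c, hc⟩ := exists_cpow_of_pos hω
  have hspec : ∀ x : ℝˣ, 0 < (x : ℝ) → (ω x : ℂ) = ((x : ℝ) : ℂ) ^ realExponent ω :=
    Classical.epsilon_spec (p := fun c : ℂ => ∀ x : ℝˣ, 0 < (x : ℝ) →
      (ω x : ℂ) = ((x : ℝ) : ℂ) ^ c) ⟨c, fun x hx => hc x x hx rfl⟩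
  have hsq : (ω (-1) : ℂ) * ω (-1) = 1 := by
    rw [← Units.val_mul, ← map_mul]
    simp
  have key : ∀ N : ℕ, (ω (-1) : ℂ) = (-1) ^ N → ∀ u : ℝˣ,
      (ω u : ℂ) = (‖(u : ℝ)‖ : ℂ) ^ realExponent ω * realAngular N u := by
    intro N hN u
    rcases lt_or_gt_of_ne u.ne_zero with h | h
    · have h1 : u = -1 * -u := by simp
      have h2 : (0 : ℝ) < ((-u : ℝˣ) : ℝ) := by simpa using h
      rw [h1, map_mul, Units.val_mul, hN, hspec _ h2, mul_comm, ← h1, realAngular,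
        Real.norm_of_nonpos h.le, div_neg, div_self h.ne]
      simp
    · rw [hspec _ h, realAngular, Real.norm_of_nonneg h.le, div_self h.ne']
      simp
  by_cases h : ω (-1) = 1
  · exact ⟨0, zero_le_one, by simp [h], key 0 (by simp [h])⟩
  · refine ⟨1, le_rfl, by simp [h], key 1 ?_⟩
    rcases mul_self_eq_one_iff.1 hsq with h1 | h1
    · exact absurd (Units.ext h1) h
    · simpa using h1

variable {K : Type*} [Field K] [TopologicalSpace K] [IsTopologicalRing K] [LocallyCompactSpace K]
  [MeasurableSpace K] [BorelSpace K]

/-- Tate's local theory for quasi-characters of a real local field. -/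
theorem tateContinuation_of_real (μ : Measure K) [μ.IsAddHaarMeasure] (hR : IsRealLocalField K)
    (ω : Kˣ →* ℂˣ) (hω : Continuous ω) : TateContinuation μ ω := by
  set e : K ≃+* ℝ := hR.choose with he_def
  have he : IsHomeomorph e := hR.choose_spec
  have := isAddHaarMeasure_map_ringEquiv he μ
  set ω' : ℝˣ →* ℂˣ := ω.comp (Units.map (e.symm : ℝ →* K)) with hω'_def
  have hω' : Continuous ω' :=
    hω.comp (Continuous.units_map _ (e.toEquiv.continuous_symm_iff.2 he.isOpenMap))
  obtain ⟨N, hN, hN', h⟩ := real_quasicharacter hω'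
  refine tateContinuation_of_isAngular he μ (c := realExponent ω') (fun u => ?_)
    (isAngular_real (μ.map e) hN) one_ne_zero one_pos (fun s => ?_) (isSchwartzBruhat_iff_real he)
  · have h1 := h (Units.map (e : K →* ℝ) u)
    have h2 : ω' (Units.map (e : K →* ℝ) u) = ω u := by
      rw [hω'_def, MonoidHom.comp_apply]
      congr 1
      exact Units.ext (by simp)
    rw [h2] at h1
    simpa using h1
  · have h1 : localL ω s = realL ω' s := by rw [localL, dif_pos hR]
    rw [h1, realL, ← hN']
    simp

end Real

end LiftedZeta

/-! ### The complex case. -/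

namespace LiftedZeta

section Complex

open Set Filter Topology Metric
open scoped ComplexConjugate

/-- The angular character `(z / |z|) ^ n`. -/
noncomputable def complexAngular (n : ℤ) (z : ℂ) : ℂ := (z / (‖z‖ : ℂ)) ^ n

/-- A polynomial in `z` and its conjugate that inverts the angular character on the circle. -/
noncomputable def complexPolynomial (n : ℤ) (z : ℂ) : ℂ :=
  if 0 ≤ n then conj z ^ n.natAbs else z ^ n.natAbs

variable (ν : Measure ℂ) [ν.IsAddHaarMeasure]

lemma measurePreserving_rotation (ζ : Circle) : MeasurePreserving (rotation ζ) ν ν := by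
  refine ⟨(rotation ζ).continuous.measurable, ?_⟩
  have h := Measure.map_linearMap_addHaar_eq_smul_addHaar ν
    (f := ((rotation ζ).toLinearEquiv : ℂ →ₗ[ℝ] ℂ)) (by rw [det_rotation]; exact one_ne_zero)
  rw [det_rotation] at h
  simpa using h

/-- Rotation by the angle π/n preserves the measure and changes the sign of the integrand. -/
lemma integral_sphere_zpow {n : ℤ} (hn : n ≠ 0) :
    ∫ θ : sphere (0 : ℂ) 1, (θ : ℂ) ^ n ∂ν.toSphere = 0 := by
  have hn' : (n : ℂ) ≠ 0 := by exact_mod_cast hn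
  have hζ : ((Circle.exp (Real.pi / n) : Circle) : ℂ) ^ n = -1 := by
    rw [Circle.coe_exp, ← Complex.exp_int_mul, ← Complex.exp_pi_mul_I]
    congr 1
    push_cast
    field_simp
  have h := integral_sphere_comp_isometry ν (rotation (Circle.exp (Real.pi / n)))
    (measurePreserving_rotation ν _) fun x => x ^ n
  simp only [rotation_apply, mul_zpow, hζ, neg_one_mul, integral_neg] at h
  exact self_eq_neg.1 h.symm

lemma integrable_sphere {h : sphere (0 : ℂ) 1 → ℂ} (hh : Continuous h) :
    Integrable h ν.toSphere :=
  hh.integrable_of_hasCompactSupport (HasCompactSupport.of_compactSpace _)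

lemma continuous_sphere_zpow (n : ℤ) : Continuous fun θ : sphere (0 : ℂ) 1 => (θ : ℂ) ^ n :=
  continuous_subtype_val.zpow₀ n fun θ => Or.inl (ne_zero_of_mem_unit_sphere θ)

/-- A homogeneous polynomial of degree `j` on the circle only involves the characters of
index `-j, -j + 2, …, j`. -/
lemma integral_sphere_multilinear (j : ℕ)
    (p : ContinuousMultilinearMap ℝ (fun _ : Fin j => ℂ) ℂ) (n : ℤ)
    (hn : ¬ ∃ l, j = n.natAbs + 2 * l) :
    ∫ θ : sphere (0 : ℂ) 1, p (fun _ => (θ : ℂ)) * (θ : ℂ) ^ n ∂ν.toSphere = 0 := by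
  induction j generalizing n with
  | zero =>
    have hn0 : n ≠ 0 := by
      rintro rfl
      exact hn ⟨0, by simp⟩
    have : ∀ θ : ℂ, p (fun _ => θ) = p 0 := fun θ => congrArg p (Subsingleton.elim _ _)
    simp_rw [this]
    rw [integral_const_mul, integral_sphere_zpow ν hn0, mul_zero]
  | succ j ih =>
    -- One argument is written through z and its conjugate, with coefficients A and B of degree j.
    -- On the circle the conjugate is z⁻¹, so n is shifted by ±1 while the degree drops by one.
    set q₁ := p.curryLeft 1
    set q₂ := p.curryLeft Complex.I
    set A := (1 / 2 : ℂ) • (q₁ - Complex.I • q₂)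
    set B := (1 / 2 : ℂ) • (q₁ + Complex.I • q₂)
    have hp : ∀ z : ℂ, p (fun _ => z) = z * A (fun _ => z) + conj z * B (fun _ => z) := by
      intro z
      have h1 : p (fun _ => z) = p.curryLeft z (fun _ => z) := by
        rw [ContinuousMultilinearMap.curryLeft_apply]
        congr 1
        funext i
        refine Fin.cases ?_ (fun i => ?_) i <;> simp
      have h2 : p.curryLeft z = z.re • q₁ + z.im • q₂ := by
        rw [← map_smul, ← map_smul, ← map_add]
        congr 1
        simp [Complex.re_add_im]
      rw [h1, h2]
      simp only [A, B, _root_.add_apply, _root_.smul_apply,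
        _root_.sub_apply, Complex.real_smul, smul_eq_mul]
      rw [Complex.re_eq_add_conj, Complex.im_eq_sub_conj]
      field_simp
      ring_nf
      simp only [Complex.I_sq]
      ring
    have hc : ∀ q : ContinuousMultilinearMap ℝ (fun _ : Fin j => ℂ) ℂ, ∀ k : ℤ,
        Continuous fun θ : sphere (0 : ℂ) 1 => q (fun _ => (θ : ℂ)) * (θ : ℂ) ^ k := fun q k =>
      (q.cont.comp (continuous_pi fun _ => continuous_subtype_val)).mul (continuous_sphere_zpow k)
    have e : ∀ θ : sphere (0 : ℂ) 1, p (fun _ => (θ : ℂ)) * (θ : ℂ) ^ n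
        = A (fun _ => (θ : ℂ)) * (θ : ℂ) ^ (n + 1) + B (fun _ => (θ : ℂ)) * (θ : ℂ) ^ (n - 1) := by
      intro θ
      have h0 : (θ : ℂ) ≠ 0 := ne_zero_of_mem_unit_sphere θ
      have h1 : conj (θ : ℂ) = (θ : ℂ)⁻¹ := by
        rw [Complex.inv_def, Complex.normSq_eq_norm_sq, norm_eq_of_mem_sphere]
        simp
      rw [hp, h1, zpow_add_one₀ h0, zpow_sub_one₀ h0]
      ring
    simp_rw [e]
    rw [integral_add (integrable_sphere ν (hc A _)) (integrable_sphere ν (hc B _)),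
      ih A (n + 1), ih B (n - 1), add_zero]
    · rintro ⟨l, hl⟩
      rcases Nat.lt_or_ge (n - 1).natAbs n.natAbs with h | h
      · exact hn ⟨l, by omega⟩
      · exact hn ⟨l + 1, by omega⟩
    · rintro ⟨l, hl⟩
      rcases Nat.lt_or_ge (n + 1).natAbs n.natAbs with h | h
      · exact hn ⟨l, by omega⟩
      · exact hn ⟨l + 1, by omega⟩

lemma isAngular_complex (n : ℤ) :
    IsAngular ν (complexAngular n) (complexPolynomial n) n.natAbs where
  continuousOn := by
    unfold complexAngular
    refine ContinuousOn.zpow₀ ?_ n fun x hx => Or.inl ?_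
    · refine continuousOn_id.div (by fun_prop) fun x hx => by simpa using hx
    · have : x ≠ 0 := hx
      simpa using this
  smul r hr x := by
    have hr' : (r : ℂ) ≠ 0 := by exact_mod_cast hr.ne'
    rw [complexAngular, complexAngular, norm_smul, Complex.real_smul, Real.norm_of_nonneg hr.le,
      Complex.ofReal_mul, mul_div_mul_left _ _ hr']
  integral_eq_zero j p h := by
    have e : ∀ θ : sphere (0 : ℂ) 1, complexAngular n θ = (θ : ℂ) ^ n := fun θ => by
      rw [complexAngular, norm_eq_of_mem_sphere]; simp
    simp_rw [e]
    exact integral_sphere_multilinear ν j p n h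
  temperate := by
    unfold complexPolynomial
    split_ifs
    · exact Function.HasTemperateGrowth.pow Complex.conjCLE.hasTemperateGrowth _
    · exact Function.HasTemperateGrowth.pow Function.HasTemperateGrowth.id' _
  mul_eq z hz := by
    have hz' : (‖z‖ : ℂ) ≠ 0 := by simpa using hz
    have hzz : conj z * z = (‖z‖ : ℂ) ^ 2 := by
      rw [mul_comm, Complex.mul_conj, Complex.normSq_eq_norm_sq]; simp
    rw [complexPolynomial, complexAngular]
    split_ifs with h
    · obtain ⟨k, rfl⟩ := Int.eq_ofNat_of_zero_le h
      rw [Int.natAbs_natCast, zpow_natCast, ← mul_pow, mul_div_assoc', hzz, sq,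
        mul_div_cancel_right₀ _ hz']
    · obtain ⟨k, hk⟩ := Int.eq_ofNat_of_zero_le (a := -n) (by omega)
      obtain rfl : n = -(k : ℤ) := by omega
      rw [Int.natAbs_neg, Int.natAbs_natCast, zpow_neg, zpow_natCast, ← inv_pow, inv_div, ← mul_pow,
        mul_div_cancel₀ _ hz]

/-- A quasi-character of `ℂˣ` has an exponent. -/
lemma complex_quasicharacter {ω : ℂˣ →* ℂˣ} (hω : Continuous ω) (u : ℂˣ) :
    (ω u : ℂ) = (‖(u : ℂ)‖ : ℂ) ^ (2 * (complexExponent ω).1) *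
      complexAngular (complexExponent ω).2 u := by
  have hpow : ∀ (z : ℂˣ) (c : ℂ), ((‖(z : ℂ)‖ ^ 2 : ℝ) : ℂ) ^ c = (‖(z : ℂ)‖ : ℂ) ^ (2 * c) := by
    intro z c
    have hz : 0 < ‖(z : ℂ)‖ := norm_pos_iff.2 z.ne_zero
    have hn : (‖(z : ℂ)‖ : ℂ) ≠ 0 := by exact_mod_cast hz.ne'
    rw [Complex.cpow_def_of_ne_zero hn, Complex.cpow_def_of_ne_zero (by exact_mod_cast (pow_pos hz 2).ne'),
      ← Complex.ofReal_log (by positivity), Real.log_pow, ← Complex.ofReal_log hz.le]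
    push_cast
    ring_nf
  obtain ⟨c, hc⟩ := exists_cpow_of_pos hω
  obtain ⟨κ, hκ⟩ := exists_eq_exp_of_continuous
    (f := fun t : ℝ => (ω (Circle.toUnits (Circle.exp t)) : ℂ))
    (Units.continuous_val.comp (hω.comp (by
      refine Units.continuous_iff.2 ⟨?_, ?_⟩
      · exact continuous_subtype_val.comp Circle.exp.continuous
      · have : Continuous fun t : ℝ => (Circle.exp (-t) : ℂ) :=
          continuous_subtype_val.comp (Circle.exp.continuous.comp continuous_neg)
        refine this.congr fun t => ?_
        simp [Circle.exp_neg])))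
    (by simp) (fun x y => by simp [Circle.exp_add])
  -- Periodicity of the circle restricts the exponent to integral multiples of i.
  obtain ⟨n, hn⟩ : ∃ n : ℤ, κ = n * Complex.I := by
    have h1 := hκ (2 * Real.pi)
    rw [Circle.exp_two_pi, map_one, map_one, Units.val_one] at h1
    obtain ⟨n, hn⟩ := Complex.exp_eq_one_iff.1 h1.symm
    refine ⟨n, ?_⟩
    have h2 : (2 * Real.pi : ℂ) ≠ 0 := by
      simp
    push_cast at hn
    refine mul_right_cancel₀ h2 (hn.trans ?_)
    ring
  have hex : ∃ p : ℂ × ℤ, ∀ z : ℂˣ, (ω z : ℂ)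
      = ((‖(z : ℂ)‖ ^ 2 : ℝ) : ℂ) ^ p.1 * ((z : ℂ) / (‖(z : ℂ)‖ : ℂ)) ^ p.2 := by
    -- The exponent is halved because the normalized absolute value of ℂ is the square of the norm.
    refine ⟨(c / 2, n), fun z => ?_⟩
    have hz : 0 < ‖(z : ℂ)‖ := norm_pos_iff.2 z.ne_zero
    have hn0 : (‖(z : ℂ)‖ : ℂ) ≠ 0 := by exact_mod_cast hz.ne'
    have hdec := Complex.norm_mul_exp_arg_mul_I (z : ℂ)
    have h1 : z = Units.mk0 (‖(z : ℂ)‖ : ℂ) hn0 * Circle.toUnits (Circle.exp (Complex.arg z)) := by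
      refine Units.ext ?_
      rw [Units.val_mul, Units.val_mk0, Circle.toUnits_apply, Units.val_mk0, Circle.coe_exp, hdec]
    have h2 : (z : ℂ) / (‖(z : ℂ)‖ : ℂ) = Complex.exp (Complex.arg z * Complex.I) := by
      rw [div_eq_iff hn0, mul_comm, hdec]
    have h3 : (ω z : ℂ) = (‖(z : ℂ)‖ : ℂ) ^ c * Complex.exp (κ * Complex.arg z) := by
      rw [← hκ, ← hc (Units.mk0 (‖(z : ℂ)‖ : ℂ) hn0) _ hz rfl, ← Units.val_mul, ← map_mul, ← h1]
    rw [h3, hpow, h2, ← Complex.exp_int_mul, hn]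
    congr 2
    · ring
    · ring
  have hspec := Classical.epsilon_spec hex u
  rw [hpow] at hspec
  exact hspec

variable {K : Type*} [Field K] [TopologicalSpace K] [IsTopologicalRing K] [LocallyCompactSpace K]
  [MeasurableSpace K] [BorelSpace K]

/-- Both sides contain Γ(s), and √2^(-2s) supplies the missing 2^(-s). This gives the complex
L-factor the shape required by `tateContinuation_of_isAngular`, with a = 2 and β = √2. -/
lemma Gammaℂ_eq_mul_Gammaℝ (s : ℂ) :
    Complex.Gammaℂ s = 2 * ((√2 : ℝ) : ℂ) ^ (-(2 * s)) * Complex.Gammaℝ (2 * s) := by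
  have h2 : ((√2 : ℝ) : ℂ) ^ (-(2 * s)) = (2 : ℂ) ^ (-s) := by
    rw [show -(2 * s) = ((2 : ℕ) : ℂ) * -s by push_cast; ring, Complex.cpow_nat_mul',
      ← Complex.ofReal_pow, Real.sq_sqrt zero_le_two]
    · simp
    all_goals
      rw [Complex.arg_ofReal_of_nonneg (Real.sqrt_nonneg 2)]
      simp [Real.pi_pos, Real.pi_pos.le]
  have h3 := Complex.mul_cpow_ofReal_nonneg (a := 2) (b := Real.pi) zero_le_two Real.pi_pos.le (-s)
  rw [Complex.ofReal_ofNat] at h3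
  have h4 : -(2 * s) / 2 = -s := by ring
  rw [Complex.Gammaℂ_def, Complex.Gammaℝ_def, h2, h3, h4, mul_div_cancel_left₀ _ two_ne_zero]
  ring

/-- Tate's local theory for quasi-characters of a complex local field. -/
theorem tateContinuation_of_complex (μ : Measure K) [μ.IsAddHaarMeasure]
    (hC : IsComplexLocalField K) (ω : Kˣ →* ℂˣ) (hω : Continuous ω) : TateContinuation μ ω := by
  have hR : ¬ IsRealLocalField K := fun ⟨e, _⟩ => not_real_and_complex e hC.choose
  set e : K ≃+* ℂ := hC.choose with he_def
  have he : IsHomeomorph e := hC.choose_spec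
  have := isAddHaarMeasure_map_ringEquiv he μ
  set ω' : ℂˣ →* ℂˣ := ω.comp (Units.map (e.symm : ℂ →* K)) with hω'_def
  have hω' : Continuous ω' :=
    hω.comp (Continuous.units_map _ (e.toEquiv.continuous_symm_iff.2 he.isOpenMap))
  refine tateContinuation_of_isAngular he μ (c := 2 * (complexExponent ω').1) (fun u => ?_)
    (isAngular_complex (μ.map e) (complexExponent ω').2) two_ne_zero (β := √2) (by positivity)
    (fun s => ?_) (isSchwartzBruhat_iff_complex he)
  · have h1 := complex_quasicharacter hω' (Units.map (e : K →* ℂ) u)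
    have h2 : ω' (Units.map (e : K →* ℂ) u) = ω u := by
      rw [hω'_def, MonoidHom.comp_apply]
      congr 1
      exact Units.ext (by simp)
    rw [h2] at h1
    simpa using h1
  · have h1 : localL ω s = complexL ω' s := by rw [localL, dif_neg hR, dif_pos hC]
    have h2 : ((Module.finrank ℝ ℂ : ℕ) : ℂ) * s + 2 * (complexExponent ω').1
        + ((complexExponent ω').2.natAbs : ℂ)
        = 2 * (s + (complexExponent ω').1 + ((complexExponent ω').2.natAbs : ℂ) / 2) := by
      rw [Complex.finrank_real_complex]
      push_cast
      ring
    rw [h1, complexL, Gammaℂ_eq_mul_Gammaℝ, h2]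

end Complex

end LiftedZeta

/-! ### Tate's theory for all local fields and the conclusion. -/

namespace LiftedZeta

variable {K : Type*} [Field K] [TopologicalSpace K] [IsTopologicalRing K] [LocallyCompactSpace K]
  [MeasurableSpace K] [BorelSpace K]

/-- Tate's local theory: the zeta integrals of a quasi-character of a local field, divided by the
local `L`-function, continue to entire functions. -/
theorem tateContinuation (hK : IsLocalField K) (μ : Measure K) [μ.IsAddHaarMeasure]
    (ω : Kˣ →* ℂˣ) (hω : Continuous ω) : TateContinuation μ ω := by
  by_cases hR : IsRealLocalField K
  · exact tateContinuation_of_real μ hR ω hω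
  by_cases hC : IsComplexLocalField K
  · exact tateContinuation_of_complex μ hC ω hω
  obtain ⟨_, _⟩ := (hK.resolve_left hR).resolve_left hC
  exact tateContinuation_of_nonarch μ hR hC ω hω

lemma measure_univ_eq_top (hK : IsLocalField K) (μ : Measure K) [μ.IsAddHaarMeasure] :
    μ Set.univ = ⊤ := by
  rcases hK with ⟨_, he⟩ | ⟨_, he⟩ | ⟨_, _⟩
  · exact measure_univ_eq_top_of_isHomeomorph he μ
  · exact measure_univ_eq_top_of_isHomeomorph he μ
  · exact measure_univ_eq_top_of_nonarch μ

end LiftedZeta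

theorem mainTheorem6 {F Γ : Type*} [Field F] [AddCommGroup Γ] [LinearOrder Γ]
    [IsOrderedAddMonoid Γ] (V : LiftedZeta.SplitValuation F Γ)
    [TopologicalSpace V.ResidueField] [IsTopologicalRing V.ResidueField]
    [LocallyCompactSpace V.ResidueField]
    [MeasurableSpace V.ResidueField] [BorelSpace V.ResidueField]
    (hK : LiftedZeta.IsLocalField V.ResidueField)
    (μ : MeasureTheory.Measure V.ResidueField) [μ.IsAddHaarMeasure]
    (ψ : AddChar F Circle) (hψ : V.IsGoodCharacter ψ V.one)
    (ω : V.integersˣ →* ℂˣ) (ωbar : V.ResidueFieldˣ →* ℂˣ)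
    (hω : V.IsGoodMulCharacter ω ωbar) :
    (∀ f ∈ V.schwartzSpace ψ, f ∈ V.treatedSpace ψ →
      V.ZetaDefined μ ψ f ω ∧ ∃ Z, V.IsZetaContinuation μ ψ f ω ωbar Z) ∧
    ∃ g ∈ V.schwartzSpace ψ, g ∈ V.treatedSpace ψ ∧
      V.ZetaDefined μ ψ g ω ∧ V.IsZetaContinuation μ ψ g ω ωbar (fun _ => 1) := by
  exact LiftedZeta.SplitValuation.zeta_continuation
    (LiftedZeta.measure_univ_eq_top hK μ) hψ hω
    (LiftedZeta.tateContinuation hK μ ωbar hω.1)
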